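/- **Theorem (Scaling of the partition function in a mixed asymptotics).** Fix $T>0$ and $\chi>0$, and let $W$ be a real random variable with $\mathbb P(W>0)=1$, $\mathbb E[W]=1$, $\mathbb E[W\log_2 W]<1$, $\mathbb P(W=1)<1$ and $\mathbb E[W^p]<\infty$ for all $p\in\mathbb R$. *Cascades.* Let $\{W^{(m)}_r : m\in\mathbb N,\ r\in\{0,1\}^j,\ j\ge 1\}$ be i.i.d. random variables with the law of $W$. For $r=(r_1,\dots,r_j)\in\{0,1\}^j$ put $r|i=(r_1,\dots,r_i)$ and $\overline r=2^j\sum_{i=1}^j r_i2^{-i}$, and let $I_{j,k}=[k2^{-j}T,(k+1)2^{-j}T]$. For each $m$, let $\mu^{(m)}_j$ be the measure on $[0,T]$ whose density with respect to Lebesgue measure equals $\prod_{i=1}^jW^{(m)}_{r|i}$ on $I_{j,\overline r}$ for every $r\in\{0,1\}^j$, and let $\mu_\infty^{(m)}$ be the (almost surely existing) weak limit of $\mu_j^{(m)}$ as $j\to\infty$. Define the random measure $\tilde\mu$ on $[0,\infty)$ by $$\tilde\mu([t_1,t_2])=\sum_{m=0}^{\infty}\mu^{(m)}_\infty([t_1-mT,t_2-mT]),\qquad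 0\le t_1\le t_2 ,$$ and, for $p\in\mathbb R$ and $j\ge 0$, let $$\mathcal S_{\tilde\mu}(j,p)=\sum_{k=0}^{N-1}\tilde\mu(I_{j,k})^p,\qquad N=N_T2^j,\quad N_T=\lfloor 2^{j\chi}\rfloor .$$ *Exponents.* Let $\tau(p)=p-\log_2\mathbb E[W^p]-1$ for $p\in\mathbb R$, and $$p_\chi^+=\inf\{p\ge 1: p\tau'(p)-\tau(p)\le-\chi\}\in(1,\infty],\qquad p_\chi^-=\sup\{p\le 0: p\tau'(p)-\tau(p)\le-\chi\}\in[-\infty,0),$$ with $\inf\emptyset=\infty$ and $\sup\emptyset=-\infty$. When these are finite put $h_\chi^+=\tau'(p_\chi^+)$ and $h_\chi^-=\tau'(p_\chi^-)$. Let $$\tau_\chi(p)=\begin{cases}\tau(p)-\chi, & p\in(p_\chi^-,p_\chi^+),\\ h_\chi^+\,p, & p\ge p_\chi^+,\\ h_\chi^-\,p, & p\le p_\chi^-.\end{cases}$$ *Claim.* Assume that either $p_\chi^+=\infty$ and $\tau(q)>0$ for all $q>1$, or $p_\chi^+<\infty$ and $\tau(p_\chi^+)>0$. Then for every $p\in\mathbb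 R$, almost surely, $$\lim_{j\to\infty}\frac{\log_2\mathcal S_{\tilde\mu}(j,p)}{-j}=\tau_\chi(p).$$ -/

import Mathlib

open MeasureTheory ProbabilityTheory Filter Topology

noncomputable section

/-- Finite words over the alphabet `{0,1}`. The weights of a cascade are attached to the
nonempty words. -/
abbrev Word : Type := List (Fin 2)

/-- For `r = (r₁,…,r_j) ∈ {0,1}^j`, the integer `2^j ∑ r_i 2^{-i} ∈ {0,…,2^j - 1}`
(the entry `r_i` of the mathematics is `r (i-1)` here). -/
def wordIndex {j : ℕ} (r : Fin j → Fin 2) : ℕ :=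
  ∑ i : Fin j, (r i : ℕ) * 2 ^ (j - 1 - (i : ℕ))

/-- The restriction `r|i = (r₁,…,r_i)` of a word `r` of length `j`. -/
def wordRestrict {j : ℕ} (r : Fin j → Fin 2) (i : ℕ) : Word :=
  (List.ofFn r).take i

/-- The dyadic interval `I_{j,k} = [k 2^{-j} T, (k+1) 2^{-j} T]`. -/
def dyadicInterval (T : ℝ) (j k : ℕ) : Set ℝ :=
  Set.Icc ((k : ℝ) * 2 ^ (-(j : ℤ)) * T) (((k : ℝ) + 1) * 2 ^ (-(j : ℤ)) * T)

/-- Lebesgue measure restricted to `I_{j,k}`, as a finite measure on `ℝ`. -/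
def dyadicLebesgue (T : ℝ) (j k : ℕ) : FiniteMeasure ℝ :=
  ⟨volume.restrict (dyadicInterval T j k), by
    unfold dyadicInterval; infer_instance⟩

/-- The `j`-th step `μ_j` of the cascade with weights `w`: the measure carried by `[0,T]` whose
density with respect to Lebesgue measure is `∏_{i=1}^j w_{r|i}` on `I_{j,r̄}` for each
`r ∈ {0,1}^j` (the intervals of level `j` overlap only at end points). -/
def cascadeStep (T : ℝ) (w : Word → ℝ) (j : ℕ) : FiniteMeasure ℝ :=
  ∑ r : Fin j → Fin 2,
    (∏ i ∈ Finset.Icc 1 j, w (wordRestrict r i)).toNNReal • dyadicLebesgue T j (wordIndex r)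

/-- The cascade measure `μ_∞`: the limit of `μ_j` as `j → ∞` in the topology of weak
convergence of finite measures. -/
def cascadeMeasure (T : ℝ) (w : Word → ℝ) : FiniteMeasure ℝ :=
  limUnder atTop (fun j : ℕ => cascadeStep T w j)

/-- The concatenation `μ̃` of the cascades built on the weights `w 0, w 1, …`: the `m`-th one is
translated by `m T`, so that
`μ̃ [t₁,t₂] = ∑_m μ_∞^{(m)} [t₁ - m T, t₂ - m T]`. -/
def concatMeasure (T : ℝ) (w : ℕ → Word → ℝ) : Measure ℝ :=
  Measure.sum fun m : ℕ =>
    (cascadeMeasure T (w m) : Measure ℝ).map (fun t : ℝ => t + (m : ℝ) * T)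

/-- The number of integral scales, `N_T = ⌊(2^j)^χ⌋`. -/
def numScales (χ : ℝ) (j : ℕ) : ℕ := ⌊((2 : ℝ) ^ j) ^ χ⌋₊

/-- The partition function `S_{μ̃}(j,p) = ∑_{k=0}^{N-1} μ̃(I_{j,k})^p` with `N = N_T 2^j`. -/
def partitionFn (T χ : ℝ) (w : ℕ → Word → ℝ) (j : ℕ) (p : ℝ) : ℝ :=
  ∑ k ∈ Finset.range (numScales χ j * 2 ^ j),
    ((concatMeasure T w).real (dyadicInterval T j k)) ^ p

/-- `τ(p) = p - log₂ E[W^p] - 1`, where `ν` is the law of `W`. -/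
def tau (ν : Measure ℝ) (p : ℝ) : ℝ := p - Real.logb 2 (∫ x, x ^ p ∂ν) - 1

/-- `p_χ^+ = inf {p ≥ 1 | p τ'(p) - τ(p) ≤ -χ}`, equal to `⊤` if the set is empty. -/
def pPlus (ν : Measure ℝ) (χ : ℝ) : EReal :=
  sInf ((fun p : ℝ => (p : EReal)) '' {p : ℝ | 1 ≤ p ∧ p * deriv (tau ν) p - tau ν p ≤ -χ})

/-- `p_χ^- = sup {p ≤ 0 | p τ'(p) - τ(p) ≤ -χ}`, equal to `⊥` if the set is empty. -/
def pMinus (ν : Measure ℝ) (χ : ℝ) : EReal :=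
  sSup ((fun p : ℝ => (p : EReal)) '' {p : ℝ | p ≤ 0 ∧ p * deriv (tau ν) p - tau ν p ≤ -χ})

/-- `h_χ^+ = τ'(p_χ^+)`, meaningful when `p_χ^+` is finite. -/
def hPlus (ν : Measure ℝ) (χ : ℝ) : ℝ := deriv (tau ν) (pPlus ν χ).toReal

/-- `h_χ^- = τ'(p_χ^-)`, meaningful when `p_χ^-` is finite. -/
def hMinus (ν : Measure ℝ) (χ : ℝ) : ℝ := deriv (tau ν) (pMinus ν χ).toReal

open Classical in
/-- The exponent `τ_χ`: equal to `h_χ^+ p` for `p ≥ p_χ^+`, to `h_χ^- p` for `p ≤ p_χ^-`, and to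
`τ(p) - χ` for `p ∈ (p_χ^-, p_χ^+)`. -/
def tauMixed (ν : Measure ℝ) (χ p : ℝ) : ℝ :=
  if pPlus ν χ ≤ (p : EReal) then hPlus ν χ * p
  else if (p : EReal) ≤ pMinus ν χ then hMinus ν χ * p
  else tau ν p - χ

end

open scoped ENNReal NNReal

/-! Removing the first generation of each cascade leaves two independent trees, so up to the factor
`(T / 2) ^ p` the partition function at level j + 1 is a sum over 2 N_T i.i.d. trees of an additive
functional X_j (`ofReal_partitionFn`, `IsForest`), with N_T of order 2^{jχ}. Writing Y for the
normalised total mass of a tree, X_j is the sum over the vertices of generation j of the p-th power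
of the halved weights above the vertex times Y^p of its subtree. Its mean is 2^{-jτ(p)} E[Y^p],
because 2 E[(W/2)^p] = 2^{-τ(p)}. Between the critical exponents the sum follows its mean.

This requires 0 < E[Y^p] < ∞. The identity Y = (W/2)(Y_0 + Y_1), with independent Y_0 and Y_1,
controls positive moments as long as τ > 0 on (1, p] (`lintegral_limitMass_rpow_ne_top`), forces Y >
0 almost surely (`ae_limitMass_pos`), and yields all negative moments
(`lintegral_limitMass_rpow_neg_ne_top`).

The upper bound is summability of normalised expectations (`ae_forestSum_le`). The lower bound is a
Chernoff estimate using only moments of X_j of an order q slightly above 1 (`exists_moment_bound`,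
`ae_le_forestSum`). It works if q τ(p) - τ(pq) < (q - 1)χ for some such q; differentiating at q = 1,
this follows from pτ'(p) - τ(p) > -χ, which holds strictly between the critical exponents
(`lt_tangentDepth`, `exists_exponents`).

At a finite critical exponent s, the tangent to χ - τ passes through the origin. Beyond s,
log-convexity of the partition function in p bounds it below by extrapolated secants, and comparison
of ℓ^c with ℓ^1 norms bounds it above by a ray from the origin. Both tend to the tangent, so the
exponent is linear there (`tendsto_of_convexOn`). -/

namespace Cascade

/-! ### The tree of i.i.d. weights and its self-similarity. -/

/-- The subtree of a weighted binary tree rooted at the child `i` of the root. -/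
def shift (i : Fin 2) (w : Word → ℝ) : Word → ℝ := fun r => w (i :: r)

/-- The law of a binary tree with i.i.d. weights of law `ν`, the root included. -/
noncomputable def treeLaw (ν : Measure ℝ) : Measure (Word → ℝ) := Measure.infinitePi fun _ => ν

/-- The tree with root weight `x.1` and subtrees `x.2.1`, `x.2.2`. -/
def graft (x : ℝ × (Word → ℝ) × (Word → ℝ)) : Word → ℝ
  | [] => x.1
  | i :: r => if i = 0 then x.2.1 r else x.2.2 r

lemma measurable_shift (i : Fin 2) : Measurable (shift i) := by
  unfold shift; fun_prop

lemma measurable_graft : Measurable graft := by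
  refine measurable_pi_iff.2 fun r => ?_
  cases r with
  | nil => exact measurable_fst
  | cons i r =>
    by_cases h : i = 0
    · simp only [graft, h, if_true]; fun_prop
    · simp only [graft, h, if_false]; fun_prop

lemma split_graft (x : ℝ × (Word → ℝ) × (Word → ℝ)) :
    (graft x [], shift 0 (graft x), shift 1 (graft x)) = x := by
  obtain ⟨a, u, v⟩ := x
  simp only [graft, Prod.mk.injEq, true_and]
  exact ⟨funext fun r => by simp [shift, graft], funext fun r => by simp [shift, graft]⟩

section Law

variable (ν : Measure ℝ) [IsProbabilityMeasure ν]

instance : IsProbabilityMeasure (treeLaw ν) := by unfold treeLaw; infer_instance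

/-- An infinite product measure is determined on finite boxes. The preimage of a box under `graft`
is again a box: the words in its support split into the root, those starting with 0 and those
starting with 1. All independence between the root and the two subtrees comes from here. -/
lemma map_graft : (ν.prod ((treeLaw ν).prod (treeLaw ν))).map graft = treeLaw ν := by
  classical
  refine Measure.eq_infinitePi _ fun s t ht => ?_
  have inj : ∀ i : Fin 2, Function.Injective (fun r : Word => i :: r) :=
    fun i r r' h => (List.cons.inj h).2
  have hpre : graft ⁻¹' (Set.pi s t) =
      (if [] ∈ s then t [] else Set.univ) ×ˢ
        (Set.pi (s.preimage (fun r => (0 : Fin 2) :: r) (inj 0).injOn) (fun r => t (0 :: r)) ×ˢ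
          Set.pi (s.preimage (fun r => (1 : Fin 2) :: r) (inj 1).injOn) (fun r => t (1 :: r))) := by
    ext ⟨a, u, v⟩
    simp only [Set.mem_preimage, Set.mem_pi, Set.mem_prod, Finset.mem_coe, Finset.mem_preimage]
    constructor
    · intro h
      refine ⟨?_, fun r hr => by simpa [graft] using h _ hr, fun r hr => by
        simpa [graft] using h _ hr⟩
      split_ifs with h0
      · exact h _ h0
      · trivial
    · rintro ⟨h1, h2, h3⟩ r hr
      match r with
      | [] => simpa [graft, hr] using h1
      | i :: r =>
        fin_cases i
        · simpa [graft] using h2 r hr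
        · simpa [graft] using h3 r hr
  rw [Measure.map_apply measurable_graft (MeasurableSet.pi s.countable_toSet fun i _ => ht i),
    hpre, Measure.prod_prod, Measure.prod_prod, treeLaw, Measure.infinitePi_pi _ fun i _ => ht _,
    Measure.infinitePi_pi _ fun i _ => ht _,
    Finset.prod_preimage' (fun r => (0 : Fin 2) :: r) s _ (fun r => ν (t r)),
    Finset.prod_preimage' (fun r => (1 : Fin 2) :: r) s _ (fun r => ν (t r)),
    ← Finset.prod_filter_mul_prod_filter_not s (fun r => r = []),
    ← Finset.prod_filter_mul_prod_filter_not (s.filter fun r => ¬ r = [])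
      (fun r => r ∈ Set.range fun r => (0 : Fin 2) :: r)]
  congr 1
  · rw [show (s.filter fun r => r = []) = if [] ∈ s then {[]} else ∅ from Finset.filter_eq' s []]
    split_ifs <;> simp
  · congr 1
    · refine Finset.prod_congr ?_ fun _ _ => rfl
      ext r
      simp only [Finset.mem_filter, Set.mem_range]
      aesop
    · refine Finset.prod_congr ?_ fun _ _ => rfl
      ext r
      simp only [Finset.mem_filter, Set.mem_range]
      match r with
      | [] => simp
      | i :: r => fin_cases i <;> simp

lemma measurePreserving_split :
    MeasurePreserving (fun w : Word → ℝ => (w [], shift 0 w, shift 1 w)) (treeLaw ν)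
      (ν.prod ((treeLaw ν).prod (treeLaw ν))) := by
  have hm : Measurable (fun w : Word → ℝ => (w [], shift 0 w, shift 1 w)) :=
    (measurable_pi_apply _).prodMk ((measurable_shift 0).prodMk (measurable_shift 1))
  refine ⟨hm, ?_⟩
  conv_lhs => rw [← map_graft ν]
  rw [Measure.map_map hm measurable_graft]
  have : (fun w : Word → ℝ => (w [], shift 0 w, shift 1 w)) ∘ graft = id :=
    funext split_graft
  rw [this, Measure.map_id]

lemma measurePreserving_root : MeasurePreserving (fun w : Word → ℝ => w []) (treeLaw ν) ν :=
  measurePreserving_fst.comp (measurePreserving_split ν)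

lemma measurePreserving_shift (i : Fin 2) :
    MeasurePreserving (shift i) (treeLaw ν) (treeLaw ν) := by
  fin_cases i
  · exact (measurePreserving_fst.comp measurePreserving_snd).comp (measurePreserving_split ν)
  · exact (measurePreserving_snd.comp measurePreserving_snd).comp (measurePreserving_split ν)

lemma lintegral_split {f : ℝ → ℝ≥0∞} {g h : (Word → ℝ) → ℝ≥0∞} (hf : Measurable f)
    (hg : Measurable g) (hh : Measurable h) :
    ∫⁻ w, f (w []) * (g (shift 0 w) * h (shift 1 w)) ∂(treeLaw ν) =
      (∫⁻ x, f x ∂ν) * ((∫⁻ w, g w ∂(treeLaw ν)) * ∫⁻ w, h w ∂(treeLaw ν)) := by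
  have := (measurePreserving_split ν).lintegral_comp
    (f := fun x => f x.1 * (g x.2.1 * h x.2.2)) (by fun_prop)
  rw [this, lintegral_prod_mul hf.aemeasurable
    (g := fun y : (Word → ℝ) × (Word → ℝ) => g y.1 * h y.2) (by fun_prop),
    lintegral_prod_mul hg.aemeasurable hh.aemeasurable]

lemma lintegral_root_shift {f : ℝ → ℝ≥0∞} {g : (Word → ℝ) → ℝ≥0∞} (hf : Measurable f)
    (hg : Measurable g) (i : Fin 2) :
    ∫⁻ w, f (w []) * g (shift i w) ∂(treeLaw ν) =
      (∫⁻ x, f x ∂ν) * ∫⁻ w, g w ∂(treeLaw ν) := by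
  fin_cases i
  · simpa using lintegral_split ν hf hg (measurable_const (a := (1 : ℝ≥0∞)))
  · simpa using lintegral_split ν hf (measurable_const (a := (1 : ℝ≥0∞))) hg

end Law

/-! ### Additive functionals of a tree and their moments. -/

/-- The weighted sum, over the vertices of generation `n`, of the product of the `p`-th powers of
the halved weights above the vertex, times the functional `Z` of the subtree at the vertex. -/
noncomputable def weightedSum (p : ℝ) (Z : (Word → ℝ) → ℝ≥0∞) : ℕ → (Word → ℝ) → ℝ≥0∞
  | 0, w => Z w
  | n + 1, w => (ENNReal.ofReal (w []) / 2) ^ p *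
      (weightedSum p Z n (shift 0 w) + weightedSum p Z n (shift 1 w))

lemma measurable_weightedSum (p : ℝ) {Z : (Word → ℝ) → ℝ≥0∞} (hZ : Measurable Z) (n : ℕ) :
    Measurable (weightedSum p Z n) := by
  induction n with
  | zero => exact hZ
  | succ n ih =>
    have h0 := ih.comp (measurable_shift 0)
    have h1 := ih.comp (measurable_shift 1)
    have h2 : Measurable (fun w : Word → ℝ => (ENNReal.ofReal (w []) / 2) ^ p) := by fun_prop
    exact h2.mul (h0.add h1)

/-- `E[(W / 2)^p]`, as an extended nonnegative real. -/
noncomputable def halfMoment (ν : Measure ℝ) (p : ℝ) : ℝ≥0∞ :=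
  ∫⁻ x, (ENNReal.ofReal x / 2) ^ p ∂ν

lemma lintegral_weightedSum (ν : Measure ℝ) [IsProbabilityMeasure ν] (p : ℝ)
    {Z : (Word → ℝ) → ℝ≥0∞} (hZ : Measurable Z) (n : ℕ) :
    ∫⁻ w, weightedSum p Z n w ∂(treeLaw ν) =
      (2 * halfMoment ν p) ^ n * ∫⁻ w, Z w ∂(treeLaw ν) := by
  induction n with
  | zero => simp [weightedSum]
  | succ n ih =>
    have hm := measurable_weightedSum p hZ n
    have hf : Measurable fun x : ℝ => (ENNReal.ofReal x / 2) ^ p := by fun_prop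
    simp only [weightedSum, mul_add]
    rw [lintegral_add_left, lintegral_root_shift ν hf hm 0, lintegral_root_shift ν hf hm 1, ih,
      halfMoment]
    · ring
    · exact (hf.comp (measurable_pi_apply _)).mul (hm.comp (measurable_shift 0))

/-- Bernoulli's inequality for (1 - y/(x+y))^q bounds the defect by q (x+y)^{q-1} y, and then y ≤
x^{1/2} y^{1/2}. Splitting off a square root leaves both exponents of the cross term strictly below
q, so cross terms are controlled by lower moments. -/
lemma add_rpow_le_of_le {q x y : ℝ} (hq : 1 ≤ q) (hy : 0 ≤ y) (hyx : y ≤ x) :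
    (x + y) ^ q ≤ x ^ q + q * 2 ^ q * (x ^ (q - 1 / 2) * y ^ (1 / 2 : ℝ)) := by
  rcases eq_or_lt_of_le (hy.trans hyx) with hx | hx
  · have hy0 : y = 0 := le_antisymm (hx ▸ hyx) hy
    subst hy0 hx
    simp
  have hxy : 0 < x + y := by linarith
  have h1 : (x + y) ^ q * (1 + q * (-(y / (x + y)))) ≤ x ^ q := by
    have hb := one_add_mul_self_le_rpow_one_add (s := -(y / (x + y))) (p := q)
      (by rw [neg_le_neg_iff, div_le_one hxy]; linarith) hq
    have he : 1 + -(y / (x + y)) = x / (x + y) := by field_simp; ring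
    rw [he, Real.div_rpow hx.le hxy.le] at hb
    calc _ ≤ (x + y) ^ q * (x ^ q / (x + y) ^ q) := by gcongr
      _ = x ^ q := by
        have := (Real.rpow_pos_of_pos hxy q).ne'
        field_simp
  have h2 : (x + y) ^ q * (y / (x + y)) ≤ 2 ^ q * (x ^ (q - 1 / 2) * y ^ (1 / 2 : ℝ)) := by
    have e1 : (x + y) ^ q * (y / (x + y)) = (x + y) ^ (q - 1) * y := by
      rw [Real.rpow_sub_one hxy.ne']; ring
    have e2 : y = y ^ (1 / 2 : ℝ) * y ^ (1 / 2 : ℝ) := by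
      rw [← Real.sqrt_eq_rpow, Real.mul_self_sqrt hy]
    have e3 : (2 * x) ^ (q - 1) = 2 ^ (q - 1) * x ^ (q - 1) := Real.mul_rpow (by norm_num) hx.le
    have e4 : x ^ (q - 1) * x ^ (1 / 2 : ℝ) = x ^ (q - 1 / 2) := by
      rw [← Real.rpow_add hx]; ring_nf
    calc (x + y) ^ q * (y / (x + y)) = (x + y) ^ (q - 1) * y := e1
      _ ≤ (2 * x) ^ (q - 1) * y := by
        gcongr
        linarith
      _ = 2 ^ (q - 1) * x ^ (q - 1) * (y ^ (1 / 2 : ℝ) * y ^ (1 / 2 : ℝ)) := by rw [e3, ← e2]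
      _ ≤ 2 ^ q * x ^ (q - 1) * (x ^ (1 / 2 : ℝ) * y ^ (1 / 2 : ℝ)) := by
        gcongr
        · norm_num
        · linarith
      _ = _ := by rw [← e4]; ring
  nlinarith [h1, mul_le_mul_of_nonneg_left h2 (by linarith : (0 : ℝ) ≤ q)]

/-- A superadditivity defect bound for the `q`-th power. -/
lemma add_rpow_le_add_cross {q : ℝ} (hq : 1 ≤ q) (x y : ℝ≥0∞) :
    (x + y) ^ q ≤ x ^ q + y ^ q + ENNReal.ofReal (q * 2 ^ q) *
      (x ^ (q - 1 / 2) * y ^ (1 / 2 : ℝ) + x ^ (1 / 2 : ℝ) * y ^ (q - 1 / 2)) := by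
  have hq0 : 0 < q := by linarith
  have key : ∀ x y : ℝ≥0, y ≤ x → ((x : ℝ≥0∞) + y) ^ q ≤ (x : ℝ≥0∞) ^ q +
      ENNReal.ofReal (q * 2 ^ q) * ((x : ℝ≥0∞) ^ (q - 1 / 2) * (y : ℝ≥0∞) ^ (1 / 2 : ℝ)) := by
    intro x y hyx
    have h := add_rpow_le_of_le hq y.2 (NNReal.coe_le_coe.2 hyx)
    rw [← ENNReal.coe_add, ← ENNReal.coe_rpow_of_nonneg _ hq0.le,
      ← ENNReal.coe_rpow_of_nonneg _ hq0.le, ← ENNReal.coe_rpow_of_nonneg _ (by linarith),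
      ← ENNReal.coe_rpow_of_nonneg _ (by norm_num), ENNReal.ofReal, ← ENNReal.coe_mul,
      ← ENNReal.coe_mul, ← ENNReal.coe_add, ENNReal.coe_le_coe, ← NNReal.coe_le_coe]
    push_cast
    rw [Real.coe_toNNReal _ (by positivity)]
    exact h
  rcases eq_or_ne x ⊤ with rfl | hx
  · simp [ENNReal.top_rpow_of_pos hq0]
  rcases eq_or_ne y ⊤ with rfl | hy
  · simp [ENNReal.top_rpow_of_pos hq0]
  lift x to ℝ≥0 using hx
  lift y to ℝ≥0 using hy
  rcases le_total y x with h | h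
  · refine (key x y h).trans ?_
    gcongr
    · exact le_self_add
    · exact le_self_add
  · rw [add_comm (x : ℝ≥0∞) y]
    refine (key y x h).trans ?_
    gcongr
    · exact le_add_self
    · rw [mul_comm]; exact le_add_self

/-- One step of the recursion for the `q`-th moment of the weighted sums. -/
lemma lintegral_weightedSum_rpow_succ_le (ν : Measure ℝ) [IsProbabilityMeasure ν] (p : ℝ) {q : ℝ}
    (hq : 1 ≤ q) {Z : (Word → ℝ) → ℝ≥0∞} (hZ : Measurable Z) (n : ℕ) :
    ∫⁻ w, weightedSum p Z (n + 1) w ^ q ∂(treeLaw ν) ≤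
      (2 * halfMoment ν (p * q)) * (∫⁻ w, weightedSum p Z n w ^ q ∂(treeLaw ν) +
        ENNReal.ofReal (q * 2 ^ q) * ((∫⁻ w, weightedSum p Z n w ^ (q - 1 / 2) ∂(treeLaw ν)) *
          ∫⁻ w, weightedSum p Z n w ^ (1 / 2 : ℝ) ∂(treeLaw ν))) := by
  have hm := measurable_weightedSum p hZ n
  have hf : Measurable fun x : ℝ => (ENNReal.ofReal x / 2) ^ (p * q) := by fun_prop
  have hpow : ∀ s : ℝ, Measurable fun w => weightedSum p Z n w ^ s := fun s => hm.pow_const s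
  set C := ENNReal.ofReal (q * 2 ^ q)
  set a := ∫⁻ w, weightedSum p Z n w ^ q ∂(treeLaw ν)
  set b := ∫⁻ w, weightedSum p Z n w ^ (q - 1 / 2) ∂(treeLaw ν)
  set c := ∫⁻ w, weightedSum p Z n w ^ (1 / 2 : ℝ) ∂(treeLaw ν)
  have m0 : ∀ s : ℝ, Measurable fun w => weightedSum p Z n (shift 0 w) ^ s :=
    fun s => (hpow s).comp (measurable_shift 0)
  have m1 : ∀ s : ℝ, Measurable fun w => weightedSum p Z n (shift 1 w) ^ s :=
    fun s => (hpow s).comp (measurable_shift 1)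
  have mf : Measurable fun w : Word → ℝ => (ENNReal.ofReal (w []) / 2) ^ (p * q) :=
    hf.comp (measurable_pi_apply _)
  have h1 : ∀ w : Word → ℝ, weightedSum p Z (n + 1) w ^ q ≤
      ((ENNReal.ofReal (w []) / 2) ^ (p * q) * weightedSum p Z n (shift 0 w) ^ q +
      (ENNReal.ofReal (w []) / 2) ^ (p * q) * weightedSum p Z n (shift 1 w) ^ q) +
      (C * ((ENNReal.ofReal (w []) / 2) ^ (p * q) * (weightedSum p Z n (shift 0 w) ^ (q - 1 / 2) *
        weightedSum p Z n (shift 1 w) ^ (1 / 2 : ℝ))) +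
      C * ((ENNReal.ofReal (w []) / 2) ^ (p * q) * (weightedSum p Z n (shift 0 w) ^ (1 / 2 : ℝ) *
        weightedSum p Z n (shift 1 w) ^ (q - 1 / 2)))) := by
    intro w
    rw [weightedSum, ENNReal.mul_rpow_of_nonneg _ _ (by linarith), ← ENNReal.rpow_mul]
    refine (mul_le_mul_right (add_rpow_le_add_cross hq _ _) _).trans (le_of_eq ?_)
    ring
  refine (lintegral_mono h1).trans (le_of_eq ?_)
  have k0 : Measurable fun w : Word → ℝ =>
    (ENNReal.ofReal (w []) / 2) ^ (p * q) * weightedSum p Z n (shift 0 w) ^ q := mf.mul (m0 q)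
  have k1 : Measurable fun w : Word → ℝ =>
    (ENNReal.ofReal (w []) / 2) ^ (p * q) * weightedSum p Z n (shift 1 w) ^ q := mf.mul (m1 q)
  have kc : ∀ s t : ℝ, Measurable fun w : Word → ℝ => (ENNReal.ofReal (w []) / 2) ^ (p * q) *
    (weightedSum p Z n (shift 0 w) ^ s * weightedSum p Z n (shift 1 w) ^ t) :=
    fun s t => mf.mul ((m0 s).mul (m1 t))
  have k01 : Measurable fun w : Word → ℝ =>
    (ENNReal.ofReal (w []) / 2) ^ (p * q) * weightedSum p Z n (shift 0 w) ^ q +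
    (ENNReal.ofReal (w []) / 2) ^ (p * q) * weightedSum p Z n (shift 1 w) ^ q := k0.add k1
  rw [lintegral_add_left k01, lintegral_add_left k0,
    lintegral_add_left ((kc _ _).const_mul C),
    lintegral_const_mul _ (kc _ _), lintegral_const_mul _ (kc _ _),
    lintegral_split ν hf (hpow _) (hpow _), lintegral_split ν hf (hpow _) (hpow _),
    lintegral_root_shift ν hf (hpow q) 0, lintegral_root_shift ν hf (hpow q) 1]
  simp only [halfMoment]
  ring

/-! ### The mass martingale and its limit. -/

/-- The integrability conditions on the law of a cascade generator. -/
structure GeneratorLaw (ν : Measure ℝ) : Prop where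
  pos : ∀ᵐ x ∂ν, 0 < x
  moments : ∀ q : ℝ, Integrable (fun x : ℝ => x ^ q) ν
  mean : ∫ x, x ∂ν = 1

/-- The subtree rooted at the vertex `s`. -/
def subtree (s : Word) (w : Word → ℝ) : Word → ℝ := fun r => w (s ++ r)

lemma shift_subtree (i : Fin 2) (s : Word) (w : Word → ℝ) :
    shift i (subtree s w) = subtree (s ++ [i]) w := by
  funext r; simp [shift, subtree]

lemma subtree_shift (i : Fin 2) (s : Word) (w : Word → ℝ) :
    subtree s (shift i w) = subtree (i :: s) w := by
  funext r; simp [shift, subtree]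

lemma measurable_subtree (s : Word) : Measurable (subtree s) := by
  unfold subtree; fun_prop

lemma measurePreserving_subtree (ν : Measure ℝ) [IsProbabilityMeasure ν] (s : Word) :
    MeasurePreserving (subtree s) (treeLaw ν) (treeLaw ν) :=
  ⟨measurable_subtree s, Measure.map_infinitePi_infinitePi_of_inj
    (P := fun _ : Word => ν) (f := fun r => s ++ r) fun _ _ h => List.append_cancel_left h⟩

/-- The normalised mass of the `n`-th step of the cascade on a tree. -/
noncomputable def stepMass (n : ℕ) : (Word → ℝ) → ℝ≥0∞ := weightedSum 1 (fun _ => 1) n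

/-- The normalised mass of the limit cascade on a tree. -/
noncomputable def limitMass (w : Word → ℝ) : ℝ≥0∞ := limsup (fun n => stepMass n w) atTop

lemma stepMass_zero (w : Word → ℝ) : stepMass 0 w = 1 := rfl

lemma stepMass_succ (n : ℕ) (w : Word → ℝ) : stepMass (n + 1) w =
    ENNReal.ofReal (w []) / 2 * (stepMass n (shift 0 w) + stepMass n (shift 1 w)) := by
  simp only [stepMass, weightedSum, ENNReal.rpow_one]

lemma measurable_stepMass (n : ℕ) : Measurable (stepMass n) :=
  measurable_weightedSum 1 measurable_const n

lemma measurable_limitMass : Measurable limitMass :=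
  Measurable.limsup measurable_stepMass

lemma stepMass_ne_top (n : ℕ) (w : Word → ℝ) : stepMass n w ≠ ⊤ := by
  induction n generalizing w with
  | zero => simp [stepMass_zero]
  | succ n ih =>
    rw [stepMass_succ]
    exact ENNReal.mul_ne_top (ENNReal.div_ne_top ENNReal.ofReal_ne_top (by simp))
      (ENNReal.add_ne_top.2 ⟨ih _, ih _⟩)

lemma toReal_stepMass_succ (n : ℕ) (w : Word → ℝ) : (stepMass (n + 1) w).toReal =
    max (w []) 0 / 2 * ((stepMass n (shift 0 w)).toReal + (stepMass n (shift 1 w)).toReal) := by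
  rw [stepMass_succ, ENNReal.toReal_mul, ENNReal.toReal_add (stepMass_ne_top _ _)
    (stepMass_ne_top _ _), ENNReal.toReal_div, ENNReal.toReal_ofReal']
  simp

section Moments

lemma GeneratorLaw.halfMoment_one {ν : Measure ℝ} (hν : GeneratorLaw ν) : 2 * halfMoment ν 1 = 1 := by
  have h1 : Integrable (fun x : ℝ => x) ν := by simpa using hν.moments 1
  have h2 : ∫⁻ x, ENNReal.ofReal x ∂ν = 1 := by
    rw [← ofReal_integral_eq_lintegral_ofReal h1 (hν.pos.mono fun x hx => hx.le), hν.mean]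
    simp
  simp only [halfMoment, ENNReal.rpow_one, ENNReal.div_eq_inv_mul]
  rw [lintegral_const_mul _ (by fun_prop), h2, mul_one]
  exact ENNReal.mul_inv_cancel (by simp) (by simp)

variable {ν : Measure ℝ} [IsProbabilityMeasure ν]

lemma GeneratorLaw.lintegral_stepMass (hν : GeneratorLaw ν) (n : ℕ) :
    ∫⁻ w, stepMass n w ∂(treeLaw ν) = 1 := by
  rw [stepMass, lintegral_weightedSum ν 1 measurable_const, hν.halfMoment_one]
  simp

lemma GeneratorLaw.integrable_stepMass (hν : GeneratorLaw ν) (n : ℕ) :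
    Integrable (fun w => (stepMass n w).toReal) (treeLaw ν) :=
  integrable_toReal_of_lintegral_ne_top (measurable_stepMass n).aemeasurable
    (by simp [hν.lintegral_stepMass])

end Moments

/-- The filtration generated by the weights of the words of length less than `k`. -/
def generation : Filtration ℕ (MeasurableSpace.pi : MeasurableSpace (Word → ℝ)) where
  seq k := ⨆ s ∈ {s : Word | s.length < k},
    MeasurableSpace.comap (fun w : Word → ℝ => w s) inferInstance
  mono' _ _ h := biSup_mono fun _ hs => lt_of_lt_of_le hs h
  le' _ := iSup₂_le fun s _ => (measurable_pi_apply s).comap_le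

lemma measurable_generation_apply {s : Word} {k : ℕ} (h : s.length < k) :
    Measurable[generation k] fun w : Word → ℝ => w s :=
  Measurable.of_comap_le (le_iSup₂_of_le (f := fun (s : Word) (_ : s ∈ {s : Word | s.length < k}) =>
    MeasurableSpace.comap (fun w : Word → ℝ => w s) inferInstance) s h le_rfl)

lemma measurable_generation_stepMass (n : ℕ) : ∀ (s : Word) {k : ℕ}, s.length + n ≤ k →
    Measurable[generation k] fun w => (stepMass n (subtree s w)).toReal := by
  induction n with
  | zero =>
    intro s k _
    simp only [stepMass_zero]
    exact @measurable_const _ _ _ (generation k) _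
  | succ n ih =>
    intro s k h
    simp only [toReal_stepMass_succ, shift_subtree]
    have h0 := ih (s ++ [0]) (k := k) (by simp; omega)
    have h1 := ih (s ++ [1]) (k := k) (by simp; omega)
    have h2 : Measurable[generation k] fun w : Word → ℝ => subtree s w [] := by
      simpa [subtree] using measurable_generation_apply (s := s) (k := k) (by omega)
    exact ((h2.max (@measurable_const _ _ _ (generation k) _)).div_const 2).mul (h0.add h1)

variable {ν : Measure ℝ} [IsProbabilityMeasure ν]

lemma indep_generation (s : Word) {k : ℕ} (h : k ≤ s.length) :
    Indep (MeasurableSpace.comap (fun w : Word → ℝ => w s) inferInstance) (generation k)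
      (treeLaw ν) := by
  have hi : iIndepFun (fun (s : Word) (w : Word → ℝ) => w s) (treeLaw ν) :=
    iIndepFun_infinitePi (P := fun _ : Word => ν) (X := fun _ x => x) fun _ => measurable_id
  have := indep_iSup_of_disjoint (S := {s}) (T := {r : Word | r.length < k})
    (fun r => (measurable_pi_apply r).comap_le) hi.iIndep
    (Set.disjoint_singleton_left.2 (by simpa using h))
  simpa [generation] using! this

/-- The induction runs over subtrees: a weight already known at generation k is pulled out of the
conditional expectation and the identity is used for both children. Only at n = 0 is a fresh weight
averaged; it is independent of the past and has mean one. -/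
lemma GeneratorLaw.condExp_stepMass (hν : GeneratorLaw ν) (n : ℕ) : ∀ (s : Word) (k : ℕ),
    s.length + n = k → (treeLaw ν)[fun w => (stepMass (n + 1) (subtree s w)).toReal | generation k]
      =ᵐ[treeLaw ν] fun w => (stepMass n (subtree s w)).toReal := by
  have hint : ∀ n s, Integrable (fun w => (stepMass n (subtree s w)).toReal) (treeLaw ν) :=
    fun n s => (measurePreserving_subtree ν s).integrable_comp_of_integrable
      (hν.integrable_stepMass n)
  induction n with
  | zero =>
    intro s k h
    have hm : Measurable[MeasurableSpace.comap (fun w : Word → ℝ => w s) inferInstance]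
        fun w => (stepMass (0 + 1) (subtree s w)).toReal := by
      have : (fun w => (stepMass (0 + 1) (subtree s w)).toReal) =
          (fun x : ℝ => max x 0 / 2 * (1 + 1)) ∘ fun w : Word → ℝ => w s := by
        funext w
        simp [toReal_stepMass_succ, stepMass_zero, subtree]
      rw [this]
      exact (by fun_prop : Measurable fun x : ℝ => max x 0 / 2 * (1 + 1)).comp
        (comap_measurable _)
    refine (condExp_indep_eq (measurable_pi_apply s).comap_le (generation.le k)
      hm.stronglyMeasurable (indep_generation s (by omega))).trans (Eventually.of_forall fun w => ?_)
    simp only [stepMass_zero, ENNReal.toReal_one]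
    have hm' : Measurable fun w => stepMass (0 + 1) (subtree s w) :=
      (measurable_stepMass _).comp (measurable_subtree s)
    rw [integral_toReal hm'.aemeasurable
      (Eventually.of_forall fun w => (stepMass_ne_top _ _).lt_top),
      (measurePreserving_subtree ν s).lintegral_comp (measurable_stepMass _),
      hν.lintegral_stepMass, ENNReal.toReal_one]
  | succ n ih =>
    intro s k h
    have i0 := ih (s ++ [0]) k (by simp; omega)
    have i1 := ih (s ++ [1]) k (by simp; omega)
    have h2 : Measurable[generation k] fun w : Word → ℝ => max (w s) 0 / 2 :=
      ((measurable_generation_apply (by omega)).max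
        (@measurable_const _ _ _ (generation k) _)).div_const 2
    have e : ∀ n, (fun w => (stepMass (n + 1) (subtree s w)).toReal) =
        (fun w : Word → ℝ => max (w s) 0 / 2) * ((fun w => (stepMass n (subtree (s ++ [0]) w)).toReal) +
          fun w => (stepMass n (subtree (s ++ [1]) w)).toReal) := by
      intro n
      funext w
      simp [toReal_stepMass_succ, shift_subtree, subtree]
    rw [e (n + 1), e n]
    refine (condExp_mul_of_stronglyMeasurable_left h2.stronglyMeasurable (by rw [← e]; exact hint _ _)
      ((hint _ _).add (hint _ _))).trans ?_
    filter_upwards [condExp_add (hint (n + 1) (s ++ [0])) (hint (n + 1) (s ++ [1])) (generation k),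
      i0, i1] with w h3 h4 h5
    simp only [Pi.mul_apply, h3, Pi.add_apply, h4, h5]

lemma GeneratorLaw.ae_tendsto_stepMass (hν : GeneratorLaw ν) :
    ∀ᵐ w ∂(treeLaw ν), Tendsto (fun n => stepMass n w) atTop (𝓝 (limitMass w)) ∧
      limitMass w ≠ ⊤ := by
  have hmart : Martingale (fun n w => (stepMass n w).toReal) generation (treeLaw ν) := by
    refine martingale_nat (fun n => ?_) hν.integrable_stepMass fun n => ?_
    · exact (measurable_generation_stepMass n [] (by simp)).stronglyMeasurable
    · exact (hν.condExp_stepMass n [] n (by simp)).symm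
  have hb : ∀ n, eLpNorm (fun w => (stepMass n w).toReal) 1 (treeLaw ν) ≤ (1 : ℝ≥0) := by
    intro n
    rw [eLpNorm_one_eq_lintegral_enorm]
    refine le_of_eq ?_
    rw [ENNReal.coe_one, ← hν.lintegral_stepMass n]
    refine lintegral_congr fun w => ?_
    rw [Real.enorm_of_nonneg ENNReal.toReal_nonneg, ENNReal.ofReal_toReal (stepMass_ne_top n w)]
  filter_upwards [hmart.submartingale.exists_ae_tendsto_of_bdd hb] with w ⟨c, hc⟩
  have h1 : Tendsto (fun n => stepMass n w) atTop (𝓝 (ENNReal.ofReal c)) := by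
    refine ((ENNReal.continuous_ofReal.tendsto c).comp hc).congr fun n => ?_
    exact ENNReal.ofReal_toReal (stepMass_ne_top n w)
  have h2 : limitMass w = ENNReal.ofReal c := h1.limsup_eq
  exact ⟨h2 ▸ h1, h2 ▸ ENNReal.ofReal_ne_top⟩

/-! ### Positive moments of the limit mass and non-degeneracy. -/

section Generator

variable {ν : Measure ℝ} [IsProbabilityMeasure ν]

lemma GeneratorLaw.integral_rpow_pos (hν : GeneratorLaw ν) (p : ℝ) : 0 < ∫ x, x ^ p ∂ν := by
  rw [integral_pos_iff_support_of_nonneg_ae (hν.pos.mono fun x hx => Real.rpow_nonneg hx.le p)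
    (hν.moments p)]
  have : ν (Function.support fun x : ℝ => x ^ p) = 1 := by
    refine (prob_compl_eq_zero_iff₀ ?_).1 ?_
    · exact (by fun_prop : Measurable fun x : ℝ => x ^ p).nullMeasurable
        (measurableSet_singleton 0).compl
    · refine measure_mono_null (t := {x | ¬ 0 < x}) (fun x hx hpos => hx ?_) hν.pos
      exact (Real.rpow_pos_of_pos hpos p).ne'
  rw [this]; norm_num

lemma GeneratorLaw.lintegral_rpow {ν : Measure ℝ} (hν : GeneratorLaw ν) (p : ℝ) :
    ∫⁻ x, ENNReal.ofReal x ^ p ∂ν = ENNReal.ofReal (∫ x, x ^ p ∂ν) := by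
  rw [ofReal_integral_eq_lintegral_ofReal (hν.moments p)
    (hν.pos.mono fun x hx => Real.rpow_nonneg hx.le p)]
  exact lintegral_congr_ae (hν.pos.mono fun x hx => ENNReal.ofReal_rpow_of_pos hx)

lemma GeneratorLaw.two_mul_halfMoment (hν : GeneratorLaw ν) (p : ℝ) :
    2 * halfMoment ν p = ENNReal.ofReal (2 ^ (-tau ν p)) := by
  have h1 : halfMoment ν p = ENNReal.ofReal (2 ^ (-p)) * ENNReal.ofReal (∫ x, x ^ p ∂ν) := by
    rw [← hν.lintegral_rpow, ← lintegral_const_mul _ (by fun_prop)]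
    refine lintegral_congr_ae (hν.pos.mono fun x hx => ?_)
    rw [← ENNReal.ofReal_rpow_of_pos (by norm_num : (0 : ℝ) < 2)]
    simp only [ENNReal.div_eq_inv_mul, ENNReal.ofReal_ofNat]
    rw [ENNReal.mul_rpow_of_ne_top (by simp) ENNReal.ofReal_ne_top, ENNReal.inv_rpow,
      ENNReal.rpow_neg]
  have h2 : (2 : ℝ) ^ (-tau ν p) = 2 * (2 ^ (-p) * ∫ x, x ^ p ∂ν) := by
    rw [tau, show -(p - Real.logb 2 (∫ x, x ^ p ∂ν) - 1) =
      1 + (-p + Real.logb 2 (∫ x, x ^ p ∂ν)) by ring, Real.rpow_add (by norm_num),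
      Real.rpow_add (by norm_num), Real.rpow_logb (by norm_num) (by norm_num)
      (hν.integral_rpow_pos p), Real.rpow_one]
  rw [h1, h2, ENNReal.ofReal_mul (by norm_num), ENNReal.ofReal_mul (by positivity)]
  simp

end Generator

lemma exists_bound_of_contraction {a : ℕ → ℝ≥0∞} {α B : ℝ≥0∞} (hα : α < 1) (hB : B ≠ ⊤)
    (h0 : a 0 ≠ ⊤) (h : ∀ n, a (n + 1) ≤ α * a n + B) : ∃ C ≠ ⊤, ∀ n, a n ≤ C := by
  have h1 : (1 : ℝ≥0∞) - α ≠ 0 := (tsub_pos_of_lt hα).ne'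
  refine ⟨a 0 + B / (1 - α), ENNReal.add_ne_top.2 ⟨h0, ENNReal.div_ne_top hB h1⟩, fun n => ?_⟩
  induction n with
  | zero => exact le_self_add
  | succ n ih =>
    calc a (n + 1) ≤ α * (a 0 + B / (1 - α)) + B := (h n).trans (by gcongr)
      _ = α * a 0 + (α * (B / (1 - α)) + (1 - α) * (B / (1 - α))) := by
        rw [ENNReal.mul_div_cancel h1 (by simp)]; ring
      _ = α * a 0 + B / (1 - α) := by
        rw [← add_mul, add_tsub_cancel_of_le hα.le, one_mul]
      _ ≤ 1 * a 0 + B / (1 - α) := by gcongr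
      _ = _ := by rw [one_mul]

lemma rpow_le_one_add {q : ℝ} (hq0 : 0 ≤ q) (hq : q ≤ 1) (x : ℝ≥0∞) : x ^ q ≤ 1 + x := by
  rcases le_total x 1 with h | h
  · exact (ENNReal.rpow_le_one h hq0).trans le_self_add
  · calc x ^ q ≤ x ^ (1 : ℝ) := ENNReal.rpow_le_rpow_of_exponent_le h hq
      _ ≤ 1 + x := by rw [ENNReal.rpow_one]; exact le_add_self

variable {ν : Measure ℝ} [IsProbabilityMeasure ν]

/-- The q-th moments satisfy an affine recursion with factor 2^{-τ(q)} < 1, whose inhomogeneous term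
involves moments of orders q - 1/2 and 1/2. Hence the induction on k, which advances the order by
1/2. -/
lemma GeneratorLaw.exists_bound_stepMass_rpow (hν : GeneratorLaw ν) (k : ℕ) :
    ∀ q : ℝ, 0 ≤ q → q ≤ 1 + k / 2 → (∀ s, 1 < s → s ≤ q → 0 < tau ν s) →
      ∃ C ≠ ⊤, ∀ n, ∫⁻ w, stepMass n w ^ q ∂(treeLaw ν) ≤ C := by
  have small : ∀ q : ℝ, 0 ≤ q → q ≤ 1 → ∀ n, ∫⁻ w, stepMass n w ^ q ∂(treeLaw ν) ≤ 2 := by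
    intro q hq0 hq1 n
    calc ∫⁻ w, stepMass n w ^ q ∂(treeLaw ν) ≤ ∫⁻ w, (1 + stepMass n w) ∂(treeLaw ν) :=
          lintegral_mono fun w => rpow_le_one_add hq0 hq1 _
      _ = 2 := by
        rw [lintegral_add_left measurable_const, hν.lintegral_stepMass]
        simp [one_add_one_eq_two]
  induction k with
  | zero => exact fun q hq0 hq _ => ⟨2, by simp, small q hq0 (by simpa using hq)⟩
  | succ k ih =>
    intro q hq0 hq hs
    rcases le_or_gt q 1 with h1 | h1
    · exact ⟨2, by simp, small q hq0 h1⟩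
    obtain ⟨C, hC, hCn⟩ := ih (q - 1 / 2) (by linarith) (by push_cast at hq; linarith)
      fun s h h' => hs s h (by linarith)
    have hα : 2 * halfMoment ν q < 1 := by
      rw [hν.two_mul_halfMoment, ENNReal.ofReal_lt_one]
      exact Real.rpow_lt_one_of_one_lt_of_neg (by norm_num) (by linarith [hs q h1 le_rfl])
    refine exists_bound_of_contraction (α := 2 * halfMoment ν q)
      (B := 2 * halfMoment ν q * (ENNReal.ofReal (q * 2 ^ q) * (C * 2))) hα ?_ ?_ fun n => ?_
    · exact ENNReal.mul_ne_top hα.ne_top (ENNReal.mul_ne_top ENNReal.ofReal_ne_top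
        (ENNReal.mul_ne_top hC (by simp)))
    · simp [stepMass_zero]
    · have := lintegral_weightedSum_rpow_succ_le ν 1 h1.le (Z := fun _ => 1) measurable_const n
      rw [one_mul, mul_add] at this
      refine this.trans ?_
      gcongr
      · exact le_rfl
      · exact hCn n
      · exact small _ (by norm_num) (by norm_num) n

/-- Fatou's lemma transfers the uniform bound to the almost sure limit. -/
lemma GeneratorLaw.lintegral_limitMass_rpow_ne_top (hν : GeneratorLaw ν) {q : ℝ} (hq : 0 ≤ q)
    (hs : ∀ s, 1 < s → s ≤ q → 0 < tau ν s) :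
    ∫⁻ w, limitMass w ^ q ∂(treeLaw ν) ≠ ⊤ := by
  obtain ⟨C, hC, hCn⟩ := hν.exists_bound_stepMass_rpow ⌈2 * q⌉₊ q hq
    (by linarith [Nat.le_ceil (2 * q)]) hs
  refine ne_top_of_le_ne_top hC ?_
  calc ∫⁻ w, limitMass w ^ q ∂(treeLaw ν)
      = ∫⁻ w, liminf (fun n => stepMass n w ^ q) atTop ∂(treeLaw ν) := by
        refine lintegral_congr_ae (hν.ae_tendsto_stepMass.mono fun w hw => ?_)
        exact (((ENNReal.continuous_rpow_const.tendsto _).comp hw.1).liminf_eq).symm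
    _ ≤ liminf (fun n => ∫⁻ w, stepMass n w ^ q ∂(treeLaw ν)) atTop :=
        lintegral_liminf_le fun n => (measurable_stepMass n).pow_const q
    _ ≤ C := liminf_le_of_le (by isBoundedDefault) fun b hb =>
        let ⟨n, hn⟩ := hb.exists; hn.trans (hCn n)

lemma GeneratorLaw.lintegral_limitMass_le (hν : GeneratorLaw ν) :
    ∫⁻ w, limitMass w ∂(treeLaw ν) ≤ 1 := by
  calc ∫⁻ w, limitMass w ∂(treeLaw ν)
      = ∫⁻ w, liminf (fun n => stepMass n w) atTop ∂(treeLaw ν) :=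
        lintegral_congr_ae (hν.ae_tendsto_stepMass.mono fun w hw => hw.1.liminf_eq.symm)
    _ ≤ liminf (fun n => ∫⁻ w, stepMass n w ∂(treeLaw ν)) atTop :=
        lintegral_liminf_le measurable_stepMass
    _ = 1 := by simp [hν.lintegral_stepMass]

/-- The cascade is not degenerate if `tau ν` is positive on `(1, q]` for some `q > 1`. -/
lemma GeneratorLaw.not_ae_limitMass_eq_zero (hν : GeneratorLaw ν) {q : ℝ} (hq : 1 < q)
    (hs : ∀ s, 1 < s → s ≤ q → 0 < tau ν s) : ¬ ∀ᵐ w ∂(treeLaw ν), limitMass w = 0 := by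
  intro h0
  obtain ⟨C, hC, hCn⟩ := hν.exists_bound_stepMass_rpow ⌈2 * q⌉₊ q (by linarith)
    (by linarith [Nat.le_ceil (2 * q)]) hs
  -- Uniform integrability by truncation: above K, x ≤ K^{1-q} x^q. If the limit vanished, the
  -- truncated means would tend to 0, leaving the constant mean 1 bounded by K^{1-q} C, which tends
  -- to 0 as K grows.
  have key : ∀ K : ℕ, 0 < K → 1 ≤ (K : ℝ≥0∞) ^ (1 - q) * C := by
    intro K hK
    have hlim : Tendsto (fun n => ∫⁻ w, min (stepMass n w) K ∂(treeLaw ν)) atTop (𝓝 0) := by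
      have := tendsto_lintegral_of_dominated_convergence (μ := treeLaw ν)
        (F := fun n w => min (stepMass n w) (K : ℝ≥0∞)) (f := fun _ => 0) (fun _ => (K : ℝ≥0∞))
        (fun n => (measurable_stepMass n).min measurable_const)
        (fun n => Eventually.of_forall fun w => min_le_right _ _) (by simp)
        (by
          filter_upwards [h0, hν.ae_tendsto_stepMass] with w hw hw'
          have := hw'.1.min (tendsto_const_nhds (x := (K : ℝ≥0∞)))
          simpa [hw] using this)
      simpa using this
    have hle : ∀ n, 1 ≤ ∫⁻ w, min (stepMass n w) K ∂(treeLaw ν) + (K : ℝ≥0∞) ^ (1 - q) * C := by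
      intro n
      rw [← hν.lintegral_stepMass n]
      calc ∫⁻ w, stepMass n w ∂(treeLaw ν)
          ≤ ∫⁻ w, (min (stepMass n w) K + (K : ℝ≥0∞) ^ (1 - q) * stepMass n w ^ q) ∂(treeLaw ν) := by
            refine lintegral_mono fun w => ?_
            rcases le_total (stepMass n w) K with h | h
            · rw [min_eq_left h]; exact le_self_add
            · refine le_trans ?_ le_add_self
              have hpos : (K : ℝ≥0∞) ≠ 0 := by exact_mod_cast hK.ne'
              have hx : stepMass n w ≠ 0 := fun h' => hpos (le_zero_iff.1 (h' ▸ h))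
              calc stepMass n w = stepMass n w ^ (1 - q) * stepMass n w ^ q := by
                    rw [← ENNReal.rpow_add _ _ hx (stepMass_ne_top n w)]; simp
                _ ≤ _ := by
                    gcongr ?_ * _
                    rw [← neg_sub q 1, ENNReal.rpow_neg, ENNReal.rpow_neg, ENNReal.inv_le_inv]
                    exact ENNReal.rpow_le_rpow h (by linarith)
        _ = ∫⁻ w, min (stepMass n w) K ∂(treeLaw ν) +
              (K : ℝ≥0∞) ^ (1 - q) * ∫⁻ w, stepMass n w ^ q ∂(treeLaw ν) := by
            rw [lintegral_add_left ((measurable_stepMass n).min measurable_const),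
              lintegral_const_mul _ ((measurable_stepMass n).pow_const q)]
        _ ≤ _ := by gcongr; exact hCn n
    have := ge_of_tendsto' (hlim.add_const ((K : ℝ≥0∞) ^ (1 - q) * C)) hle
    simpa using this
  have h1 : Tendsto (fun n : ℕ => ((n + 1 : ℕ) : ℝ≥0∞)) atTop (𝓝 ⊤) :=
    ENNReal.tendsto_nat_nhds_top.comp (tendsto_add_atTop_nat 1)
  have h2 := ((ENNReal.continuous_rpow_const (y := 1 - q)).tendsto ⊤).comp h1
  rw [ENNReal.top_rpow_of_neg (by linarith)] at h2
  have h3 := ENNReal.Tendsto.mul_const (b := C) h2 (Or.inr hC)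
  rw [zero_mul] at h3
  exact absurd (ge_of_tendsto' h3 fun n => key (n + 1) n.succ_pos) (by simp)

lemma tendsto_limitMass_recursion {w : Word → ℝ}
    (h : ∀ i, Tendsto (fun n => stepMass n (shift i w)) atTop (𝓝 (limitMass (shift i w)))) :
    Tendsto (fun n => stepMass n w) atTop
      (𝓝 (ENNReal.ofReal (w []) / 2 * (limitMass (shift 0 w) + limitMass (shift 1 w)))) := by
  rw [← tendsto_add_atTop_iff_nat 1]
  simp only [stepMass_succ]
  exact ENNReal.Tendsto.const_mul ((h 0).add (h 1))
    (Or.inr (ENNReal.div_ne_top ENNReal.ofReal_ne_top (by simp)))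

lemma limitMass_recursion {w : Word → ℝ}
    (h : ∀ i, Tendsto (fun n => stepMass n (shift i w)) atTop (𝓝 (limitMass (shift i w)))) :
    limitMass w = ENNReal.ofReal (w []) / 2 * (limitMass (shift 0 w) + limitMass (shift 1 w)) :=
  (tendsto_limitMass_recursion h).limsup_eq

lemma GeneratorLaw.ae_root_pos (hν : GeneratorLaw ν) : ∀ᵐ w ∂(treeLaw ν), 0 < w [] :=
  (measurePreserving_root ν).quasiMeasurePreserving.ae hν.pos

lemma GeneratorLaw.ae_limitMass_recursion (hν : GeneratorLaw ν) : ∀ᵐ w ∂(treeLaw ν),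
    limitMass w = ENNReal.ofReal (w []) / 2 * (limitMass (shift 0 w) + limitMass (shift 1 w)) := by
  filter_upwards [ae_all_iff.2 fun i =>
    (measurePreserving_shift ν i).quasiMeasurePreserving.ae hν.ae_tendsto_stepMass] with w hw
  exact limitMass_recursion fun i => (hw i).1

/-- A tree has zero mass exactly when both of its subtrees do, since the root weight is positive. By
independence the extinction probability satisfies z = z², and z = 1 is excluded by non-degeneracy.
-/
lemma GeneratorLaw.ae_limitMass_pos (hν : GeneratorLaw ν) {q : ℝ} (hq : 1 < q)
    (hs : ∀ s, 1 < s → s ≤ q → 0 < tau ν s) : ∀ᵐ w ∂(treeLaw ν), limitMass w ≠ 0 := by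
  have hms : MeasurableSet {w | limitMass w = 0} := measurable_limitMass (measurableSet_singleton 0)
  set z := treeLaw ν {w | limitMass w = 0} with hz
  have h1 : z = z * z := by
    let f : (Word → ℝ) → ℝ≥0∞ := Set.indicator {w | limitMass w = 0} 1
    have hf : Measurable f := measurable_one.indicator hms
    have hfz : ∫⁻ w, f w ∂(treeLaw ν) = z := lintegral_indicator_one hms
    have h2 : ∫⁻ w, f w ∂(treeLaw ν) = ∫⁻ w, 1 * (f (shift 0 w) * f (shift 1 w)) ∂(treeLaw ν) := by
      refine lintegral_congr_ae ?_
      filter_upwards [hν.ae_limitMass_recursion, hν.ae_root_pos] with w hw hpos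
      have : limitMass w = 0 ↔ limitMass (shift 0 w) = 0 ∧ limitMass (shift 1 w) = 0 := by
        rw [hw]; simp [hpos]
      simp only [f, Set.indicator_apply, Set.mem_ofPred_eq, Pi.one_apply, one_mul]
      by_cases h0 : limitMass (shift 0 w) = 0 <;> by_cases h1 : limitMass (shift 1 w) = 0 <;>
        simp [this, h0, h1]
    rw [lintegral_split ν measurable_const hf hf, hfz] at h2
    simpa using h2
  have hz1 : z ≠ 1 := fun h => hν.not_ae_limitMass_eq_zero hq hs
    ((prob_compl_eq_zero_iff hms).2 h)
  have hzt : z ≠ ⊤ := measure_ne_top _ _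
  have : z = 0 := by
    by_contra h0
    refine hz1 ?_
    have := ENNReal.mul_right_inj h0 hzt (b := 1) (c := z)
    rw [mul_one] at this
    exact (this.1 h1).symm
  exact measure_eq_zero_iff_ae_notMem.1 this

/-! ### Negative moments of the limit mass. -/

lemma rpow_neg_antitone {x y : ℝ≥0∞} {s : ℝ} (hs : 0 ≤ s) (h : x ≤ y) : y ^ (-s) ≤ x ^ (-s) := by
  rw [ENNReal.rpow_neg, ENNReal.rpow_neg, ENNReal.inv_le_inv]
  exact ENNReal.rpow_le_rpow h hs

section

variable {ν : Measure ℝ} [IsProbabilityMeasure ν]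

/-- Markov's inequality for W^{-2}. -/
lemma GeneratorLaw.exists_measure_le_sq (hν : GeneratorLaw ν) :
    ∃ C : ℝ, 0 < C ∧ ∀ y : ℝ, 0 < y → ν {x | x ≤ 2 * y} ≤ ENNReal.ofReal (C * y ^ 2) := by
  set m := ∫ x, x ^ (-2 : ℝ) ∂ν with hm
  refine ⟨4 * m, mul_pos (by norm_num) (hν.integral_rpow_pos _), fun y hy => ?_⟩
  have h1 := mul_meas_ge_le_lintegral (μ := ν)
    (by fun_prop : Measurable fun x : ℝ => ENNReal.ofReal x ^ (-2 : ℝ))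
    (ENNReal.ofReal (2 * y) ^ (-2 : ℝ))
  have h2 : ν {x | x ≤ 2 * y} ≤
      ν {x | ENNReal.ofReal (2 * y) ^ (-2 : ℝ) ≤ ENNReal.ofReal x ^ (-2 : ℝ)} :=
    measure_mono fun x hx => rpow_neg_antitone (by norm_num) (ENNReal.ofReal_le_ofReal hx)
  rw [hν.lintegral_rpow, ENNReal.ofReal_rpow_of_pos (by positivity)] at h1
  have h3 : ENNReal.ofReal ((2 * y) ^ (-2 : ℝ)) * ν {x | x ≤ 2 * y} ≤ ENNReal.ofReal m := by
    refine le_trans ?_ h1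
    rw [ENNReal.ofReal_rpow_of_pos (by positivity)] at h2
    gcongr
  have h4 : ENNReal.ofReal (4 * m * y ^ 2) =
      ENNReal.ofReal ((2 * y) ^ 2) * ENNReal.ofReal m := by
    rw [← ENNReal.ofReal_mul (by positivity)]; ring_nf
  have h5 : ENNReal.ofReal ((2 * y) ^ 2) * ENNReal.ofReal ((2 * y) ^ (-2 : ℝ)) = 1 := by
    rw [← ENNReal.ofReal_mul (by positivity), ← Real.rpow_two, ← Real.rpow_add (by positivity)]
    simp
  calc ν {x | x ≤ 2 * y} = ENNReal.ofReal ((2 * y) ^ 2) *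
        (ENNReal.ofReal ((2 * y) ^ (-2 : ℝ)) * ν {x | x ≤ 2 * y}) := by
        rw [← mul_assoc, h5, one_mul]
    _ ≤ _ := by rw [h4]; gcongr

/-- If Y ≤ 4y² while W > 2y, then Y_0 + Y_1 ≤ 4y, so both independent masses are at most 4y.
Squaring the threshold thus essentially squares the probability. -/
lemma GeneratorLaw.measure_limitMass_le_sq (hν : GeneratorLaw ν) {y : ℝ} (hy : 0 < y) :
    treeLaw ν {w | limitMass w ≤ ENNReal.ofReal (4 * y ^ 2)} ≤
      ν {x | x ≤ 2 * y} + treeLaw ν {w | limitMass w ≤ ENNReal.ofReal (4 * y)} ^ 2 := by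
  have hms : MeasurableSet {w | limitMass w ≤ ENNReal.ofReal (4 * y)} :=
    measurable_limitMass measurableSet_Iic
  have h1 : treeLaw ν {w | w [] ≤ 2 * y} = ν {x | x ≤ 2 * y} :=
    (measurePreserving_root ν).measure_preimage measurableSet_Iic.nullMeasurableSet
  let f : (Word → ℝ) → ℝ≥0∞ := Set.indicator {w | limitMass w ≤ ENNReal.ofReal (4 * y)} 1
  have hf : Measurable f := measurable_one.indicator hms
  have hfz : ∫⁻ w, f w ∂(treeLaw ν) = treeLaw ν {w | limitMass w ≤ ENNReal.ofReal (4 * y)} :=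
    lintegral_indicator_one hms
  have h2 : treeLaw ν (shift 0 ⁻¹' {w | limitMass w ≤ ENNReal.ofReal (4 * y)} ∩
      shift 1 ⁻¹' {w | limitMass w ≤ ENNReal.ofReal (4 * y)}) =
      treeLaw ν {w | limitMass w ≤ ENNReal.ofReal (4 * y)} ^ 2 := by
    have h3 := lintegral_split ν (measurable_const (a := (1 : ℝ≥0∞))) hf hf
    rw [← lintegral_indicator_one ((measurable_shift 0 hms).inter (measurable_shift 1 hms))]
    rw [hfz, lintegral_const, measure_univ, one_mul, one_mul] at h3
    rw [pow_two, ← h3]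
    rw [Set.inter_indicator_one]
    exact lintegral_congr fun w => (one_mul _).symm
  rw [← h1, ← h2]
  refine le_trans (measure_mono_ae ?_) (measure_union_le _ _)
  filter_upwards [hν.ae_limitMass_recursion, hν.ae_root_pos] with w hw hpos hle
  by_cases hW : w [] ≤ 2 * y
  · exact Or.inl hW
  refine Or.inr ?_
  push Not at hW
  have hle' : limitMass w ≤ ENNReal.ofReal (4 * y ^ 2) := hle
  rw [hw] at hle'
  have h3 : limitMass (shift 0 w) + limitMass (shift 1 w) ≤ ENNReal.ofReal (4 * y) := by
    have h4 : ENNReal.ofReal y * (limitMass (shift 0 w) + limitMass (shift 1 w)) ≤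
        ENNReal.ofReal y * ENNReal.ofReal (4 * y) := by
      rw [← ENNReal.ofReal_mul hy.le]
      calc _ ≤ ENNReal.ofReal (w []) / 2 * (limitMass (shift 0 w) + limitMass (shift 1 w)) := by
            gcongr
            rw [ENNReal.le_div_iff_mul_le (by simp) (by simp), ← ENNReal.ofReal_ofNat 2,
              ← ENNReal.ofReal_mul hy.le]
            exact ENNReal.ofReal_le_ofReal (by linarith)
        _ ≤ _ := hle'
        _ = _ := by ring_nf
    exact (ENNReal.mul_le_mul_iff_right (by simpa using hy) (by simp)).1 h4
  exact ⟨le_self_add.trans h3, le_add_self.trans h3⟩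

/-- Lower tail of the limit mass along a doubly exponential sequence. -/
lemma GeneratorLaw.exists_lower_tail (hν : GeneratorLaw ν)
    (hpos : ∀ᵐ w ∂(treeLaw ν), limitMass w ≠ 0) : ∃ y : ℝ, 0 < y ∧ y < 1 ∧ ∀ n : ℕ,
      treeLaw ν {w | limitMass w ≤ ENNReal.ofReal (4 * y ^ 2 ^ n)} ≤
        ENNReal.ofReal (1 / 2 * (1 / 2) ^ 2 ^ n) := by
  obtain ⟨C, hC, hCy⟩ := hν.exists_measure_le_sq
  have h0 : Tendsto (fun n : ℕ => treeLaw ν {w | limitMass w ≤ ENNReal.ofReal (4 * (1 / (n + 1 : ℝ)))})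
      atTop (𝓝 0) := by
    have h1 := tendsto_measure_iInter_atTop (μ := treeLaw ν)
      (s := fun n : ℕ => {w | limitMass w ≤ ENNReal.ofReal (4 * (1 / (n + 1 : ℝ)))})
      (fun n => (measurable_limitMass measurableSet_Iic).nullMeasurableSet)
      (fun m n hmn w hw => le_trans hw (ENNReal.ofReal_le_ofReal (by gcongr)))
      ⟨0, measure_ne_top _ _⟩
    have h2 : treeLaw ν (⋂ n : ℕ, {w | limitMass w ≤ ENNReal.ofReal (4 * (1 / (n + 1 : ℝ)))}) = 0 := by
      refine measure_mono_null (fun w hw => ?_) hpos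
      have h3 : Tendsto (fun n : ℕ => ENNReal.ofReal (4 * (1 / (n + 1 : ℝ)))) atTop (𝓝 0) := by
        have := ENNReal.tendsto_ofReal
          ((tendsto_one_div_add_atTop_nhds_zero_nat (𝕜 := ℝ)).const_mul 4)
        simpa using this
      have h4 : limitMass w ≤ 0 := ge_of_tendsto' h3 fun n => Set.mem_iInter.1 hw n
      simpa using h4
    rwa [h2] at h1
  have hsmall : Tendsto (fun n : ℕ => (1 / (n + 1 : ℝ))) atTop (𝓝 0) :=
    tendsto_one_div_add_atTop_nhds_zero_nat
  have e1 : ∀ᶠ n : ℕ in atTop, 4 * (1 / (n + 1 : ℝ)) ^ 2 < 1 := by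
    have : Tendsto (fun n : ℕ => 4 * (1 / (n + 1 : ℝ)) ^ 2) atTop (𝓝 (4 * 0 ^ 2)) :=
      (hsmall.pow 2).const_mul 4
    exact this.eventually_lt_const (by norm_num)
  have e2 : ∀ᶠ n : ℕ in atTop, 16 * C * (1 / (n + 1 : ℝ)) ^ 2 < 1 := by
    have : Tendsto (fun n : ℕ => 16 * C * (1 / (n + 1 : ℝ)) ^ 2) atTop (𝓝 (16 * C * 0 ^ 2)) :=
      (hsmall.pow 2).const_mul _
    exact this.eventually_lt_const (by norm_num)
  have e3 := h0.eventually_lt_const (u := ENNReal.ofReal (1 / 4)) (by simp)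
  -- The third condition is the case n = 0. In the induction step the prefactor 1/2 becomes 1/4
  -- after squaring, and the first two conditions make the contribution of the root weight at most
  -- the other 1/4.
  obtain ⟨N, hN1, hN2, hN3⟩ := (e1.and (e2.and e3)).exists
  set y : ℝ := 1 / (N + 1 : ℝ)
  have hy : 0 < y := by positivity
  have hy1 : y < 1 := by nlinarith
  refine ⟨y, hy, hy1, fun n => ?_⟩
  induction n with
  | zero => 
    rw [pow_zero, pow_one, pow_one]
    exact hN3.le.trans (ENNReal.ofReal_le_ofReal (by norm_num))
  | succ n ih =>
    have hyn : 0 < y ^ 2 ^ n := by positivity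
    have h1 := hν.measure_limitMass_le_sq hyn
    rw [← pow_mul, ← pow_succ] at h1
    refine h1.trans ((add_le_add (hCy _ hyn) (pow_le_pow_left' ih 2)).trans ?_)
    rw [← ENNReal.ofReal_pow (by positivity), ← ENNReal.ofReal_add (by positivity) (by positivity)]
    refine ENNReal.ofReal_le_ofReal ?_
    have h2 : (1 / 2 : ℝ) ^ 2 ^ (n + 1) = ((1 / 2) ^ 2 ^ n) ^ 2 := by rw [pow_succ 2 n, pow_mul]
    have h3 : (4 * y ^ 2) ^ 2 ^ n ≤ 4 * y ^ 2 :=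
      pow_le_of_le_one (by positivity) hN1.le (by positivity)
    have h4 : C * (y ^ 2 ^ n) ^ 2 = ((1 / 2) ^ 2 ^ n) ^ 2 * (C * (4 * y ^ 2) ^ 2 ^ n) := by
      rw [← pow_mul, ← pow_mul, mul_comm (2 ^ n) 2, pow_mul, pow_mul, mul_pow, ← mul_assoc, mul_comm _ C,
        mul_assoc, ← mul_assoc _ ((4 : ℝ) ^ 2 ^ n), ← mul_pow]
      norm_num
    have h5 : C * (4 * y ^ 2) ^ 2 ^ n ≤ 1 / 4 := by nlinarith
    rw [h2, h4]
    nlinarith [sq_nonneg ((1 / 2 : ℝ) ^ 2 ^ n)]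

/-- Decompose according to the position of Y among the thresholds 4 y^{2^n}. On each layer Y^{-s}
grows like (3/2)^{2^n} while the probability is at most of order (1/2)^{2^n}. -/
lemma GeneratorLaw.exists_negative_moment (hν : GeneratorLaw ν)
    (hpos : ∀ᵐ w ∂(treeLaw ν), limitMass w ≠ 0) :
    ∃ s : ℝ, 0 < s ∧ ∫⁻ w, limitMass w ^ (-s) ∂(treeLaw ν) ≠ ⊤ := by
  obtain ⟨y, hy, hy1, htail⟩ := hν.exists_lower_tail hpos
  have hlog : Real.log y < 0 := Real.log_neg hy hy1
  -- Solves y^{-2s} = 3/2; any value strictly between 1 and 2 would beat the tail.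
  set s := Real.log (3 / 2) / (-2 * Real.log y) with hs
  have hs0 : 0 < s := div_pos (Real.log_pos (by norm_num)) (by linarith)
  have hys : (y ^ 2) ^ (-s) = 3 / 2 := by
    rw [← Real.rpow_natCast, ← Real.rpow_mul hy.le, Real.rpow_def_of_pos hy]
    rw [show Real.log y * (((2 : ℕ) : ℝ) * -s) = Real.log (3 / 2) by
      rw [hs]; push_cast; have := hlog.ne; field_simp]
    exact Real.exp_log (by norm_num)
  refine ⟨s, hs0, ?_⟩
  have hval : ∀ n : ℕ, ENNReal.ofReal (4 * y ^ 2 ^ (n + 1)) ^ (-s) =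
      ENNReal.ofReal (4 ^ (-s) * (3 / 2) ^ 2 ^ n) := by
    intro n
    rw [ENNReal.ofReal_rpow_of_pos (by positivity), Real.mul_rpow (by norm_num) (by positivity),
      pow_succ' 2 n, pow_mul, ← Real.rpow_natCast (y ^ 2), ← Real.rpow_mul (by positivity),
      mul_comm ((2 ^ n : ℕ) : ℝ), Real.rpow_mul (by positivity), hys, Real.rpow_natCast]
  have hpt : ∀ w, limitMass w ≠ 0 → limitMass w ^ (-s) ≤ ENNReal.ofReal (4 * y) ^ (-s) +
      ∑' n : ℕ, ENNReal.ofReal (4 ^ (-s) * (3 / 2) ^ 2 ^ n) *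
        Set.indicator {w | limitMass w ≤ ENNReal.ofReal (4 * y ^ 2 ^ n)} 1 w := by
    intro w hw
    by_cases h : limitMass w ≤ ENNReal.ofReal (4 * y)
    · have hex : ∃ n : ℕ, ENNReal.ofReal (4 * y ^ 2 ^ n) < limitMass w := by
        have h1 : Tendsto (fun n : ℕ => ENNReal.ofReal (4 * y ^ 2 ^ n)) atTop (𝓝 0) := by
          have h2 : Tendsto (fun n : ℕ => y ^ 2 ^ n) atTop (𝓝 0) :=
            (tendsto_pow_atTop_nhds_zero_of_lt_one hy.le hy1).comp
              (tendsto_pow_atTop_atTop_of_one_lt (by norm_num : 1 < 2))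
          simpa using ENNReal.tendsto_ofReal (h2.const_mul 4)
        exact (h1.eventually_lt_const (pos_iff_ne_zero.2 hw)).exists
      classical
      obtain ⟨n, hn⟩ : ∃ n, Nat.find hex = n + 1 := by
        refine Nat.exists_eq_succ_of_ne_zero fun h0 => ?_
        have := Nat.find_spec hex
        rw [h0] at this
        simp only [pow_zero, pow_one] at this
        exact absurd h (not_le.2 this)
      have h1 := Nat.find_spec hex
      rw [hn] at h1
      have h2 : limitMass w ≤ ENNReal.ofReal (4 * y ^ 2 ^ n) :=
        not_lt.1 (Nat.find_min hex (by omega))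
      refine le_trans ?_ le_add_self
      refine le_trans ?_ (ENNReal.le_tsum n)
      rw [Set.indicator_of_mem (by exact h2), Pi.one_apply, mul_one, ← hval]
      exact rpow_neg_antitone hs0.le h1.le
    · exact (rpow_neg_antitone hs0.le (not_le.1 h).le).trans le_self_add
  have hms : ∀ n : ℕ, MeasurableSet {w | limitMass w ≤ ENNReal.ofReal (4 * y ^ 2 ^ n)} :=
    fun n => measurable_limitMass measurableSet_Iic
  refine ne_top_of_le_ne_top ?_ (lintegral_mono_ae (hpos.mono hpt))
  rw [lintegral_add_left measurable_const, lintegral_tsum fun n =>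
    ((measurable_one.indicator (hms n)).const_mul _).aemeasurable]
  refine ENNReal.add_ne_top.2 ⟨?_, ?_⟩
  · rw [ENNReal.ofReal_rpow_of_pos (by positivity)]
    simp
  have hsum : Summable fun n : ℕ => (4 : ℝ) ^ (-s) * (3 / 4) ^ n :=
    (summable_geometric_of_lt_one (by norm_num) (by norm_num)).mul_left _
  refine ne_top_of_le_ne_top hsum.tsum_ofReal_ne_top (ENNReal.tsum_le_tsum fun n => ?_)
  rw [lintegral_const_mul _ (measurable_one.indicator (hms n)), lintegral_indicator_one (hms n)]
  refine (mul_le_mul_right (htail n) _).trans ?_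
  rw [← ENNReal.ofReal_mul (by positivity)]
  refine ENNReal.ofReal_le_ofReal ?_
  have h1 : (3 / 4 : ℝ) ^ 2 ^ n ≤ (3 / 4) ^ n :=
    pow_le_pow_of_le_one (by norm_num) (by norm_num) (Nat.lt_two_pow_self).le
  have h2 : (3 / 4 : ℝ) ^ 2 ^ n = (3 / 2) ^ 2 ^ n * (1 / 2) ^ 2 ^ n := by
    rw [← mul_pow]; norm_num
  have h3 : (0 : ℝ) < 4 ^ (-s) := by positivity
  nlinarith [mul_le_mul_of_nonneg_left h1 h3.le, pow_pos (by norm_num : (0 : ℝ) < 3 / 4) (2 ^ n)]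

lemma GeneratorLaw.halfMoment_ne_top (hν : GeneratorLaw ν) (p : ℝ) : halfMoment ν p ≠ ⊤ := by
  intro h
  have := hν.two_mul_halfMoment p
  rw [h] at this
  simp at this

/-- Since (a + b)^{-2s} ≤ a^{-s} b^{-s}, independence of the two subtrees turns one moment of order
-2s into a product of two moments of order -s. -/
lemma GeneratorLaw.negative_moment_double (hν : GeneratorLaw ν)
    {s : ℝ} (hs : 0 ≤ s)
    (h : ∫⁻ w, limitMass w ^ (-s) ∂(treeLaw ν) ≠ ⊤) :
    ∫⁻ w, limitMass w ^ (-(2 * s)) ∂(treeLaw ν) ≠ ⊤ := by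
  have hm : Measurable fun w => limitMass w ^ (-s) := measurable_limitMass.pow_const _
  have hle : ∫⁻ w, limitMass w ^ (-(2 * s)) ∂(treeLaw ν) ≤
      ∫⁻ w, (ENNReal.ofReal (w []) / 2) ^ (-(2 * s)) *
        (limitMass (shift 0 w) ^ (-s) * limitMass (shift 1 w) ^ (-s)) ∂(treeLaw ν) := by
    refine lintegral_mono_ae ?_
    filter_upwards [hν.ae_limitMass_recursion, hν.ae_root_pos, ae_all_iff.2 fun i =>
      (measurePreserving_shift ν i).quasiMeasurePreserving.ae hν.ae_tendsto_stepMass] with w hw hpos hi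
    rw [hw, ENNReal.mul_rpow_of_ne_top (ENNReal.div_ne_top ENNReal.ofReal_ne_top (by simp))
      (ENNReal.add_ne_top.2 ⟨(hi 0).2, (hi 1).2⟩)]
    gcongr
    rw [show -(2 * s) = -s * (2 : ℕ) by push_cast; ring, ENNReal.rpow_mul, ENNReal.rpow_natCast,
      pow_two]
    exact mul_le_mul' (rpow_neg_antitone hs le_self_add) (rpow_neg_antitone hs le_add_self)
  refine ne_top_of_le_ne_top ?_ hle
  rw [lintegral_split ν (f := fun x => (ENNReal.ofReal x / 2) ^ (-(2 * s))) (by fun_prop) hm hm]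
  exact ENNReal.mul_ne_top (hν.halfMoment_ne_top _) (ENNReal.mul_ne_top h h)

lemma GeneratorLaw.lintegral_limitMass_rpow_neg_ne_top (hν : GeneratorLaw ν)
    (hpos : ∀ᵐ w ∂(treeLaw ν), limitMass w ≠ 0) {s : ℝ} (hs : 0 ≤ s) :
    ∫⁻ w, limitMass w ^ (-s) ∂(treeLaw ν) ≠ ⊤ := by
  obtain ⟨s₀, hs₀, h₀⟩ := hν.exists_negative_moment hpos
  have hk : ∀ k : ℕ, ∫⁻ w, limitMass w ^ (-(2 ^ k * s₀)) ∂(treeLaw ν) ≠ ⊤ := by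
    intro k
    induction k with
    | zero => simpa using h₀
    | succ k ih =>
      have := hν.negative_moment_double (by positivity) ih
      rwa [show (2 : ℝ) * (2 ^ k * s₀) = 2 ^ (k + 1) * s₀ by ring] at this
  obtain ⟨k, hk'⟩ := pow_unbounded_of_one_lt (s / s₀) (by norm_num : (1 : ℝ) < 2)
  rw [div_lt_iff₀ hs₀] at hk'
  have hle : ∫⁻ w, limitMass w ^ (-s) ∂(treeLaw ν) ≤
      ∫⁻ w, (1 + limitMass w ^ (-(2 ^ k * s₀))) ∂(treeLaw ν) := by
    refine lintegral_mono fun w => ?_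
    rcases le_total (limitMass w) 1 with h | h
    · exact (ENNReal.rpow_le_rpow_of_exponent_ge h (by linarith)).trans le_add_self
    · refine le_trans ?_ le_self_add
      simpa using rpow_neg_antitone hs h
  refine ne_top_of_le_ne_top ?_ hle
  rw [lintegral_add_left measurable_const]
  exact ENNReal.add_ne_top.2 ⟨by simp, hk k⟩

/-- The `p`-th moment of the limit mass is finite for `p ≤ 1` and whenever `τ > 0` on `(1, p]`. -/
lemma GeneratorLaw.limitMass_moment_ne_top (hν : GeneratorLaw ν)
    (hpos : ∀ᵐ w ∂(treeLaw ν), limitMass w ≠ 0) {p : ℝ} (hs : ∀ s, 1 < s → s ≤ p → 0 < tau ν s) :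
    ∫⁻ w, limitMass w ^ p ∂(treeLaw ν) ≠ ⊤ := by
  rcases le_total 0 p with h | h
  · exact hν.lintegral_limitMass_rpow_ne_top h hs
  · simpa using hν.lintegral_limitMass_rpow_neg_ne_top hpos (neg_nonneg.2 h)

lemma GeneratorLaw.limitMass_moment_ne_zero (hν : GeneratorLaw ν)
    (hpos : ∀ᵐ w ∂(treeLaw ν), limitMass w ≠ 0) (p : ℝ) :
    ∫⁻ w, limitMass w ^ p ∂(treeLaw ν) ≠ 0 := by
  intro h
  rw [lintegral_eq_zero_iff (measurable_limitMass.pow_const p)] at h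
  have : ∀ᵐ w ∂(treeLaw ν), False := by
    filter_upwards [h, hpos, hν.ae_tendsto_stepMass] with w h0 h1 h2
    simp only [Pi.zero_apply, ENNReal.rpow_eq_zero_iff] at h0
    rcases h0 with h0 | h0
    · exact h1 h0.1
    · exact h2.2 h0.1
  obtain ⟨_, hx⟩ := this.exists
  exact hx

/-! ### Masses along extreme rays and regular trees. -/

/-- The normalised limit mass carried by the `n`-th vertex of the ray which always turns to the
side `i`. -/
noncomputable def rayMass (i : Fin 2) : ℕ → (Word → ℝ) → ℝ≥0∞
  | 0, w => limitMass w
  | n + 1, w => ENNReal.ofReal (w []) / 2 * rayMass i n (shift i w)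

lemma measurable_rayMass (i : Fin 2) (n : ℕ) : Measurable (rayMass i n) := by
  induction n with
  | zero => exact measurable_limitMass
  | succ n ih =>
    have h : Measurable fun w : Word → ℝ => ENNReal.ofReal (w []) / 2 := by fun_prop
    exact h.mul (ih.comp (measurable_shift i))

lemma GeneratorLaw.lintegral_rayMass_le (hν : GeneratorLaw ν) (i : Fin 2) (n : ℕ) :
    ∫⁻ w, rayMass i n w ∂(treeLaw ν) ≤ (1 / 2) ^ n := by
  induction n with
  | zero => simpa [rayMass] using hν.lintegral_limitMass_le
  | succ n ih =>
    have h1 : halfMoment ν 1 = 1 / 2 :=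
      (ENNReal.eq_div_iff (by simp) (by simp)).2 hν.halfMoment_one
    have h2 := lintegral_root_shift ν (f := fun x => (ENNReal.ofReal x / 2) ^ (1 : ℝ)) (by fun_prop)
      (measurable_rayMass i n) i
    simp only [ENNReal.rpow_one] at h2
    simp only [rayMass]
    rw [h2, pow_succ']
    simp only [halfMoment, ENNReal.rpow_one] at h1
    rw [h1]
    gcongr

lemma ae_tendsto_zero_of_lintegral_le {α : Type*} [MeasurableSpace α] {μ : Measure α}
    {f : ℕ → α → ℝ≥0∞} (hf : ∀ n, AEMeasurable (f n) μ) (h : ∑' n, ∫⁻ x, f n x ∂μ ≠ ⊤) :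
    ∀ᵐ x ∂μ, Tendsto (fun n => f n x) atTop (𝓝 0) := by
  rw [← lintegral_tsum hf] at h
  filter_upwards [ae_lt_top' (AEMeasurable.tsum hf) h] with x hx
  exact ENNReal.tendsto_atTop_zero_of_tsum_ne_top hx.ne

/-- The expectations are at most 2^{-n}, hence summable. This is what prevents atoms at the end
points shared by neighbouring closed dyadic intervals. -/
lemma GeneratorLaw.ae_tendsto_rayMass (hν : GeneratorLaw ν) (i : Fin 2) :
    ∀ᵐ w ∂(treeLaw ν), Tendsto (fun n => rayMass i n w) atTop (𝓝 0) := by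
  refine ae_tendsto_zero_of_lintegral_le (fun n => (measurable_rayMass i n).aemeasurable) ?_
  refine ne_top_of_le_ne_top ?_ (ENNReal.tsum_le_tsum fun n => hν.lintegral_rayMass_le i n)
  simp [ENNReal.tsum_geometric]

/-- The trees for which the cascade measure exists and charges no dyadic point. -/
structure RegularTree (w : Word → ℝ) : Prop where
  weight_pos : ∀ s, 0 < w s
  tendsto_stepMass : ∀ s, Tendsto (fun n => stepMass n (subtree s w)) atTop
    (𝓝 (limitMass (subtree s w)))
  limitMass_ne_zero : ∀ s, limitMass (subtree s w) ≠ 0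
  limitMass_ne_top : ∀ s, limitMass (subtree s w) ≠ ⊤
  tendsto_rayMass : ∀ s i, Tendsto (fun n => rayMass i n (subtree s w)) atTop (𝓝 0)

lemma RegularTree.shift {w : Word → ℝ} (h : RegularTree w) (i : Fin 2) :
    RegularTree (shift i w) where
  weight_pos s := h.weight_pos (i :: s)
  tendsto_stepMass s := by simpa only [subtree_shift] using h.tendsto_stepMass (i :: s)
  limitMass_ne_zero s := by simpa only [subtree_shift] using h.limitMass_ne_zero (i :: s)
  limitMass_ne_top s := by simpa only [subtree_shift] using h.limitMass_ne_top (i :: s)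
  tendsto_rayMass s := by simpa only [subtree_shift] using h.tendsto_rayMass (i :: s)

lemma RegularTree.limitMass_eq {w : Word → ℝ} (h : RegularTree w) : limitMass w =
    ENNReal.ofReal (w []) / 2 * (limitMass (Cascade.shift 0 w) + limitMass (Cascade.shift 1 w)) :=
  limitMass_recursion fun i => (h.shift i).tendsto_stepMass []

lemma GeneratorLaw.ae_regularTree (hν : GeneratorLaw ν)
    (hpos : ∀ᵐ w ∂(treeLaw ν), limitMass w ≠ 0) : ∀ᵐ w ∂(treeLaw ν), RegularTree w := by
  have h0 : ∀ᵐ w ∂(treeLaw ν), (0 < w [] ∧ (Tendsto (fun n => stepMass n w) atTop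
      (𝓝 (limitMass w)) ∧ limitMass w ≠ ⊤)) ∧ limitMass w ≠ 0 ∧
      ∀ i, Tendsto (fun n => rayMass i n w) atTop (𝓝 0) := by
    filter_upwards [hν.ae_root_pos, hν.ae_tendsto_stepMass, hpos,
      ae_all_iff.2 fun i => hν.ae_tendsto_rayMass i] with w h1 h2 h3 h4
    exact ⟨⟨h1, h2⟩, h3, h4⟩
  have h1 := ae_all_iff.2 fun s => (measurePreserving_subtree ν s).quasiMeasurePreserving.ae h0
  filter_upwards [h1] with w hw
  exact ⟨fun s => by simpa [subtree] using (hw s).1.1, fun s => (hw s).1.2.1,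
    fun s => (hw s).2.1, fun s => (hw s).1.2.2, fun s => (hw s).2.2⟩

end

/-! ### Weak convergence of the cascade measures. -/

/-- Lebesgue measure on `[a, b]`, as a finite measure. -/
noncomputable def intervalLebesgue (a b : ℝ) : FiniteMeasure ℝ :=
  ⟨volume.restrict (Set.Icc a b), inferInstance⟩

/-- The measure on `[a, a + L]` obtained after `n` multiplications along the tree `w`. -/
noncomputable def stepMeasure : ℕ → (Word → ℝ) → ℝ → ℝ → FiniteMeasure ℝ
  | 0, _, a, L => intervalLebesgue a (a + L)
  | n + 1, w, a, L => (w []).toNNReal •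
      (stepMeasure n (shift 0 w) a (L / 2) + stepMeasure n (shift 1 w) (a + L / 2) (L / 2))

lemma intervalLebesgue_add {a b c : ℝ} (hab : a ≤ b) (hbc : b ≤ c) :
    intervalLebesgue a b + intervalLebesgue b c = intervalLebesgue a c := by
  refine Subtype.ext ?_
  change volume.restrict (Set.Icc a b) + volume.restrict (Set.Icc b c) =
    volume.restrict (Set.Icc a c)
  rw [← Set.Icc_union_Icc_eq_Icc hab hbc, Measure.restrict_union₀ _ measurableSet_Icc.nullMeasurableSet]
  refine measure_mono_null (t := {b}) (fun x hx => ?_) (by simp)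
  exact le_antisymm hx.1.2 hx.2.1

lemma wordIndex_cons {n : ℕ} (i : Fin 2) (r : Fin n → Fin 2) :
    wordIndex (Fin.cons i r : Fin (n + 1) → Fin 2) = i * 2 ^ n + wordIndex r := by
  simp only [wordIndex, Fin.sum_univ_succ, Fin.cons_zero, Fin.cons_succ, Fin.val_zero, Fin.val_succ]
  congr 1
  refine Finset.sum_congr rfl fun k _ => ?_
  congr 2
  omega

lemma wordRestrict_cons {n : ℕ} (i : Fin 2) (r : Fin n → Fin 2) (k : ℕ) :
    wordRestrict (Fin.cons i r : Fin (n + 1) → Fin 2) (k + 1) = i :: wordRestrict r k := by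
  simp [wordRestrict, List.ofFn_succ]

lemma sum_fin_cons {M : Type*} [AddCommMonoid M] {n : ℕ} (f : (Fin (n + 1) → Fin 2) → M) :
    ∑ r, f r = ∑ r : Fin n → Fin 2, f (Fin.cons 0 r) + ∑ r : Fin n → Fin 2, f (Fin.cons 1 r) := by
  rw [← (Fin.consEquiv fun _ : Fin (n + 1) => Fin 2).sum_comp, Fintype.sum_prod_type,
    Fin.sum_univ_two]
  rfl

/-- Step n + 1 uses the root weight and the next n generations, hence 2^n intervals: the two
Lebesgue halves created by the last splitting carry the same weight and merge. -/
lemma stepMeasure_succ_eq_sum {w : Word → ℝ} (hw : ∀ s, 0 ≤ w s) (n : ℕ) {L : ℝ} (hL : 0 ≤ L)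
    (a : ℝ) : stepMeasure (n + 1) w a L = ∑ r : Fin n → Fin 2,
      (w [] * ∏ i ∈ Finset.range n, w (wordRestrict r (i + 1))).toNNReal •
        intervalLebesgue (a + wordIndex r * (L / 2 ^ n)) (a + (wordIndex r + 1) * (L / 2 ^ n)) := by
  induction n generalizing w L a with
  | zero =>
    rw [Fintype.sum_unique, stepMeasure, stepMeasure, stepMeasure,
      intervalLebesgue_add (by linarith) (by linarith)]
    simp [wordIndex, add_assoc]
  | succ n ih =>
    have h2 : (2 : ℝ) ^ (n + 1) = 2 * 2 ^ n := by ring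
    rw [stepMeasure, ih (w := shift 0 w) (fun s => hw _) (by linarith),
      ih (w := shift 1 w) (fun s => hw _) (by linarith),
      sum_fin_cons, smul_add, Finset.smul_sum, Finset.smul_sum]
    have key : ∀ (i : Fin 2) (r : Fin n → Fin 2),
        (w []).toNNReal • (shift i w [] * ∏ k ∈ Finset.range n,
          shift i w (wordRestrict r (k + 1))).toNNReal •
          intervalLebesgue (a + i * (L / 2) + wordIndex r * (L / 2 / 2 ^ n))
            (a + i * (L / 2) + (wordIndex r + 1) * (L / 2 / 2 ^ n)) =
        (w [] * ∏ k ∈ Finset.range (n + 1),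
          w (wordRestrict (Fin.cons i r : Fin (n + 1) → Fin 2) (k + 1))).toNNReal •
          intervalLebesgue (a + wordIndex (Fin.cons i r : Fin (n + 1) → Fin 2) * (L / 2 ^ (n + 1)))
            (a + (wordIndex (Fin.cons i r : Fin (n + 1) → Fin 2) + 1) * (L / 2 ^ (n + 1))) := by
      intro i r
      rw [smul_smul, ← Real.toNNReal_mul (hw _), Finset.prod_range_succ', wordIndex_cons]
      congr 2
      · rw [wordRestrict_cons]
        simp only [wordRestrict_cons, shift]
        simp only [wordRestrict, List.take_zero]
        ring
      · push_cast; field_simp; ring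
      · push_cast; field_simp; ring
    congr 1
    · refine Finset.sum_congr rfl fun r _ => ?_
      have := key 0 r
      simpa using this
    · refine Finset.sum_congr rfl fun r _ => ?_
      have := key 1 r
      simpa using this

/-- The tree `w` with root weight replaced by `1`. -/
def unitRoot (w : Word → ℝ) : Word → ℝ
  | [] => 1
  | i :: r => w (i :: r)

lemma shift_unitRoot (i : Fin 2) (w : Word → ℝ) : shift i (unitRoot w) = shift i w := rfl

/-- The cascade has no weight at the empty word, so the recursive construction is run with root
weight one; this accounts for the extra step. -/
lemma cascadeStep_eq_stepMeasure {w : Word → ℝ} (hw : ∀ s, s ≠ [] → 0 ≤ w s) {T : ℝ} (hT : 0 ≤ T)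
    (n : ℕ) : cascadeStep T w n = stepMeasure (n + 1) (unitRoot w) 0 T := by
  have hw' : ∀ s, 0 ≤ unitRoot w s := by
    intro s
    match s with
    | [] => simp [unitRoot]
    | i :: r => exact hw _ (by simp)
  rw [stepMeasure_succ_eq_sum hw' n hT, cascadeStep]
  refine Finset.sum_congr rfl fun r _ => ?_
  congr 1
  · congr 1
    rw [← Finset.Ico_add_one_right_eq_Icc, Finset.prod_Ico_eq_prod_range]
    simp only [unitRoot, one_mul, Nat.add_sub_cancel]
    refine Finset.prod_congr rfl fun i hi => ?_
    rw [add_comm 1 i]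
    have hlen : (wordRestrict r (i + 1)).length = i + 1 := by
      have := Finset.mem_range.1 hi
      simp [wordRestrict]
      omega
    match h : wordRestrict r (i + 1) with
    | [] => simp [h] at hlen
    | j :: s => rfl
  · refine Subtype.ext ?_
    change volume.restrict (dyadicInterval T n (wordIndex r)) = volume.restrict (Set.Icc _ _)
    rw [dyadicInterval, zpow_neg, zpow_natCast]
    congr 2 <;> field_simp <;> ring

section Convergence

lemma toMeasure_stepMeasure_succ (n : ℕ) (w : Word → ℝ) (a L : ℝ) (s : Set ℝ) :
    (stepMeasure (n + 1) w a L : Measure ℝ) s = ENNReal.ofReal (w []) *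
      ((stepMeasure n (shift 0 w) a (L / 2) : Measure ℝ) s +
        (stepMeasure n (shift 1 w) (a + L / 2) (L / 2) : Measure ℝ) s) := by
  rw [stepMeasure, FiniteMeasure.toMeasure_smul, FiniteMeasure.toMeasure_add]
  rfl

lemma stepMeasure_univ (n : ℕ) (w : Word → ℝ) (a : ℝ) {L : ℝ} (hL : 0 ≤ L) :
    (stepMeasure n w a L : Measure ℝ) Set.univ = ENNReal.ofReal L * stepMass n w := by
  induction n generalizing w a L with
  | zero => simp [stepMeasure, intervalLebesgue, stepMass_zero]
  | succ n ih =>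
    rw [toMeasure_stepMeasure_succ, ih _ _ (by linarith), ih _ _ (by linarith), stepMass_succ,
      ENNReal.ofReal_div_of_pos (by norm_num), ENNReal.ofReal_ofNat]
    simp only [ENNReal.div_eq_inv_mul]
    ring

lemma stepMeasure_compl (n : ℕ) (w : Word → ℝ) (a : ℝ) {L : ℝ} (hL : 0 ≤ L) :
    (stepMeasure n w a L : Measure ℝ) (Set.Icc a (a + L))ᶜ = 0 := by
  induction n generalizing w a L with
  | zero =>
    simp only [stepMeasure, intervalLebesgue, FiniteMeasure.toMeasure_mk]
    rw [Measure.restrict_apply measurableSet_Icc.compl]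
    simp
  | succ n ih =>
    rw [toMeasure_stepMeasure_succ,
      measure_mono_null (t := (Set.Icc a (a + L / 2))ᶜ) _ (ih _ _ (by linarith)),
      measure_mono_null (t := (Set.Icc (a + L / 2) (a + L / 2 + L / 2))ᶜ) _ (ih _ _ (by linarith))]
    · simp
    · exact Set.compl_subset_compl.2 (Set.Icc_subset_Icc (by linarith) (by linarith))
    · exact Set.compl_subset_compl.2 (Set.Icc_subset_Icc (by linarith) (by linarith))

lemma RegularTree.tendsto {w : Word → ℝ} (h : RegularTree w) :
    Tendsto (fun n => (stepMass n w).toReal) atTop (𝓝 (limitMass w).toReal) :=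
  (ENNReal.tendsto_toReal (h.limitMass_ne_top [])).comp (h.tendsto_stepMass [])

lemma RegularTree.toReal_limitMass_eq {w : Word → ℝ} (h : RegularTree w) : (limitMass w).toReal =
    w [] / 2 * ((limitMass (Cascade.shift 0 w)).toReal + (limitMass (Cascade.shift 1 w)).toReal) := by
  have h0 : limitMass (Cascade.shift 0 w) ≠ ⊤ := (h.shift 0).limitMass_ne_top []
  have h1 : limitMass (Cascade.shift 1 w) ≠ ⊤ := (h.shift 1).limitMass_ne_top []
  rw [h.limitMass_eq, ENNReal.toReal_mul, ENNReal.toReal_add h0 h1, ENNReal.toReal_div,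
    ENNReal.toReal_ofReal (h.weight_pos []).le]
  simp

lemma integral_stepMeasure_succ (f : BoundedContinuousFunction ℝ ℝ) (n : ℕ) {w : Word → ℝ}
    (hw : 0 ≤ w []) (a L : ℝ) : ∫ x, f x ∂(stepMeasure (n + 1) w a L : Measure ℝ) =
      w [] * (∫ x, f x ∂(stepMeasure n (shift 0 w) a (L / 2) : Measure ℝ) +
        ∫ x, f x ∂(stepMeasure n (shift 1 w) (a + L / 2) (L / 2) : Measure ℝ)) := by
  rw [stepMeasure, FiniteMeasure.toMeasure_smul, FiniteMeasure.toMeasure_add,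
    integral_smul_nnreal_measure,
    integral_add_measure (f.integrable _) (f.integrable _), NNReal.smul_def, smul_eq_mul,
    Real.coe_toNNReal _ hw]

/-- Approximate convergence of the integrals of a function of small oscillation. -/
lemma RegularTree.exists_approx_integral (f : BoundedContinuousFunction ℝ ℝ) {ε : ℝ}
    (j : ℕ) : ∀ {w : Word → ℝ}, RegularTree w → ∀ (a L : ℝ), 0 ≤ L →
      (∀ x ∈ Set.Icc a (a + L), ∀ y ∈ Set.Icc a (a + L), |x - y| ≤ L / 2 ^ j → |f x - f y| ≤ ε) →
      ∃ A : ℝ, ∀ η > 0, ∀ᶠ n in atTop,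
        |∫ x, f x ∂(stepMeasure n w a L : Measure ℝ) - A| ≤ ε * L * (limitMass w).toReal + η := by
  induction j with
  | zero =>
    intro w hw a L hL hosc
    -- At the coarsest scale `f` is replaced by its value at the left end point, and only the total
    -- mass has to converge.
    refine ⟨f a * (L * (limitMass w).toReal), fun η hη => ?_⟩
    have hmass : ∀ n, (stepMeasure n w a L : Measure ℝ).real Set.univ = L * (stepMass n w).toReal := by
      intro n
      rw [Measure.real, stepMeasure_univ n w a hL, ENNReal.toReal_mul, ENNReal.toReal_ofReal hL]
    have hbound : ∀ n, |∫ x, f x ∂(stepMeasure n w a L : Measure ℝ) -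
        f a * (L * (limitMass w).toReal)| ≤ ε * (L * (stepMass n w).toReal) +
          |f a| * |L * (stepMass n w).toReal - L * (limitMass w).toReal| := by
      intro n
      have h1 : ‖∫ x, (f x - f a) ∂(stepMeasure n w a L : Measure ℝ)‖ ≤
          ε * (stepMeasure n w a L : Measure ℝ).real Set.univ := by
        refine norm_integral_le_of_norm_le_const ?_
        have : ∀ᵐ x ∂(stepMeasure n w a L : Measure ℝ), x ∈ Set.Icc a (a + L) :=
          stepMeasure_compl n w a hL
        filter_upwards [this] with x hx
        refine hosc x hx a ⟨le_rfl, by linarith⟩ ?_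
        rw [pow_zero, div_one, abs_le]
        constructor <;> linarith [hx.1, hx.2]
      rw [integral_sub (f.integrable _) (integrable_const _), integral_const, hmass, Real.norm_eq_abs,
        smul_eq_mul] at h1
      rw [← abs_mul]
      refine le_trans ?_ (add_le_add h1 le_rfl)
      refine le_trans (le_of_eq ?_) (abs_add_le _ _)
      ring_nf
    have hlim : Tendsto (fun n => ε * (L * (stepMass n w).toReal) +
        |f a| * |L * (stepMass n w).toReal - L * (limitMass w).toReal|) atTop
        (𝓝 (ε * (L * (limitMass w).toReal) + |f a| * |L * (limitMass w).toReal -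
          L * (limitMass w).toReal|)) :=
      ((hw.tendsto.const_mul L).const_mul ε).add
        (((hw.tendsto.const_mul L).sub_const _).abs.const_mul _)
    filter_upwards [hlim.eventually_le_const (u := ε * L * (limitMass w).toReal + η)
      (by simp; nlinarith)] with n hn
    exact (hbound n).trans hn
  | succ j ih =>
    intro w hw a L hL hosc
    have hpow : L / 2 / 2 ^ j = L / 2 ^ (j + 1) := by rw [pow_succ']; field_simp
    obtain ⟨A₀, h₀⟩ := ih (hw.shift 0) a (L / 2) (by linarith) (by
      intro x hx y hy hxy
      refine hosc x ⟨hx.1, by linarith [hx.2]⟩ y ⟨hy.1, by linarith [hy.2]⟩ (by rwa [← hpow]))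
    obtain ⟨A₁, h₁⟩ := ih (hw.shift 1) (a + L / 2) (L / 2) (by linarith) (by
      intro x hx y hy hxy
      refine hosc x ⟨by linarith [hx.1], by linarith [hx.2]⟩ y
        ⟨by linarith [hy.1], by linarith [hy.2]⟩ (by rwa [← hpow]))
    have hr := hw.weight_pos []
    refine ⟨w [] * (A₀ + A₁), fun η hη => ?_⟩
    -- The two errors are added and then multiplied by the root weight, giving η. The main errors
    -- combine exactly, by the recursion of the limit mass.
    have hη' : 0 < η / (2 * w []) := by positivity
    obtain ⟨N, hN⟩ := eventually_atTop.1 ((h₀ _ hη').and (h₁ _ hη'))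
    refine eventually_atTop.2 ⟨N + 1, fun n hn => ?_⟩
    obtain ⟨m, rfl⟩ : ∃ m, n = m + 1 := ⟨n - 1, by omega⟩
    obtain ⟨hn₀, hn₁⟩ := hN m (by omega)
    rw [integral_stepMeasure_succ f m hr.le, hw.toReal_limitMass_eq, ← mul_sub, abs_mul,
      abs_of_pos hr, add_sub_add_comm]
    have hηw : w [] * (η / (2 * w [])) = η / 2 := by field_simp
    have h3 := mul_le_mul_of_nonneg_left ((abs_add_le _ _).trans (add_le_add hn₀ hn₁)) hr.le
    refine h3.trans (le_of_eq ?_)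
    linear_combination 2 * hηw

/-- Uniform continuity makes the oscillation of `f` small at a fine dyadic scale, and the
approximation then shows that the integrals form a Cauchy sequence. -/
lemma RegularTree.exists_tendsto_integral {w : Word → ℝ} (hw : RegularTree w) (a : ℝ) {L : ℝ}
    (hL : 0 ≤ L) (f : BoundedContinuousFunction ℝ ℝ) : ∃ l, Tendsto
      (fun n => ∫ x, f x ∂(stepMeasure n w a L : Measure ℝ)) atTop (𝓝 l) := by
  refine cauchySeq_tendsto_of_complete (Metric.cauchySeq_iff'.2 fun δ hδ => ?_)
  set Y := (limitMass w).toReal with hY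
  have hY0 : 0 ≤ Y := ENNReal.toReal_nonneg
  set ε := δ / (8 * (L * Y + 1)) with hε
  have hLY : 0 ≤ L * Y := by positivity
  have hε0 : 0 < ε := by positivity
  have huc : UniformContinuousOn f (Set.Icc a (a + L)) :=
    isCompact_Icc.uniformContinuousOn_of_continuous f.continuous.continuousOn
  obtain ⟨ρ, hρ, hρf⟩ := Metric.uniformContinuousOn_iff.1 huc ε hε0
  obtain ⟨j, hj⟩ : ∃ j : ℕ, L / 2 ^ j < ρ := by
    have : Tendsto (fun j : ℕ => L / 2 ^ j) atTop (𝓝 0) :=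
      tendsto_const_nhds.div_atTop (tendsto_pow_atTop_atTop_of_one_lt (by norm_num))
    exact (this.eventually_lt_const hρ).exists
  obtain ⟨A, hA⟩ := RegularTree.exists_approx_integral f j hw a L hL
    fun x hx y hy hxy => (hρf x hx y hy (lt_of_le_of_lt hxy hj)).le
  obtain ⟨N, hN⟩ := eventually_atTop.1 (hA (δ / 8) (by positivity))
  have hεY : ε * L * Y ≤ δ / 8 := by
    rw [hε, div_mul_eq_mul_div, div_mul_eq_mul_div, div_le_div_iff₀ (by positivity) (by norm_num)]
    nlinarith
  refine ⟨N, fun n hn => ?_⟩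
  have h1 := hN n hn
  have h2 := hN N le_rfl
  rw [Real.dist_eq]
  rw [abs_le] at h1 h2
  rw [abs_lt]
  constructor <;> linarith

/-- Measures of bounded mass carried by a fixed compact interval form a compact set, so there is a
limit along an ultrafilter. Convergence of each integral upgrades this to convergence of the whole
sequence. -/
lemma RegularTree.exists_tendsto_stepMeasure {w : Word → ℝ} (hw : RegularTree w) (a : ℝ) {L : ℝ}
    (hL : 0 ≤ L) : ∃ μ : FiniteMeasure ℝ, Tendsto (fun n => stepMeasure n w a L) atTop (𝓝 μ) ∧
      (μ : Measure ℝ) (Set.Icc a (a + L))ᶜ = 0 := by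
  have hmass : ∀ n, ((stepMeasure n w a L).mass : ℝ) = L * (stepMass n w).toReal := by
    intro n
    have := stepMeasure_univ n w a hL
    rw [← FiniteMeasure.ennreal_mass] at this
    rw [← ENNReal.coe_toReal, this, ENNReal.toReal_mul, ENNReal.toReal_ofReal hL]
  obtain ⟨C, hC⟩ := (hw.tendsto.const_mul L).bddAbove_range
  have hK := isCompact_setOfPred_finiteMeasure_le_of_isCompact C.toNNReal
    (isCompact_Icc (a := a) (b := a + L))
  have hmem : ∀ n, stepMeasure n w a L ∈
      {μ : FiniteMeasure ℝ | μ.mass ≤ C.toNNReal ∧ μ (Set.Icc a (a + L))ᶜ = 0} := by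
    intro n
    refine ⟨?_, ?_⟩
    · refine NNReal.le_toNNReal_of_coe_le ?_
      rw [hmass]
      exact hC ⟨n, rfl⟩
    · exact (FiniteMeasure.null_iff_toMeasure_null _ _).2 (stepMeasure_compl n w a hL)
  let U : Ultrafilter ℕ := Ultrafilter.of atTop
  have hU : (U : Filter ℕ) ≤ atTop := Ultrafilter.of_le atTop
  obtain ⟨μ, hμK, hμ⟩ := hK.ultrafilter_le_nhds (U.map fun n => stepMeasure n w a L)
    (by
      rw [le_principal_iff]
      exact Filter.mem_map.2 (Filter.univ_mem' hmem))
  refine ⟨μ, FiniteMeasure.tendsto_iff_forall_integral_tendsto.2 fun f => ?_,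
    (FiniteMeasure.null_iff_toMeasure_null _ _).1 hμK.2⟩
  obtain ⟨l, hl⟩ := hw.exists_tendsto_integral a hL f
  have h1 : Tendsto (fun n => stepMeasure n w a L) U (𝓝 μ) := hμ
  have h2 := FiniteMeasure.tendsto_iff_forall_integral_tendsto.1 h1 f
  rwa [tendsto_nhds_unique h2 (hl.mono_left hU)]

end Convergence

/-! ### The limit measure on dyadic intervals. -/

/-- The cascade measure of a tree on `[a, a + L]`. -/
noncomputable def limitMeasure (w : Word → ℝ) (a L : ℝ) : FiniteMeasure ℝ :=
  limUnder atTop fun n => stepMeasure n w a L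

namespace RegularTree

variable {w : Word → ℝ} {a L : ℝ}

lemma tendsto_limitMeasure (hw : RegularTree w) (hL : 0 ≤ L) :
    Tendsto (fun n => stepMeasure n w a L) atTop (𝓝 (limitMeasure w a L)) := by
  obtain ⟨μ, hμ, -⟩ := hw.exists_tendsto_stepMeasure a hL
  rw [limitMeasure, hμ.limUnder_eq]
  exact hμ

lemma limitMeasure_eq (hw : RegularTree w) (hL : 0 ≤ L) : limitMeasure w a L =
    (w []).toNNReal • (limitMeasure (Cascade.shift 0 w) a (L / 2) +
      limitMeasure (Cascade.shift 1 w) (a + L / 2) (L / 2)) := by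
  refine tendsto_nhds_unique ((tendsto_add_atTop_iff_nat 1).2 (hw.tendsto_limitMeasure hL)) ?_
  simp only [stepMeasure]
  exact (((hw.shift 0).tendsto_limitMeasure (by linarith)).add
    ((hw.shift 1).tendsto_limitMeasure (by linarith))).const_smul _

lemma limitMeasure_apply (hw : RegularTree w) (hL : 0 ≤ L) (s : Set ℝ) :
    (limitMeasure w a L : Measure ℝ) s = ENNReal.ofReal (w []) *
      ((limitMeasure (Cascade.shift 0 w) a (L / 2) : Measure ℝ) s +
        (limitMeasure (Cascade.shift 1 w) (a + L / 2) (L / 2) : Measure ℝ) s) := by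
  rw [hw.limitMeasure_eq hL, FiniteMeasure.toMeasure_smul, FiniteMeasure.toMeasure_add]
  rfl

lemma limitMeasure_univ (hw : RegularTree w) (hL : 0 ≤ L) :
    (limitMeasure w a L : Measure ℝ) Set.univ = ENNReal.ofReal L * limitMass w := by
  rw [← FiniteMeasure.ennreal_mass]
  refine tendsto_nhds_unique
    ((ENNReal.continuous_coe.tendsto _).comp (hw.tendsto_limitMeasure (a := a) hL).mass) ?_
  have : ∀ n, ((stepMeasure n w a L).mass : ℝ≥0∞) = ENNReal.ofReal L * stepMass n w := fun n => by
    rw [FiniteMeasure.ennreal_mass, stepMeasure_univ n w a hL]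
  simp only [Function.comp_def, this]
  exact ENNReal.Tendsto.const_mul (hw.tendsto_stepMass []) (Or.inr ENNReal.ofReal_ne_top)

lemma limitMeasure_compl (hw : RegularTree w) (hL : 0 ≤ L) :
    (limitMeasure w a L : Measure ℝ) (Set.Icc a (a + L))ᶜ = 0 := by
  obtain ⟨μ, hμ, hK⟩ := hw.exists_tendsto_stepMeasure a hL
  rwa [tendsto_nhds_unique (hw.tendsto_limitMeasure hL) hμ]

lemma limitMeasure_null (hw : RegularTree w) (hL : 0 ≤ L) {s : Set ℝ}
    (hs : s ⊆ (Set.Icc a (a + L))ᶜ) : (limitMeasure w a L : Measure ℝ) s = 0 :=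
  measure_mono_null hs (hw.limitMeasure_compl hL)

/-- The left end point lies outside the interval of the right child, so only the leftmost ray can
charge it. -/
lemma limitMeasure_left_le (n : ℕ) : ∀ {w : Word → ℝ} {a L : ℝ}, RegularTree w → 0 < L →
    (limitMeasure w a L : Measure ℝ) {a} ≤ ENNReal.ofReal L * rayMass 0 n w := by
  induction n with
  | zero =>
    intro w a L hw hL
    exact (measure_mono (Set.subset_univ _)).trans (hw.limitMeasure_univ hL.le).le
  | succ n ih =>
    intro w a L hw hL
    rw [hw.limitMeasure_apply hL.le, (hw.shift 1).limitMeasure_null (by linarith) (s := {a})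
      (by rintro x rfl; intro h; linarith [h.1]), add_zero, rayMass]
    refine (mul_le_mul_right (ih (hw.shift 0) (by linarith)) _).trans (le_of_eq ?_)
    rw [ENNReal.ofReal_div_of_pos (by norm_num), ENNReal.ofReal_ofNat]
    simp only [ENNReal.div_eq_inv_mul]
    ring

lemma limitMeasure_right_le (n : ℕ) : ∀ {w : Word → ℝ} {a L : ℝ}, RegularTree w → 0 < L →
    (limitMeasure w a L : Measure ℝ) {a + L} ≤ ENNReal.ofReal L * rayMass 1 n w := by
  induction n with
  | zero =>
    intro w a L hw hL
    exact (measure_mono (Set.subset_univ _)).trans (hw.limitMeasure_univ hL.le).le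
  | succ n ih =>
    intro w a L hw hL
    rw [hw.limitMeasure_apply hL.le, (hw.shift 0).limitMeasure_null (by linarith) (s := {a + L})
      (by rintro x rfl; intro h; linarith [h.2]), zero_add, rayMass]
    have := ih (a := a + L / 2) (hw.shift 1) (half_pos hL)
    rw [add_assoc, add_halves] at this
    refine (mul_le_mul_right this _).trans (le_of_eq ?_)
    rw [ENNReal.ofReal_div_of_pos (by norm_num), ENNReal.ofReal_ofNat]
    simp only [ENNReal.div_eq_inv_mul]
    ring

lemma limitMeasure_left (hw : RegularTree w) (hL : 0 < L) :
    (limitMeasure w a L : Measure ℝ) {a} = 0 := by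
  have h := ENNReal.Tendsto.const_mul (a := ENNReal.ofReal L) (hw.tendsto_rayMass [] 0)
    (Or.inr ENNReal.ofReal_ne_top)
  rw [mul_zero] at h
  exact le_antisymm (ge_of_tendsto' h fun n => limitMeasure_left_le n hw hL) zero_le

lemma limitMeasure_right (hw : RegularTree w) (hL : 0 < L) :
    (limitMeasure w a L : Measure ℝ) {a + L} = 0 := by
  have h := ENNReal.Tendsto.const_mul (a := ENNReal.ofReal L) (hw.tendsto_rayMass [] 1)
    (Or.inr ENNReal.ofReal_ne_top)
  rw [mul_zero] at h
  exact le_antisymm (ge_of_tendsto' h fun n => limitMeasure_right_le n hw hL) zero_le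

lemma limitMeasure_Iic (hw : RegularTree w) (hL : 0 < L) {s : Set ℝ} (hs : s ⊆ Set.Iic a) :
    (limitMeasure w a L : Measure ℝ) s = 0 := by
  refine measure_mono_null (t := {a} ∪ (Set.Icc a (a + L))ᶜ) (fun x hx => ?_)
    (measure_union_null (hw.limitMeasure_left hL) (hw.limitMeasure_compl hL.le))
  rcases eq_or_lt_of_le (Set.mem_Iic.1 (hs hx)) with h | h
  · exact Or.inl h
  · exact Or.inr fun h' => absurd h'.1 (not_le.2 h)

lemma limitMeasure_Ici (hw : RegularTree w) (hL : 0 < L) {s : Set ℝ} (hs : s ⊆ Set.Ici (a + L)) :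
    (limitMeasure w a L : Measure ℝ) s = 0 := by
  refine measure_mono_null (t := {a + L} ∪ (Set.Icc a (a + L))ᶜ) (fun x hx => ?_)
    (measure_union_null (hw.limitMeasure_right hL) (hw.limitMeasure_compl hL.le))
  rcases eq_or_lt_of_le (Set.mem_Ici.1 (hs hx)) with h | h
  · exact Or.inl h.symm
  · exact Or.inr fun h' => absurd h'.2 (not_le.2 h)

/-- The partition function of a cascade measure in terms of the tree. -/
lemma sum_limitMeasure_rpow (p : ℝ) (j : ℕ) : ∀ {w : Word → ℝ} {a L : ℝ}, RegularTree w → 0 < L →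
    ∑ k ∈ Finset.range (2 ^ j), (limitMeasure w a L : Measure ℝ)
      (Set.Icc (a + k * (L / 2 ^ j)) (a + (k + 1) * (L / 2 ^ j))) ^ p =
    ENNReal.ofReal L ^ p * weightedSum p (fun w => limitMass w ^ p) j w := by
  induction j with
  | zero =>
    intro w a L hw hL
    have h1 : (limitMeasure w a L : Measure ℝ) (Set.Icc a (a + L)) = ENNReal.ofReal L * limitMass w := by
      rw [← hw.limitMeasure_univ hL.le (a := a)]
      refine measure_congr (ae_eq_univ.2 (hw.limitMeasure_compl hL.le))
    simp only [pow_zero, Finset.range_one, Finset.sum_singleton, Nat.cast_zero, zero_mul, add_zero,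
      zero_add, div_one, one_mul, h1, weightedSum]
    exact ENNReal.mul_rpow_of_ne_top ENNReal.ofReal_ne_top (hw.limitMass_ne_top []) p
  | succ j ih =>
    intro w a L hw hL
    have hp : (0 : ℝ) < 2 ^ j := by positivity
    have hd : L / 2 ^ (j + 1) = L / 2 / 2 ^ j := by rw [pow_succ']; field_simp
    have hd' : (2 : ℝ) ^ j * (L / 2 / 2 ^ j) = L / 2 := by field_simp
    have hLj : 0 < L / 2 / 2 ^ j := by positivity
    rw [hd, show 2 ^ (j + 1) = 2 ^ j + 2 ^ j by ring, Finset.sum_range_add]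
    have hroot : ENNReal.ofReal (w []) ≠ ⊤ := ENNReal.ofReal_ne_top
    have h0 : ∀ k ∈ Finset.range (2 ^ j), (limitMeasure w a L : Measure ℝ)
        (Set.Icc (a + k * (L / 2 / 2 ^ j)) (a + (k + 1) * (L / 2 / 2 ^ j))) ^ p =
        ENNReal.ofReal (w []) ^ p * (limitMeasure (Cascade.shift 0 w) a (L / 2) : Measure ℝ)
          (Set.Icc (a + k * (L / 2 / 2 ^ j)) (a + (k + 1) * (L / 2 / 2 ^ j))) ^ p := by
      intro k hk
      have hk' : ((k : ℝ) + 1) ≤ 2 ^ j := by exact_mod_cast Finset.mem_range.1 hk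
      rw [hw.limitMeasure_apply hL.le, (hw.shift 1).limitMeasure_Iic (half_pos hL), add_zero,
        ENNReal.mul_rpow_of_ne_top hroot (measure_ne_top _ _)]
      rintro x ⟨-, hx⟩
      have := mul_le_mul_of_nonneg_right hk' hLj.le
      exact hx.trans (by linarith)
    have h1 : ∀ k ∈ Finset.range (2 ^ j), (limitMeasure w a L : Measure ℝ)
        (Set.Icc (a + ((2 ^ j + k : ℕ) : ℝ) * (L / 2 / 2 ^ j))
          (a + (((2 ^ j + k : ℕ) : ℝ) + 1) * (L / 2 / 2 ^ j))) ^ p =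
        ENNReal.ofReal (w []) ^ p *
          (limitMeasure (Cascade.shift 1 w) (a + L / 2) (L / 2) : Measure ℝ)
          (Set.Icc (a + L / 2 + k * (L / 2 / 2 ^ j)) (a + L / 2 + (k + 1) * (L / 2 / 2 ^ j))) ^ p := by
      intro k _
      have e1 : a + ((2 ^ j + k : ℕ) : ℝ) * (L / 2 / 2 ^ j) = a + L / 2 + k * (L / 2 / 2 ^ j) := by
        push_cast; rw [add_mul, hd']; ring
      have e2 : a + (((2 ^ j + k : ℕ) : ℝ) + 1) * (L / 2 / 2 ^ j) =
          a + L / 2 + (k + 1) * (L / 2 / 2 ^ j) := by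
        push_cast; rw [add_mul, add_mul, hd']; ring
      rw [e1, e2, hw.limitMeasure_apply hL.le, (hw.shift 0).limitMeasure_Ici (half_pos hL), zero_add,
        ENNReal.mul_rpow_of_ne_top hroot (measure_ne_top _ _)]
      rintro x ⟨hx, -⟩
      exact le_trans (by have := mul_nonneg (Nat.cast_nonneg (α := ℝ) k) hLj.le; linarith) hx
    -- Each half of the intervals sees only one child, the other meeting it at most at the common
    -- end point, which is null. The remaining identity is the recursion of `weightedSum`, with L/2
    -- accounting for the halved weight.
    rw [Finset.sum_congr rfl h0, Finset.sum_congr rfl h1, ← Finset.mul_sum, ← Finset.mul_sum,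
      ih (hw.shift 0) (half_pos hL), ih (hw.shift 1) (half_pos hL), weightedSum]
    rw [ENNReal.ofReal_div_of_pos (by norm_num), ENNReal.ofReal_ofNat]
    simp only [ENNReal.div_eq_inv_mul]
    rw [ENNReal.mul_rpow_of_ne_top (by simp) ENNReal.ofReal_ne_top,
      ENNReal.mul_rpow_of_ne_top (by simp) ENNReal.ofReal_ne_top]
    ring

lemma weightedSum_ne_top (p : ℝ) (j : ℕ) : ∀ {w : Word → ℝ}, RegularTree w →
    weightedSum p (fun w => limitMass w ^ p) j w ≠ ⊤ := by
  induction j with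
  | zero =>
    exact fun hw => ENNReal.rpow_ne_top_of_ne_zero (hw.limitMass_ne_zero []) (hw.limitMass_ne_top [])
  | succ j ih =>
    intro w hw
    have h0 : ENNReal.ofReal (w []) / 2 ≠ 0 := by simp [hw.weight_pos []]
    exact ENNReal.mul_ne_top (ENNReal.rpow_ne_top_of_ne_zero h0
      (ENNReal.div_ne_top ENNReal.ofReal_ne_top (by simp)))
      (ENNReal.add_ne_top.2 ⟨ih (hw.shift 0), ih (hw.shift 1)⟩)

/-- Read off from the partition function with exponent -1: its value is finite, so no term can be
infinite. -/
lemma limitMeasure_Icc_ne_zero (hw : RegularTree w) (hL : 0 < L) {j k : ℕ} (hk : k < 2 ^ j) :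
    (limitMeasure w a L : Measure ℝ)
      (Set.Icc (a + k * (L / 2 ^ j)) (a + (k + 1) * (L / 2 ^ j))) ≠ 0 := by
  intro h
  have h1 := sum_limitMeasure_rpow (-1) j (a := a) hw hL
  have h2 : ENNReal.ofReal L ^ (-1 : ℝ) *
      weightedSum (-1) (fun w => limitMass w ^ (-1 : ℝ)) j w ≠ ⊤ :=
    ENNReal.mul_ne_top (ENNReal.rpow_ne_top_of_ne_zero (by simpa using hL) ENNReal.ofReal_ne_top)
      (hw.weightedSum_ne_top _ _)
  rw [← h1] at h2
  refine ENNReal.sum_ne_top.1 h2 k (Finset.mem_range.2 hk) ?_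
  rw [h, ENNReal.zero_rpow_of_neg (by norm_num)]

/-- Almost sure regularity concerns trees with random root. The cascades carry root weight one, so
regularity is rebuilt from their first-generation subtrees. -/
lemma of_shift (h0 : 0 < w []) (h : ∀ i, RegularTree (Cascade.shift i w)) : RegularTree w := by
  have ht : Tendsto (fun n => stepMass n w) atTop (𝓝 (limitMass w)) := by
    have := tendsto_limitMass_recursion fun i => (h i).tendsto_stepMass []
    rwa [← limitMass_recursion fun i => (h i).tendsto_stepMass []] at this
  have he := limitMass_recursion fun i => (h i).tendsto_stepMass []
  have hz : ∀ i, limitMass (Cascade.shift i w) ≠ 0 := fun i => (h i).limitMass_ne_zero []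
  have hi : ∀ i, limitMass (Cascade.shift i w) ≠ ⊤ := fun i => (h i).limitMass_ne_top []
  refine ⟨fun s => ?_, fun s => ?_, fun s => ?_, fun s => ?_, fun s i => ?_⟩
  · match s with
    | [] => exact h0
    | i :: r => exact (h i).weight_pos r
  · match s with
    | [] => exact ht
    | i :: r => simpa only [subtree_shift] using (h i).tendsto_stepMass r
  · match s with
    | [] =>
      change limitMass w ≠ 0
      rw [he]
      simp [h0, hz]
    | i :: r => simpa only [subtree_shift] using (h i).limitMass_ne_zero r
  · match s with
    | [] =>
      change limitMass w ≠ ⊤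
      rw [he]
      exact ENNReal.mul_ne_top (ENNReal.div_ne_top ENNReal.ofReal_ne_top (by simp))
        (ENNReal.add_ne_top.2 ⟨hi 0, hi 1⟩)
    | i :: r => simpa only [subtree_shift] using (h i).limitMass_ne_top r
  · match s with
    | [] =>
      change Tendsto (fun n => rayMass i n w) atTop (𝓝 0)
      rw [← tendsto_add_atTop_iff_nat 1]
      simp only [rayMass]
      have := ENNReal.Tendsto.const_mul (a := ENNReal.ofReal (w []) / 2)
        ((h i).tendsto_rayMass [] i)
        (Or.inr (ENNReal.div_ne_top ENNReal.ofReal_ne_top (by simp)))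
      rwa [mul_zero] at this
    | k :: r => simpa only [subtree_shift] using (h k).tendsto_rayMass r i

lemma unitRoot {w : Word → ℝ} (h : ∀ i, RegularTree (Cascade.shift i w)) :
    RegularTree (Cascade.unitRoot w) :=
  of_shift (by simp [Cascade.unitRoot]) h

end RegularTree

/-! ### The concatenated measure and its partition function. -/

lemma cascadeMeasure_eq {w : Word → ℝ} (h : ∀ i, RegularTree (shift i w)) {T : ℝ} (hT : 0 ≤ T) :
    cascadeMeasure T w = limitMeasure (unitRoot w) 0 T := by
  have hw : ∀ s, s ≠ [] → 0 ≤ w s := fun s hs => by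
    match s with
    | [] => exact absurd rfl hs
    | i :: r => exact ((h i).weight_pos r).le
  have hlim := (tendsto_add_atTop_iff_nat 1).2
    ((RegularTree.unitRoot h).tendsto_limitMeasure (a := 0) hT)
  refine Tendsto.limUnder_eq (hlim.congr fun n => ?_)
  exact (cascadeStep_eq_stepMeasure hw hT n).symm

/-- The mass given by the concatenated measure to a dyadic interval comes from one cascade. -/
lemma concatMeasure_dyadicInterval {w : ℕ → Word → ℝ} (h : ∀ m i, RegularTree (shift i (w m)))
    {T : ℝ} (hT : 0 < T) (j m k : ℕ) (hk : k < 2 ^ j) :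
    concatMeasure T w (dyadicInterval T j (m * 2 ^ j + k)) =
      (limitMeasure (unitRoot (w m)) 0 T : Measure ℝ)
        (Set.Icc (0 + k * (T / 2 ^ j)) (0 + (k + 1) * (T / 2 ^ j))) := by
  have hms : MeasurableSet (dyadicInterval T j (m * 2 ^ j + k)) := measurableSet_Icc
  have hp : (0 : ℝ) < 2 ^ j := by positivity
  have hTj : 0 < T / 2 ^ j := by positivity
  have hTj' : 2 ^ j * (T / 2 ^ j) = T := by field_simp
  have hpre : ∀ m' : ℕ, (fun t : ℝ => t + (m' : ℝ) * T) ⁻¹' dyadicInterval T j (m * 2 ^ j + k) =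
      Set.Icc (((m : ℝ) - m') * T + k * (T / 2 ^ j)) (((m : ℝ) - m') * T + (k + 1) * (T / 2 ^ j)) := by
    intro m'
    have e1 : ((m * 2 ^ j + k : ℕ) : ℝ) * 2 ^ (-(j : ℤ)) * T = m * T + k * (T / 2 ^ j) := by
      rw [zpow_neg, zpow_natCast]; push_cast; field_simp
    have e2 : (((m * 2 ^ j + k : ℕ) : ℝ) + 1) * 2 ^ (-(j : ℤ)) * T =
        m * T + (k + 1) * (T / 2 ^ j) := by
      rw [zpow_neg, zpow_natCast]; push_cast; field_simp; ring
    ext t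
    simp only [dyadicInterval, e1, e2, Set.mem_preimage, Set.mem_Icc]
    constructor <;> rintro ⟨h1, h2⟩ <;> constructor <;> linarith
  have hk' : ((k : ℝ) + 1) * (T / 2 ^ j) ≤ T := by
    have : ((k : ℝ) + 1) ≤ 2 ^ j := by exact_mod_cast hk
    calc _ ≤ 2 ^ j * (T / 2 ^ j) := by gcongr
      _ = T := hTj'
  have hk0 : 0 ≤ (k : ℝ) * (T / 2 ^ j) := by positivity
  -- The other translated cascades meet the interval at most at an end point of their support, where
  -- they have no atom.
  rw [concatMeasure, Measure.sum_apply _ hms, tsum_eq_single m]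
  · rw [Measure.map_apply (by fun_prop) hms, hpre, cascadeMeasure_eq (h m) hT.le]
    simp
  · intro m' hm'
    rw [Measure.map_apply (by fun_prop) hms, hpre, cascadeMeasure_eq (h m') hT.le]
    rcases lt_or_gt_of_ne hm' with hlt | hlt
    · refine (RegularTree.unitRoot (h m')).limitMeasure_Ici hT fun x hx => ?_
      have : (1 : ℝ) ≤ (m : ℝ) - m' := by
        have : (m' : ℝ) + 1 ≤ m := by exact_mod_cast hlt
        linarith
      have := mul_le_mul_of_nonneg_right this hT.le
      exact le_trans (by linarith) hx.1
    · refine (RegularTree.unitRoot (h m')).limitMeasure_Iic hT fun x hx => ?_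
      have : (m : ℝ) - m' ≤ -1 := by
        have : (m : ℝ) + 1 ≤ m' := by exact_mod_cast hlt
        linarith
      have := mul_le_mul_of_nonneg_right this hT.le
      exact hx.2.trans (by linarith)

lemma sum_range_mul {M : Type*} [AddCommMonoid M] (f : ℕ → M) (n k : ℕ) :
    ∑ i ∈ Finset.range (n * k), f i =
      ∑ m ∈ Finset.range n, ∑ l ∈ Finset.range k, f (m * k + l) := by
  induction n with
  | zero => simp
  | succ n ih => rw [add_mul, one_mul, Finset.sum_range_add, ih, Finset.sum_range_succ]

section Partition

variable {w : ℕ → Word → ℝ} {T : ℝ}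

lemma concatMeasure_real_pos (h : ∀ m i, RegularTree (shift i (w m))) (hT : 0 < T) {j n : ℕ} :
    0 < (concatMeasure T w).real (dyadicInterval T j n) := by
  have h2 : 0 < 2 ^ j := by positivity
  have hk := Nat.mod_lt n h2
  rw [← Nat.div_add_mod' n (2 ^ j), Measure.real, concatMeasure_dyadicInterval h hT _ _ _ hk]
  exact ENNReal.toReal_pos ((RegularTree.unitRoot (h _)).limitMeasure_Icc_ne_zero hT hk)
    (measure_ne_top _ _)

/-- The partition function as a sum over independent trees. -/
lemma ofReal_partitionFn (h : ∀ m i, RegularTree (shift i (w m))) (hT : 0 < T) (χ p : ℝ) (j : ℕ) :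
    ENNReal.ofReal (partitionFn T χ w (j + 1) p) =
      ENNReal.ofReal (T / 2) ^ p * ∑ m ∈ Finset.range (numScales χ (j + 1)),
        ∑ i : Fin 2, weightedSum p (fun w => limitMass w ^ p) j (shift i (w m)) := by
  rw [partitionFn, ENNReal.ofReal_sum_of_nonneg fun _ _ =>
    Real.rpow_nonneg measureReal_nonneg p, sum_range_mul, Finset.mul_sum]
  refine Finset.sum_congr rfl fun m _ => ?_
  have hr := RegularTree.unitRoot (h m)
  have h1 := RegularTree.sum_limitMeasure_rpow p (j + 1) (a := 0) hr hT
  -- The root weight one contributes the factor (1/2)^p, which turns T into T/2.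
  have h2 : ENNReal.ofReal T ^ p *
      weightedSum p (fun w => limitMass w ^ p) (j + 1) (unitRoot (w m)) =
      ENNReal.ofReal (T / 2) ^ p *
        ∑ i : Fin 2, weightedSum p (fun w => limitMass w ^ p) j (shift i (w m)) := by
    rw [weightedSum, Fin.sum_univ_two, shift_unitRoot, shift_unitRoot, ← mul_assoc,
      ← ENNReal.mul_rpow_of_ne_top ENNReal.ofReal_ne_top
        (ENNReal.div_ne_top ENNReal.ofReal_ne_top (by simp))]
    congr 2
    simp [unitRoot, ENNReal.ofReal_div_of_pos, ENNReal.div_eq_inv_mul, mul_comm]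
  rw [← h2, ← h1]
  refine Finset.sum_congr rfl fun k hk => ?_
  have hk' := Finset.mem_range.1 hk
  rw [← ENNReal.ofReal_rpow_of_pos (concatMeasure_real_pos h hT), Measure.real,
    concatMeasure_dyadicInterval h hT _ _ _ hk', ENNReal.ofReal_toReal (measure_ne_top _ _)]

lemma numScales_pos {χ : ℝ} (hχ : 0 ≤ χ) (j : ℕ) : 0 < numScales χ j := by
  refine Nat.floor_pos.2 (Real.one_le_rpow ?_ hχ)
  exact one_le_pow₀ (by norm_num)

lemma partitionFn_pos (h : ∀ m i, RegularTree (shift i (w m))) (hT : 0 < T) {χ : ℝ} (hχ : 0 ≤ χ)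
    (j : ℕ) (p : ℝ) : 0 < partitionFn T χ w j p := by
  refine Finset.sum_pos (fun k _ => Real.rpow_pos_of_pos (concatMeasure_real_pos h hT) p) ?_
  exact Finset.nonempty_range_iff.2 (mul_pos (numScales_pos hχ j) (by positivity)).ne'

end Partition

/-! ### Independent trees and the almost sure upper bound. -/

section Forest

variable {Ω : Type*} [MeasurableSpace Ω] {P : Measure Ω}
  {ν : Measure ℝ}

/-- A family of i.i.d. trees. -/
structure IsForest (ν : Measure ℝ) (P : Measure Ω) (t : ℕ × Fin 2 → Ω → Word → ℝ) : Prop where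
  law : ∀ k, HasLaw (t k) (treeLaw ν) P
  indep : iIndepFun t P

lemma IsForest.ae {t : ℕ × Fin 2 → Ω → Word → ℝ} (h : IsForest ν P t) {p : (Word → ℝ) → Prop}
    (hp : ∀ᵐ w ∂(treeLaw ν), p w) : ∀ᵐ ω ∂P, ∀ k, p (t k ω) := by
  refine ae_all_iff.2 fun k => ae_of_ae_map (h.law k).aemeasurable ?_
  rwa [(h.law k).map_eq]

variable [IsProbabilityMeasure ν]

/-- The first-generation subtrees of a family of i.i.d. weights are i.i.d. trees. -/
lemma hasLaw_subtrees {W : ℕ → Word → Ω → ℝ}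
    (h_law : ∀ (m : ℕ) (r : Word), r ≠ [] → HasLaw (W m r) ν P)
    (h_indep : iIndepFun (fun (i : ℕ × {r : Word // r ≠ []}) => W i.1 i.2.1) P) :
    HasLaw (fun ω (k : ℕ × Fin 2) => shift k.2 fun r => W k.1 r ω)
      (Measure.infinitePi fun _ : ℕ × Fin 2 => treeLaw ν) P := by
  let g : (ℕ × Fin 2) × Word → ℕ × {r : Word // r ≠ []} :=
    fun x => (x.1.1, ⟨x.1.2 :: x.2, by simp⟩)
  have hg : Function.Injective g := by
    rintro ⟨⟨m, i⟩, r⟩ ⟨⟨m', i'⟩, r'⟩ h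
    simp only [g, Prod.mk.injEq, Subtype.mk.injEq, List.cons.injEq] at h
    simp [h.1, h.2.1, h.2.2]
  have h1 : HasLaw (fun ω (x : (ℕ × Fin 2) × Word) => W x.1.1 (x.1.2 :: x.2) ω)
      (Measure.infinitePi fun _ : (ℕ × Fin 2) × Word => ν) P :=
    (h_indep.precomp hg).hasLaw_infinitePi (fun x => h_law _ _ (by simp))
      (aemeasurable_pi_iff.2 fun x => (h_law _ _ (by simp)).aemeasurable)
  have h2 : HasLaw (MeasurableEquiv.curry (ℕ × Fin 2) Word ℝ)
      (Measure.infinitePi fun _ : ℕ × Fin 2 => treeLaw ν)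
      (Measure.infinitePi fun _ : (ℕ × Fin 2) × Word => ν) :=
    ⟨(MeasurableEquiv.measurable _).aemeasurable,
      Measure.infinitePi_map_curry fun (_ : ℕ × Fin 2) (_ : Word) => ν⟩
  exact h2.comp h1

lemma isForest_of_hasLaw [IsProbabilityMeasure P] {t : ℕ × Fin 2 → Ω → Word → ℝ}
    (h : HasLaw (fun ω k => t k ω) (Measure.infinitePi fun _ : ℕ × Fin 2 => treeLaw ν) P) :
    IsForest ν P t := by
  have hl : ∀ k, HasLaw (t k) (treeLaw ν) P := fun k => by
    have : HasLaw (fun x : ℕ × Fin 2 → Word → ℝ => x k) (treeLaw ν)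
        (Measure.infinitePi fun _ : ℕ × Fin 2 => treeLaw ν) :=
      ⟨(measurable_pi_apply k).aemeasurable, Measure.infinitePi_map_eval _ k⟩
    exact this.comp h
  exact ⟨hl, (iIndepFun_iff_hasLaw_Pi_infinitePi hl h.aemeasurable).2 h⟩

lemma IsForest.ae_regularTree {t : ℕ × Fin 2 → Ω → Word → ℝ} (h : IsForest ν P t)
    (hν : GeneratorLaw ν) (hpos : ∀ᵐ w ∂(treeLaw ν), limitMass w ≠ 0) :
    ∀ᵐ ω ∂P, ∀ k, RegularTree (t k ω) :=
  h.ae (hν.ae_regularTree hpos)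

lemma numScales_le (χ : ℝ) (j : ℕ) : (numScales χ j : ℝ) ≤ (2 : ℝ) ^ (j * χ) := by
  refine (Nat.floor_le (by positivity)).trans (le_of_eq ?_)
  rw [← Real.rpow_natCast, ← Real.rpow_mul (by norm_num)]

lemma le_two_mul_numScales {χ : ℝ} (hχ : 0 ≤ χ) (j : ℕ) :
    (2 : ℝ) ^ (j * χ) ≤ 2 * numScales χ j := by
  have h1 : (1 : ℝ) ≤ numScales χ j := by exact_mod_cast numScales_pos hχ j
  have h2 : ((2 : ℝ) ^ j) ^ χ < numScales χ j + 1 := Nat.lt_floor_add_one _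
  rw [← Real.rpow_natCast, ← Real.rpow_mul (by norm_num)] at h2
  linarith

/-- The sum of the weighted sums of generation `j` over the trees of index less than `N`. -/
noncomputable def forestSum (t : ℕ × Fin 2 → Ω → Word → ℝ) (p : ℝ) (j N : ℕ) (ω : Ω) : ℝ≥0∞ :=
  ∑ m ∈ Finset.range N, ∑ i : Fin 2, weightedSum p (fun w => limitMass w ^ p) j (t (m, i) ω)

lemma measurable_partition (p : ℝ) (j : ℕ) :
    Measurable (weightedSum p (fun w => limitMass w ^ p) j) :=
  measurable_weightedSum p (measurable_limitMass.pow_const p) j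

lemma lintegral_partition (hν : GeneratorLaw ν) (p : ℝ) (j : ℕ) :
    ∫⁻ w, weightedSum p (fun w => limitMass w ^ p) j w ∂(treeLaw ν) =
      ENNReal.ofReal (2 ^ (-(j * tau ν p))) * ∫⁻ w, limitMass w ^ p ∂(treeLaw ν) := by
  rw [lintegral_weightedSum ν p (measurable_limitMass.pow_const p), hν.two_mul_halfMoment,
    ← ENNReal.ofReal_pow (by positivity), ← Real.rpow_natCast, ← Real.rpow_mul (by norm_num)]
  ring_nf

lemma IsForest.lintegral_forestSum {t : ℕ × Fin 2 → Ω → Word → ℝ} (h : IsForest ν P t)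
    (hν : GeneratorLaw ν) (p : ℝ) (j N : ℕ) : ∫⁻ ω, forestSum t p j N ω ∂P =
      2 * N * (ENNReal.ofReal (2 ^ (-(j * tau ν p))) * ∫⁻ w, limitMass w ^ p ∂(treeLaw ν)) := by
  have hm : ∀ k, AEMeasurable (fun ω => weightedSum p (fun w => limitMass w ^ p) j (t k ω)) P :=
    fun k => (measurable_partition p j).comp_aemeasurable (h.law k).aemeasurable
  have hi : ∀ k, ∫⁻ ω, weightedSum p (fun w => limitMass w ^ p) j (t k ω) ∂P =
      ENNReal.ofReal (2 ^ (-(j * tau ν p))) * ∫⁻ w, limitMass w ^ p ∂(treeLaw ν) := fun k => by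
    rw [← lintegral_partition hν, ← (h.law k).map_eq,
      lintegral_map' (measurable_partition p j).aemeasurable (h.law k).aemeasurable]
  simp only [forestSum]
  rw [lintegral_finsetSum' _ fun m _ => Finset.aemeasurable_fun_sum _ fun i _ => hm _]
  simp only [lintegral_finsetSum' _ fun i _ => hm _, hi, Finset.sum_const, Finset.card_range,
    Finset.card_univ, Fintype.card_fin, nsmul_eq_mul]
  push_cast
  ring

/-- Almost sure upper bound for the partition functions. -/
lemma IsForest.ae_forestSum_le {t : ℕ × Fin 2 → Ω → Word → ℝ} (h : IsForest ν P t)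
    (hν : GeneratorLaw ν) {χ p ε : ℝ} (hp : ∫⁻ w, limitMass w ^ p ∂(treeLaw ν) ≠ ⊤) (hε : 0 < ε) :
    ∀ᵐ ω ∂P, ∀ᶠ j : ℕ in atTop, forestSum t p j (numScales χ (j + 1)) ω ≤
      ENNReal.ofReal (2 ^ (j * (χ - tau ν p + ε))) := by
  obtain ⟨M, h3, hM⟩ : ∃ M : ℝ, 0 ≤ M ∧ ∫⁻ w, limitMass w ^ p ∂(treeLaw ν) = ENNReal.ofReal M :=
    ⟨_, ENNReal.toReal_nonneg, (ENNReal.ofReal_toReal hp).symm⟩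
  have hmeas : ∀ j : ℕ, AEMeasurable (fun ω => ENNReal.ofReal (2 ^ (-(j * (χ - tau ν p + ε)))) *
      forestSum t p j (numScales χ (j + 1)) ω) P := fun j =>
    (Finset.aemeasurable_fun_sum _ fun m _ => Finset.aemeasurable_fun_sum _ fun i _ =>
      (measurable_partition p j).comp_aemeasurable (h.law _).aemeasurable).const_mul _
  -- The factor 2^χ comes from counting scales at level j + 1 instead of j. The ε in the exponent
  -- leaves the geometric decay 2^{-εj}, so no independence is needed.
  have hbound : ∀ j : ℕ, ∫⁻ ω, ENNReal.ofReal (2 ^ (-(j * (χ - tau ν p + ε)))) *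
      forestSum t p j (numScales χ (j + 1)) ω ∂P ≤
      ENNReal.ofReal (2 * 2 ^ χ * M * (2 ^ (-ε)) ^ j) := by
    intro j
    rw [lintegral_const_mul' _ _ ENNReal.ofReal_ne_top, h.lintegral_forestSum hν,
      hM, ← ENNReal.ofReal_natCast, ← ENNReal.ofReal_ofNat,
      ← ENNReal.ofReal_mul (by norm_num), ← ENNReal.ofReal_mul (by positivity),
      ← ENNReal.ofReal_mul (by positivity), ← ENNReal.ofReal_mul (by positivity)]
    refine ENNReal.ofReal_le_ofReal ?_
    have h1 := numScales_le χ (j + 1)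
    have h2 : (2 : ℝ) ^ (-(j * (χ - tau ν p + ε))) * (2 * 2 ^ (((j + 1 : ℕ) : ℝ) * χ) *
        (2 ^ (-(j * tau ν p)) * M)) = 2 * 2 ^ χ * M * (2 ^ (-ε)) ^ j := by
      rw [← Real.rpow_natCast (2 ^ (-ε)) j, ← Real.rpow_mul (by norm_num : (0 : ℝ) ≤ 2) (-ε)]
      have : (2 : ℝ) ^ (-(j * (χ - tau ν p + ε))) * 2 ^ (((j + 1 : ℕ) : ℝ) * χ) *
          2 ^ (-(j * tau ν p)) = 2 ^ χ * 2 ^ (-ε * j) := by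
        rw [← Real.rpow_add (by norm_num), ← Real.rpow_add (by norm_num),
          ← Real.rpow_add (by norm_num)]
        congr 1
        push_cast; ring
      linear_combination 2 * M * this
    rw [← h2]
    gcongr
  have hsum : ∑' j : ℕ, ∫⁻ ω, ENNReal.ofReal (2 ^ (-(j * (χ - tau ν p + ε)))) *
      forestSum t p j (numScales χ (j + 1)) ω ∂P ≠ ⊤ := by
    refine ne_top_of_le_ne_top ?_ (ENNReal.tsum_le_tsum hbound)
    refine Summable.tsum_ofReal_ne_top (Summable.mul_left _
      (summable_geometric_of_lt_one (by positivity) ?_))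
    exact Real.rpow_lt_one_of_one_lt_of_neg (by norm_num) (by linarith)
  filter_upwards [ae_tendsto_zero_of_lintegral_le hmeas hsum] with ω hω
  filter_upwards [hω.eventually_le_const (u := 1) (by simp)] with j hj
  have h1 : ENNReal.ofReal (2 ^ (j * (χ - tau ν p + ε))) *
      ENNReal.ofReal (2 ^ (-(j * (χ - tau ν p + ε)))) = 1 := by
    rw [← ENNReal.ofReal_mul (by positivity), ← Real.rpow_add (by norm_num)]
    simp
  calc forestSum t p j (numScales χ (j + 1)) ω
      = ENNReal.ofReal (2 ^ (j * (χ - tau ν p + ε))) *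
        (ENNReal.ofReal (2 ^ (-(j * (χ - tau ν p + ε)))) *
        forestSum t p j (numScales χ (j + 1)) ω) := by rw [← mul_assoc, h1, one_mul]
    _ ≤ ENNReal.ofReal (2 ^ (j * (χ - tau ν p + ε))) * 1 := by gcongr
    _ = _ := mul_one _

end Forest

/-! ### Laplace transforms and the almost sure lower bound. -/

lemma lintegral_rpow_le_rpow_lintegral {α : Type*} [MeasurableSpace α] {μ : Measure α}
    [IsProbabilityMeasure μ] {f : α → ℝ≥0∞} (hf : Measurable f) {s : ℝ} (hs : 0 < s)
    (hs1 : s ≤ 1) : ∫⁻ x, f x ^ s ∂μ ≤ (∫⁻ x, f x ∂μ) ^ s := by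
  have h := eLpNorm'_le_eLpNorm'_of_exponent_le hs hs1 μ hf.aestronglyMeasurable
  simp only [eLpNorm', enorm_eq_self, ENNReal.rpow_one, div_one] at h
  calc ∫⁻ x, f x ^ s ∂μ = ((∫⁻ x, f x ^ s ∂μ) ^ (1 / s)) ^ s := by
        rw [← ENNReal.rpow_mul, one_div_mul_cancel hs.ne', ENNReal.rpow_one]
    _ ≤ _ := by gcongr

/-- For y ≤ 1 the second-order Taylor bound applies and y² ≤ y^q; for y ≥ 1 one has y ≤ y^q. A
remainder of order q allows a Laplace estimate without second moments. -/
lemma exp_neg_le {y q : ℝ} (hy : 0 ≤ y) (hq : 1 ≤ q) (hq2 : q ≤ 2) :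
    Real.exp (-y) ≤ 1 - y + y ^ q := by
  rcases le_total y 1 with h | h
  · have h1 := (abs_le.1 (Real.abs_exp_sub_one_sub_id_le (x := -y) (by rwa [abs_neg, abs_of_nonneg hy]))).2
    have h2 : y ^ (2 : ℝ) ≤ y ^ q := by
      rcases hy.eq_or_lt with rfl | hy
      · rw [Real.zero_rpow (by norm_num), Real.zero_rpow (by linarith)]
      · exact Real.rpow_le_rpow_of_exponent_ge hy h hq2
    rw [Real.rpow_two] at h2
    nlinarith
  · have h1 : y ^ (1 : ℝ) ≤ y ^ q := Real.rpow_le_rpow_of_exponent_le h hq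
    have h2 : Real.exp (-y) ≤ 1 := Real.exp_le_one_iff.2 (by linarith)
    rw [Real.rpow_one] at h1
    linarith

lemma exp_neg_le_inv {y : ℝ} (hy : 0 < y) : Real.exp (-y) ≤ y⁻¹ := by
  rw [Real.exp_neg]
  exact inv_anti₀ hy (by linarith [Real.add_one_le_exp y])

section Generator

variable {ν : Measure ℝ} [IsProbabilityMeasure ν]

/-- Growth of the moments of order `q` slightly larger than one of the partition functions of a
single tree. -/
lemma GeneratorLaw.exists_moment_bound (hν : GeneratorLaw ν) {p q κ : ℝ} (hq : 1 < q)
    (hq2 : q ≤ 3 / 2) (hκ : 0 ≤ κ) (h : q * tau ν p - tau ν (p * q) < (q - 1) * κ)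
    (hp : ∫⁻ w, limitMass w ^ p ∂(treeLaw ν) ≠ ⊤)
    (hpq : ∫⁻ w, limitMass w ^ (p * q) ∂(treeLaw ν) ≠ ⊤) :
    ∃ A : ℝ, 0 ≤ A ∧ ∀ j : ℕ,
      ∫⁻ w, weightedSum p (fun w => limitMass w ^ p) j w ^ q ∂(treeLaw ν) ≤
        ENNReal.ofReal (A * 2 ^ (j * ((q - 1) * κ - q * tau ν p))) := by
  set X := weightedSum p (fun w => limitMass w ^ p)
  have hX : ∀ j, Measurable (X j) := measurable_partition p
  set B := ∫⁻ w, limitMass w ^ p ∂(treeLaw ν)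
  -- Normalisation by the claimed growth: the task becomes to bound the q-th moments multiplied by
  -- 2^{jg}.
  set g : ℝ := q * tau ν p - (q - 1) * κ
  set G : ℝ≥0∞ := ENNReal.ofReal (2 ^ g)
  have hG : ∀ j : ℕ, G ^ j = ENNReal.ofReal (2 ^ (j * g)) := fun j => by
    rw [← ENNReal.ofReal_pow (by positivity), ← Real.rpow_natCast, ← Real.rpow_mul (by norm_num),
      mul_comm g]
  set C := ENNReal.ofReal (q * 2 ^ q)
  set H := ENNReal.ofReal (2 ^ (-tau ν (p * q)))
  -- Since q ≤ 3/2, both q - 1/2 and 1/2 are at most 1, so Jensen's inequality bounds the cross term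
  -- by the q-th power of the mean; κ ≥ 0 absorbs the rest.
  have hm : ∀ j : ℕ, (∫⁻ w, X j w ^ (q - 1 / 2) ∂(treeLaw ν)) *
      (∫⁻ w, X j w ^ (1 / 2 : ℝ) ∂(treeLaw ν)) * G ^ j ≤ B ^ q := by
    intro j
    have h0 : (ENNReal.ofReal (2 ^ (-(j * tau ν p)))) ^ q * G ^ j ≤ 1 := by
      rw [hG, ENNReal.ofReal_rpow_of_pos (by positivity), ← ENNReal.ofReal_mul (by positivity),
        ← Real.rpow_mul (by norm_num), ← Real.rpow_add (by norm_num), ENNReal.ofReal_le_one]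
      refine Real.rpow_le_one_of_one_le_of_nonpos (by norm_num) ?_
      have : 0 ≤ (j : ℝ) * ((q - 1) * κ) :=
        mul_nonneg (Nat.cast_nonneg j) (mul_nonneg (by linarith) hκ)
      simp only [g]; linarith
    calc _ ≤ (∫⁻ w, X j w ∂(treeLaw ν)) ^ (q - 1 / 2) *
          (∫⁻ w, X j w ∂(treeLaw ν)) ^ (1 / 2 : ℝ) * G ^ j := by
          gcongr
          · exact lintegral_rpow_le_rpow_lintegral (hX j) (by linarith) (by linarith)
          · exact lintegral_rpow_le_rpow_lintegral (hX j) (by norm_num) (by norm_num)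
      _ = (∫⁻ w, X j w ∂(treeLaw ν)) ^ q * G ^ j := by
          rw [← ENNReal.rpow_add_of_nonneg _ _ (by linarith) (by norm_num)]
          norm_num
      _ = B ^ q * ((ENNReal.ofReal (2 ^ (-(j * tau ν p)))) ^ q * G ^ j) := by
          rw [lintegral_partition hν, ENNReal.mul_rpow_of_nonneg _ _ (by linarith)]
          ring
      _ ≤ B ^ q * 1 := by gcongr
      _ = B ^ q := mul_one _
  -- The contraction factor is 2^{qτ(p) - τ(pq) - (q-1)κ}, which is less than one precisely by the
  -- assumption on κ.
  obtain ⟨D, hD, hDb⟩ := exists_bound_of_contraction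
    (a := fun j => (∫⁻ w, X j w ^ q ∂(treeLaw ν)) * G ^ j) (α := H * G) (B := H * G * (C * B ^ q))
    (by
      rw [← ENNReal.ofReal_mul (by positivity), ← Real.rpow_add (by norm_num),
        ENNReal.ofReal_lt_one]
      refine Real.rpow_lt_one_of_one_lt_of_neg (by norm_num) ?_
      simp only [g]; linarith)
    (ENNReal.mul_ne_top (ENNReal.mul_ne_top ENNReal.ofReal_ne_top ENNReal.ofReal_ne_top)
      (ENNReal.mul_ne_top ENNReal.ofReal_ne_top (ENNReal.rpow_ne_top_of_nonneg (by linarith) hp)))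
    (by simpa [X, weightedSum, ← ENNReal.rpow_mul] using hpq)
    (by
      intro n
      have := lintegral_weightedSum_rpow_succ_le ν p hq.le (measurable_limitMass.pow_const p) n
      rw [hν.two_mul_halfMoment] at this
      calc (∫⁻ w, X (n + 1) w ^ q ∂(treeLaw ν)) * G ^ (n + 1)
          ≤ (H * ((∫⁻ w, X n w ^ q ∂(treeLaw ν)) + C *
            ((∫⁻ w, X n w ^ (q - 1 / 2) ∂(treeLaw ν)) *
              (∫⁻ w, X n w ^ (1 / 2 : ℝ) ∂(treeLaw ν))))) * G ^ (n + 1) := by gcongr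
        _ = H * G * ((∫⁻ w, X n w ^ q ∂(treeLaw ν)) * G ^ n) + H * G * (C *
            ((∫⁻ w, X n w ^ (q - 1 / 2) ∂(treeLaw ν)) *
              (∫⁻ w, X n w ^ (1 / 2 : ℝ) ∂(treeLaw ν)) * G ^ n)) := by ring
        _ ≤ _ := by gcongr; exact hm n)
  refine ⟨D.toReal, ENNReal.toReal_nonneg, fun j => ?_⟩
  have h1 : G ^ j * ENNReal.ofReal (2 ^ (j * ((q - 1) * κ - q * tau ν p))) = 1 := by
    rw [hG, ← ENNReal.ofReal_mul (by positivity), ← Real.rpow_add (by norm_num)]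
    rw [show (j : ℝ) * g + j * ((q - 1) * κ - q * tau ν p) = 0 by simp only [g]; ring]
    simp
  rw [ENNReal.ofReal_mul ENNReal.toReal_nonneg, ENNReal.ofReal_toReal hD]
  calc _ = (∫⁻ w, X j w ^ q ∂(treeLaw ν)) * G ^ j *
        ENNReal.ofReal (2 ^ (j * ((q - 1) * κ - q * tau ν p))) := by rw [mul_assoc, h1, mul_one]
    _ ≤ _ := by gcongr; exact hDb j

end Generator

/-- Laplace transform bound in terms of the mean and of a moment of order `q ∈ (1,2]`. -/
lemma mgf_neg_le {α : Type*} [MeasurableSpace α] {μ : Measure α} [IsProbabilityMeasure μ]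
    {X : α → ℝ≥0∞} (hX : Measurable X) {q : ℝ} (hq : 1 ≤ q) (hq2 : q ≤ 2) {a b l : ℝ} (hl : 0 ≤ l)
    (ha0 : 0 ≤ a) (ha : ∫⁻ x, X x ^ q ∂μ ≤ ENNReal.ofReal a) (hb0 : 0 ≤ b)
    (hb : ∫⁻ x, X x ∂μ = ENNReal.ofReal b) :
    mgf (fun x => (X x).toReal) μ (-l) ≤ Real.exp (-(l * b) + l ^ q * a) := by
  have h1 : Integrable (fun x => (X x).toReal) μ :=
    integrable_toReal_of_lintegral_ne_top hX.aemeasurable (by rw [hb]; exact ENNReal.ofReal_ne_top)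
  have hq' : ∫⁻ x, X x ^ q ∂μ ≠ ⊤ := ne_top_of_le_ne_top ENNReal.ofReal_ne_top ha
  have h2 : Integrable (fun x => (X x).toReal ^ q) μ := by
    simp only [ENNReal.toReal_rpow]
    exact integrable_toReal_of_lintegral_ne_top (hX.pow_const q).aemeasurable hq'
  have e1 : ∫ x, (X x).toReal ∂μ = b := by
    rw [integral_toReal hX.aemeasurable (ae_lt_top hX (by rw [hb]; exact ENNReal.ofReal_ne_top)), hb,
      ENNReal.toReal_ofReal hb0]
  have e2 : ∫ x, (X x).toReal ^ q ∂μ ≤ a := by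
    simp only [ENNReal.toReal_rpow]
    rw [integral_toReal (hX.pow_const q).aemeasurable (ae_lt_top (hX.pow_const q) hq')]
    exact ENNReal.toReal_le_of_le_ofReal ha0 ha
  have i0 : Integrable (fun x => 1 - l * (X x).toReal) μ := (integrable_const 1).sub (h1.const_mul l)
  have i1 : Integrable (fun x => 1 - l * (X x).toReal + l ^ q * (X x).toReal ^ q) μ :=
    i0.add (h2.const_mul (l ^ q))
  calc mgf (fun x => (X x).toReal) μ (-l)
      ≤ ∫ x, (1 - l * (X x).toReal + l ^ q * (X x).toReal ^ q) ∂μ := by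
        refine integral_mono_of_nonneg (ae_of_all _ fun x => (Real.exp_pos _).le) i1
          (ae_of_all _ fun x => ?_)
        have := exp_neg_le (y := l * (X x).toReal) (mul_nonneg hl ENNReal.toReal_nonneg) hq hq2
        rw [Real.mul_rpow hl ENNReal.toReal_nonneg] at this
        simpa [neg_mul] using this
    _ = 1 - l * b + l ^ q * ∫ x, (X x).toReal ^ q ∂μ := by
        rw [integral_add i0 (h2.const_mul (l ^ q)),
          integral_sub (integrable_const 1) (h1.const_mul l), integral_const_mul,
          integral_const_mul, e1]
        simp
    _ ≤ 1 - l * b + l ^ q * a := by gcongr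
    _ ≤ _ := by linarith [Real.add_one_le_exp (-(l * b) + l ^ q * a)]

section Forest

variable {Ω : Type*} [MeasurableSpace Ω] {P : Measure Ω} [IsProbabilityMeasure P]
  {ν : Measure ℝ} [IsProbabilityMeasure ν]

/-- Chernoff bound for the lower deviations of the forest sums. -/
lemma IsForest.lintegral_exp_le {t : ℕ × Fin 2 → Ω → Word → ℝ} (h : IsForest ν P t)
    {X : (Word → ℝ) → ℝ≥0∞} (hX : Measurable X) {q : ℝ} (hq : 1 ≤ q) (hq2 : q ≤ 2) {a b l : ℝ}
    (hl : 0 ≤ l) (ha0 : 0 ≤ a) (ha : ∫⁻ w, X w ^ q ∂(treeLaw ν) ≤ ENNReal.ofReal a) (hb0 : 0 ≤ b)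
    (hb : ∫⁻ w, X w ∂(treeLaw ν) = ENNReal.ofReal b) (s : Finset (ℕ × Fin 2)) :
    ∫⁻ ω, ENNReal.ofReal (Real.exp (l * (s.card * b / 2 - ∑ k ∈ s, (X (t k ω)).toReal))) ∂P ≤
      ENNReal.ofReal (Real.exp (s.card * (-(l * b / 2) + l ^ q * a))) := by
  set Y : ℕ × Fin 2 → Ω → ℝ := fun k ω => (X (t k ω)).toReal
  have hYm : ∀ k, AEMeasurable (Y k) P := fun k =>
    (hX.ennreal_toReal).comp_aemeasurable (h.law k).aemeasurable
  have hYi : iIndepFun Y P := h.indep.comp (fun _ w => (X w).toReal) fun _ => hX.ennreal_toReal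
  have hmgf : ∀ k, mgf (Y k) P (-l) ≤ Real.exp (-(l * b) + l ^ q * a) := fun k => by
    have : mgf (Y k) P (-l) = mgf (fun w => (X w).toReal) (treeLaw ν) (-l) := by
      have hm : Measurable fun w => Real.exp (-l * (X w).toReal) :=
        Real.measurable_exp.comp (hX.ennreal_toReal.const_mul _)
      rw [← (h.law k).map_eq, mgf_map (h.law k).aemeasurable hm.aestronglyMeasurable]
      rfl
    rw [this]
    exact mgf_neg_le hX hq hq2 hl ha0 ha hb0 hb
  have hS : AEMeasurable (fun ω => ∑ k ∈ s, Y k ω) P := Finset.aemeasurable_fun_sum _ fun k _ => hYm k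
  have hint : Integrable (fun ω => Real.exp (-l * ∑ k ∈ s, Y k ω)) P := by
    refine Integrable.of_bound (C := 1) (by fun_prop) (ae_of_all _ fun ω => ?_)
    rw [Real.norm_eq_abs, abs_of_pos (Real.exp_pos _), Real.exp_le_one_iff]
    have : 0 ≤ ∑ k ∈ s, Y k ω := Finset.sum_nonneg fun k _ => ENNReal.toReal_nonneg
    nlinarith
  -- The threshold is half the mean of the sum, so half of the linear gain l b per tree survives.
  have e : ∀ ω, Real.exp (l * (s.card * b / 2 - ∑ k ∈ s, Y k ω)) =
      Real.exp (l * (s.card * b / 2)) * Real.exp (-l * ∑ k ∈ s, Y k ω) := fun ω => by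
    rw [← Real.exp_add]; ring_nf
  have hprod : ∫ ω, Real.exp (-l * ∑ k ∈ s, Y k ω) ∂P = ∏ k ∈ s, mgf (Y k) P (-l) := by
    rw [← hYi.mgf_sum₀ hYm s]
    simp [mgf]
  refine (lintegral_congr fun ω => congrArg ENNReal.ofReal (e ω)).trans_le ?_
  rw [← ofReal_integral_eq_lintegral_ofReal (hint.const_mul _)
    (ae_of_all _ fun ω => by positivity), integral_const_mul, hprod]
  refine ENNReal.ofReal_le_ofReal ?_
  calc _ ≤ Real.exp (l * (s.card * b / 2)) * ∏ k ∈ s, Real.exp (-(l * b) + l ^ q * a) := by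
        gcongr with k hk
        · exact fun k _ => mgf_nonneg
        · exact hmgf k
    _ = _ := by
        rw [Finset.prod_const, ← Real.exp_nat_mul, ← Real.exp_add]
        ring_nf

/-- Almost sure lower bound for the partition functions. -/
lemma IsForest.ae_le_forestSum {t : ℕ × Fin 2 → Ω → Word → ℝ} (h : IsForest ν P t)
    (hν : GeneratorLaw ν) (hpos : ∀ᵐ w ∂(treeLaw ν), limitMass w ≠ 0) {χ p q δ : ℝ} (hχ : 0 ≤ χ)
    (hq : 1 < q) (hq2 : q ≤ 3 / 2) (hδ : 0 < δ) (hδχ : δ ≤ χ)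
    (hτ : q * tau ν p - tau ν (p * q) < (q - 1) * (χ - δ))
    (hp : ∫⁻ w, limitMass w ^ p ∂(treeLaw ν) ≠ ⊤)
    (hpq : ∫⁻ w, limitMass w ^ (p * q) ∂(treeLaw ν) ≠ ⊤) :
    ∃ c : ℝ, 0 < c ∧ ∀ᵐ ω ∂P, ∀ᶠ j : ℕ in atTop,
      ENNReal.ofReal (c * 2 ^ (j * (χ - tau ν p))) ≤ forestSum t p j (numScales χ (j + 1)) ω := by
  obtain ⟨A, hA0, hA⟩ := hν.exists_moment_bound hq hq2 (sub_nonneg.2 hδχ) hτ hp hpq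
  set X := weightedSum p (fun w => limitMass w ^ p)
  obtain ⟨B, hB0, hB⟩ : ∃ B : ℝ, 0 < B ∧ ∫⁻ w, limitMass w ^ p ∂(treeLaw ν) = ENNReal.ofReal B :=
    ⟨_, ENNReal.toReal_pos (hν.limitMass_moment_ne_zero hpos p) hp, (ENNReal.ofReal_toReal hp).symm⟩
  set s : ℕ → Finset (ℕ × Fin 2) := fun j => Finset.range (numScales χ (j + 1)) ×ˢ Finset.univ
  have hs : ∀ j : ℕ, (2 : ℝ) ^ (j * χ) ≤ (s j).card := fun j => by
    have h1 := le_two_mul_numScales hχ (j + 1)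
    have h2 : (2 : ℝ) ^ (j * χ) ≤ 2 ^ (((j + 1 : ℕ) : ℝ) * χ) := by
      gcongr
      · norm_num
      · simp
    simp only [s, Finset.card_product, Finset.card_range, Finset.card_univ, Fintype.card_fin]
    push_cast
    linarith
  -- With this choice l b is of order 2^{j(δ/2 - χ)}. Times the number of trees, at least 2^{jχ}, it
  -- diverges like 2^{jδ/2}, while the remainder l^q a is smaller by the factor 2^{-j(q-1)δ/2}.
  set l : ℕ → ℝ := fun j => 2 ^ (j * (tau ν p - χ + δ / 2))
  set b : ℕ → ℝ := fun j => B * 2 ^ (-(j * tau ν p))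
  set a : ℕ → ℝ := fun j => A * 2 ^ (j * ((q - 1) * (χ - δ) - q * tau ν p))
  have key : ∀ j : ℕ, -(l j * b j / 2) + l j ^ q * a j =
      2 ^ (j * (δ / 2 - χ)) * (-(B / 2) + A * (2 ^ (-((q - 1) * (δ / 2)))) ^ j) := by
    intro j
    have e1 : l j * b j = B * 2 ^ (j * (δ / 2 - χ)) := by
      simp only [l, b]
      rw [mul_left_comm, ← Real.rpow_add (by norm_num)]
      ring_nf
    have e2 : l j ^ q * a j = A * (2 ^ (j * (δ / 2 - χ)) * (2 ^ (-((q - 1) * (δ / 2)))) ^ j) := by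
      simp only [l, a]
      rw [mul_left_comm, ← Real.rpow_natCast (2 ^ (-((q - 1) * (δ / 2)))), ← Real.rpow_mul (by norm_num),
        ← Real.rpow_mul (by norm_num), ← Real.rpow_add (by norm_num), ← Real.rpow_add (by norm_num)]
      ring_nf
    rw [e1, e2]; ring
  have hbound : ∀ j : ℕ, ∫⁻ ω, ENNReal.ofReal (Real.exp (l j * ((s j).card * b j / 2 -
      ∑ k ∈ s j, (X j (t k ω)).toReal))) ∂P ≤
      ENNReal.ofReal (Real.exp ((s j).card * (-(l j * b j / 2) + l j ^ q * a j))) := by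
    intro j
    refine h.lintegral_exp_le (measurable_partition p j) hq.le (by linarith) (by positivity)
      (by positivity) (hA j) (by positivity) ?_ (s j)
    rw [lintegral_partition hν, hB, ← ENNReal.ofReal_mul (by positivity)]
    simp only [b]; ring_nf
  have hsum : Summable fun j : ℕ => Real.exp ((s j).card * (-(l j * b j / 2) + l j ^ q * a j)) := by
    have hr : Tendsto (fun j : ℕ => A * ((2 : ℝ) ^ (-((q - 1) * (δ / 2)))) ^ j) atTop (𝓝 (A * 0)) :=
      (tendsto_pow_atTop_nhds_zero_of_lt_one (by positivity)
        (Real.rpow_lt_one_of_one_lt_of_neg (by norm_num) (by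
          have : 0 < (q - 1) * (δ / 2) := mul_pos (by linarith) (by linarith)
          linarith))).const_mul A
    have hr' := hr.eventually_lt_const (u := B / 4) (by simpa using by positivity)
    -- The bounds decay like exp(-c 2^{jδ/2}); the crude estimate exp(-y) ≤ 1/y already gives a
    -- geometric series.
    refine Summable.of_norm_bounded_eventually_nat (g := fun j : ℕ => (B / 4)⁻¹ * (2 ^ (-(δ / 2))) ^ j)
      (Summable.mul_left _ (summable_geometric_of_lt_one (by positivity)
        (Real.rpow_lt_one_of_one_lt_of_neg (by norm_num) (by linarith)))) ?_
    filter_upwards [hr'] with j hj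
    rw [Real.norm_eq_abs, abs_of_pos (Real.exp_pos _), key]
    have e3 : (B / 4)⁻¹ * ((2 : ℝ) ^ (-(δ / 2))) ^ j =
        (2 ^ (j * χ) * (2 ^ (j * (δ / 2 - χ)) * (B / 4)))⁻¹ := by
      rw [← mul_assoc, ← Real.rpow_add (by norm_num), mul_inv, ← Real.rpow_neg (by norm_num),
        mul_comm, ← Real.rpow_natCast, ← Real.rpow_mul (by norm_num)]
      ring_nf
    rw [e3]
    refine le_trans (Real.exp_le_exp.2 ?_) (exp_neg_le_inv (by positivity))
    have h1 : (2 : ℝ) ^ (j * χ) * (2 ^ (j * (δ / 2 - χ)) * (B / 4)) ≤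
        (s j).card * (2 ^ (j * (δ / 2 - χ)) * (B / 4)) := by gcongr; exact hs j
    have h2 : (0 : ℝ) ≤ (s j).card * 2 ^ (j * (δ / 2 - χ)) := by positivity
    nlinarith
  have hmeas : ∀ j : ℕ, AEMeasurable (fun ω => ENNReal.ofReal (Real.exp (l j * ((s j).card * b j / 2 -
      ∑ k ∈ s j, (X j (t k ω)).toReal)))) P := by
    intro j
    have : AEMeasurable (fun ω => ∑ k ∈ s j, (X j (t k ω)).toReal) P :=
      Finset.aemeasurable_fun_sum _ fun k _ =>
        (measurable_partition p j).ennreal_toReal.comp_aemeasurable (h.law k).aemeasurable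
    fun_prop
  refine ⟨B / 2, by positivity, ?_⟩
  filter_upwards [ae_tendsto_zero_of_lintegral_le hmeas
    (ne_top_of_le_ne_top hsum.tsum_ofReal_ne_top (ENNReal.tsum_le_tsum hbound))] with ω hω
  filter_upwards [hω.eventually_lt_const (u := 1) (by simp)] with j hj
  -- An exponential moment below one forces a negative exponent, so the sum is at least half of its
  -- mean.
  rw [ENNReal.ofReal_lt_one, Real.exp_lt_one_iff] at hj
  have h1 : (s j).card * b j / 2 ≤ ∑ k ∈ s j, (X j (t k ω)).toReal := by
    have : 0 < l j := by positivity
    by_contra! h2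
    nlinarith
  calc ENNReal.ofReal (B / 2 * 2 ^ (j * (χ - tau ν p)))
      ≤ ENNReal.ofReal (∑ k ∈ s j, (X j (t k ω)).toReal) := by
        refine ENNReal.ofReal_le_ofReal (le_trans ?_ h1)
        have : (2 : ℝ) ^ (j * (χ - tau ν p)) = 2 ^ (j * χ) * 2 ^ (-(j * tau ν p)) := by
          rw [← Real.rpow_add (by norm_num)]; ring_nf
        rw [this]
        calc _ = 2 ^ (j * χ) * b j / 2 := by simp only [b]; ring
          _ ≤ _ := by gcongr; exact hs j
    _ = ∑ k ∈ s j, ENNReal.ofReal (X j (t k ω)).toReal :=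
        ENNReal.ofReal_sum_of_nonneg fun _ _ => ENNReal.toReal_nonneg
    _ ≤ ∑ k ∈ s j, X j (t k ω) := Finset.sum_le_sum fun _ _ => ENNReal.ofReal_toReal_le
    _ = _ := by rw [forestSum, Finset.sum_product]

end Forest

/-! ### The exponent τ and the critical points. -/

section Exponents

variable {ν : Measure ℝ}

lemma GeneratorLaw.integral_exp_mul_log (hν : GeneratorLaw ν) (p : ℝ) :
    mgf Real.log ν p = ∫ x, x ^ p ∂ν :=
  integral_congr_ae (hν.pos.mono fun x hx => by
    simp only; rw [Real.rpow_def_of_pos hx, mul_comm])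

lemma GeneratorLaw.mem_interior (hν : GeneratorLaw ν) (p : ℝ) :
    p ∈ interior (integrableExpSet Real.log ν) := by
  have : integrableExpSet Real.log ν = Set.univ := Set.eq_univ_of_forall fun q =>
    (hν.moments q).congr (hν.pos.mono fun x hx => by
      simp only; rw [Real.rpow_def_of_pos hx, mul_comm])
  simp [this]

/-- Up to affine terms, τ is minus the cumulant generating function of log W divided by log 2.
Analyticity and concavity both follow from this. -/
lemma GeneratorLaw.tau_eq (hν : GeneratorLaw ν) :
    tau ν = fun p => p - cgf Real.log ν p / Real.log 2 - 1 := by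
  funext p
  rw [tau, cgf, hν.integral_exp_mul_log, Real.logb]

lemma GeneratorLaw.analyticAt_tau (hν : GeneratorLaw ν) (p : ℝ) : AnalyticAt ℝ (tau ν) p := by
  rw [hν.tau_eq]
  exact (analyticAt_id.sub ((analyticAt_cgf (hν.mem_interior p)).div_const)).sub analyticAt_const

lemma GeneratorLaw.differentiable_tau (hν : GeneratorLaw ν) : Differentiable ℝ (tau ν) :=
  fun p => (hν.analyticAt_tau p).differentiableAt

lemma GeneratorLaw.differentiable_deriv_tau (hν : GeneratorLaw ν) :
    Differentiable ℝ (deriv (tau ν)) :=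
  fun p => (hν.analyticAt_tau p).deriv.differentiableAt

lemma GeneratorLaw.deriv_tau (hν : GeneratorLaw ν) :
    deriv (tau ν) = fun p => 1 - deriv (cgf Real.log ν) p / Real.log 2 := by
  funext p
  have h := (analyticAt_cgf (hν.mem_interior p)).differentiableAt.hasDerivAt
  rw [hν.tau_eq]
  exact (((hasDerivAt_id p).sub (h.div_const (Real.log 2))).sub_const 1).deriv

lemma GeneratorLaw.concaveOn_tau (hν : GeneratorLaw ν) : ConcaveOn ℝ Set.univ (tau ν) := by
  refine concaveOn_univ_of_deriv2_nonpos hν.differentiable_tau hν.differentiable_deriv_tau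
    fun p => ?_
  have h := (analyticAt_cgf (hν.mem_interior p)).deriv.differentiableAt.hasDerivAt
  have h2 : deriv (deriv (cgf Real.log ν)) p = iteratedDeriv 2 (cgf Real.log ν) p := by
    rw [iteratedDeriv_succ, iteratedDeriv_one]
  have h3 : 0 ≤ deriv (deriv (cgf Real.log ν)) p := by
    rw [h2, iteratedDeriv_two_cgf_eq_integral (hν.mem_interior p)]
    exact div_nonneg (integral_nonneg fun x => by positivity) mgf_nonneg
  have h4 : deriv (deriv (tau ν)) p = -(deriv (deriv (cgf Real.log ν)) p / Real.log 2) := by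
    rw [hν.deriv_tau]
    exact ((h.div_const (Real.log 2)).const_sub 1).deriv
  simp only [Function.iterate_succ, Function.iterate_zero, Function.comp_apply, id]
  rw [h4, neg_nonpos]
  exact div_nonneg h3 (Real.log_nonneg (by norm_num))

lemma GeneratorLaw.tau_one (hν : GeneratorLaw ν) : tau ν 1 = 0 := by
  simp [tau, hν.mean]

lemma GeneratorLaw.deriv_tau_one (hν : GeneratorLaw ν) :
    deriv (tau ν) 1 = 1 - ∫ x, x * Real.logb 2 x ∂ν := by
  have h1 : mgf Real.log ν 1 = 1 := by simp [hν.integral_exp_mul_log, hν.mean]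
  rw [hν.deriv_tau]
  simp only
  rw [deriv_cgf (hν.mem_interior 1), h1, div_one, ← integral_div]
  congr 1
  refine integral_congr_ae (hν.pos.mono fun x hx => ?_)
  simp only [one_mul]
  rw [Real.exp_log hx, Real.logb]
  ring

/-- The slope of the tangent line to `tau` at `q` bounds `tau` from above. -/
lemma GeneratorLaw.tau_le_tangent (hν : GeneratorLaw ν) (p q : ℝ) :
    tau ν p ≤ tau ν q + deriv (tau ν) q * (p - q) := by
  have hd := hν.differentiable_tau q
  rcases lt_trichotomy p q with h | rfl | h
  · have := hν.concaveOn_tau.deriv_le_slope (Set.mem_univ p) (Set.mem_univ q) h hd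
    rw [slope_def_field, le_div_iff₀ (by linarith)] at this
    linarith
  · simp
  · have := hν.concaveOn_tau.slope_le_deriv (Set.mem_univ q) (Set.mem_univ p) h hd
    rw [slope_def_field, div_le_iff₀ (by linarith)] at this
    linarith

lemma GeneratorLaw.antitone_deriv_tau (hν : GeneratorLaw ν) : Antitone (deriv (tau ν)) := by
  intro p q h
  rcases h.eq_or_lt with rfl | h
  · exact le_rfl
  have h1 := hν.tau_le_tangent p q
  have h2 := hν.tau_le_tangent q p
  nlinarith

/-- The opposite of the intercept of the tangent line to `tau` at `p`. -/
noncomputable def tangentDepth (ν : Measure ℝ) (p : ℝ) : ℝ := p * deriv (tau ν) p - tau ν p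

lemma GeneratorLaw.continuous_tangentDepth (hν : GeneratorLaw ν) : Continuous (tangentDepth ν) :=
  (continuous_id.mul hν.differentiable_deriv_tau.continuous).sub hν.differentiable_tau.continuous

/-- Concavity gives τ(p) ≤ τ'(1)(p - 1) and τ'(p) ≥ τ'(1), so the quantity is at least τ'(1). This
covers the gap [0, 1] left between the definitions of the two critical exponents. -/
lemma GeneratorLaw.tangentDepth_nonneg (hν : GeneratorLaw ν) (h1 : 0 < deriv (tau ν) 1) {p : ℝ}
    (hp0 : 0 ≤ p) (hp1 : p ≤ 1) : 0 ≤ tangentDepth ν p := by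
  have h2 := hν.tau_le_tangent p 1
  rw [hν.tau_one] at h2
  have h3 := hν.antitone_deriv_tau hp1
  unfold tangentDepth
  nlinarith

lemma GeneratorLaw.tangentDepth_one (hν : GeneratorLaw ν) :
    tangentDepth ν 1 = deriv (tau ν) 1 := by simp [tangentDepth, hν.tau_one]

/-- `tau` is positive on `(1, r]` as soon as it is positive at `r`. -/
lemma GeneratorLaw.tau_pos_of_le (hν : GeneratorLaw ν) {r s : ℝ} (hr : 0 < tau ν r) (hs : 1 < s)
    (hsr : s ≤ r) : 0 < tau ν s := by
  have ha : 0 ≤ (r - s) / (r - 1) := div_nonneg (by linarith) (by linarith)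
  have hb : 0 ≤ (s - 1) / (r - 1) := div_nonneg (by linarith) (by linarith)
  have h := hν.concaveOn_tau.2 (Set.mem_univ 1) (Set.mem_univ r) ha hb (by
      have : r - 1 ≠ 0 := by linarith
      field_simp; ring)
  have h2 : (r - s) / (r - 1) * 1 + (s - 1) / (r - 1) * r = s := by
    have : r - 1 ≠ 0 := by linarith
    field_simp; ring
  simp only [smul_eq_mul, hν.tau_one, mul_zero, zero_add] at h
  rw [h2] at h
  exact lt_of_lt_of_le (mul_pos (div_pos (by linarith) (by linarith)) hr) h

lemma GeneratorLaw.isClosed_tangentDepth_le (hν : GeneratorLaw ν) (χ : ℝ) :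
    IsClosed {p : ℝ | tangentDepth ν p ≤ -χ} :=
  isClosed_le hν.continuous_tangentDepth continuous_const

/-- Description of `pPlus` when it is finite. -/
lemma GeneratorLaw.exists_pPlus (hν : GeneratorLaw ν) (h1 : 0 < deriv (tau ν) 1) {χ : ℝ}
    (hχ : 0 < χ) (h : pPlus ν χ ≠ ⊤) :
    ∃ s : ℝ, pPlus ν χ = s ∧ 1 < s ∧ tangentDepth ν s = -χ := by
  set S := {p : ℝ | 1 ≤ p ∧ p * deriv (tau ν) p - tau ν p ≤ -χ}
  have hne : S.Nonempty := by
    rw [Set.nonempty_iff_ne_empty]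
    intro h0
    refine h ?_
    rw [show pPlus ν χ = sInf ((fun p : ℝ => (p : EReal)) '' S) from rfl, h0, Set.image_empty,
      sInf_empty]
  have hcl : IsClosed S := isClosed_Ici.inter (hν.isClosed_tangentDepth_le χ)
  have hl : IsLeast S (sInf S) := hcl.isLeast_csInf hne ⟨1, fun x hx => hx.1⟩
  set s := sInf S
  -- At 1 the depth is τ'(1) > 0 > -χ, so 1 is not in the set.
  have hs1 : 1 < s := by
    refine lt_of_le_of_ne hl.1.1 fun h0 => ?_
    have := hl.1.2
    change tangentDepth ν s ≤ -χ at this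
    rw [← h0, hν.tangentDepth_one] at this
    linarith
  refine ⟨s, (show IsLeast ((fun p : ℝ => (p : EReal)) '' S) s from
    ⟨⟨s, hl.1, rfl⟩, ?_⟩).isGLB.sInf_eq, hs1,
    le_antisymm hl.1.2 ?_⟩
  · rintro _ ⟨x, hx, rfl⟩
    exact EReal.coe_le_coe_iff.2 (hl.2 hx)
  · have hcont : Tendsto (tangentDepth ν) (𝓝[<] s) (𝓝 (tangentDepth ν s)) :=
      (hν.continuous_tangentDepth.tendsto s).mono_left nhdsWithin_le_nhds
    refine ge_of_tendsto hcont ?_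
    filter_upwards [Ioo_mem_nhdsLT hs1] with x hx
    by_contra! h0
    exact absurd (hl.2 ⟨hx.1.le, h0.le⟩) (not_le.2 hx.2)

/-- Description of `pMinus` when it is finite. -/
lemma GeneratorLaw.exists_pMinus (hν : GeneratorLaw ν) (h1 : 0 < deriv (tau ν) 1) {χ : ℝ}
    (hχ : 0 < χ) (h : pMinus ν χ ≠ ⊥) :
    ∃ s : ℝ, pMinus ν χ = s ∧ s < 0 ∧ tangentDepth ν s = -χ := by
  set S := {p : ℝ | p ≤ 0 ∧ p * deriv (tau ν) p - tau ν p ≤ -χ}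
  have hne : S.Nonempty := by
    rw [Set.nonempty_iff_ne_empty]
    intro h0
    refine h ?_
    rw [show pMinus ν χ = sSup ((fun p : ℝ => (p : EReal)) '' S) from rfl, h0, Set.image_empty,
      sSup_empty]
  have hcl : IsClosed S := isClosed_Iic.inter (hν.isClosed_tangentDepth_le χ)
  have hl : IsGreatest S (sSup S) := hcl.isGreatest_csSup hne ⟨0, fun x hx => hx.1⟩
  set s := sSup S
  have hs1 : s < 0 := by
    refine lt_of_le_of_ne hl.1.1 fun h0 => ?_
    have := hl.1.2
    change tangentDepth ν s ≤ -χ at this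
    rw [h0] at this
    linarith [hν.tangentDepth_nonneg h1 le_rfl zero_le_one]
  refine ⟨s, (show IsGreatest ((fun p : ℝ => (p : EReal)) '' S) s from
    ⟨⟨s, hl.1, rfl⟩, ?_⟩).isLUB.sSup_eq, hs1,
    le_antisymm hl.1.2 ?_⟩
  · rintro _ ⟨x, hx, rfl⟩
    exact EReal.coe_le_coe_iff.2 (hl.2 hx)
  · have hcont : Tendsto (tangentDepth ν) (𝓝[>] s) (𝓝 (tangentDepth ν s)) :=
      (hν.continuous_tangentDepth.tendsto s).mono_left nhdsWithin_le_nhds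
    refine ge_of_tendsto hcont ?_
    filter_upwards [Ioo_mem_nhdsGT hs1] with x hx
    by_contra! h0
    exact absurd (hl.2 ⟨hx.2.le, h0.le⟩) (not_le.2 hx.1)

/-- The definition of `pMinus` covers p ≤ 0, that of `pPlus` covers p ≥ 1, and between them the
depth is nonnegative. -/
lemma GeneratorLaw.lt_tangentDepth (hν : GeneratorLaw ν) (h1 : 0 < deriv (tau ν) 1) {χ p : ℝ}
    (hχ : 0 < χ) (hp : p < pPlus ν χ) (hm : pMinus ν χ < p) : -χ < tangentDepth ν p := by
  by_contra! h
  rcases le_or_gt p 0 with h0 | h0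
  · exact absurd (le_sSup (Set.mem_image_of_mem _ ⟨h0, h⟩) : (p : EReal) ≤ pMinus ν χ) (not_le.2 hm)
  rcases le_or_gt 1 p with h2 | h2
  · exact absurd (sInf_le (Set.mem_image_of_mem _ ⟨h2, h⟩) : pPlus ν χ ≤ (p : EReal)) (not_le.2 hp)
  · linarith [hν.tangentDepth_nonneg h1 h0.le h2.le]

/-- Under the hypothesis on `tau`, it is positive on `(1, r]` for some `r` larger than a given
`p < pPlus`. -/
lemma GeneratorLaw.exists_tau_pos (hν : GeneratorLaw ν) (h1 : 0 < deriv (tau ν) 1) {χ p : ℝ}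
    (hχ : 0 < χ) (h_tau : (pPlus ν χ = ⊤ ∧ ∀ q : ℝ, 1 < q → 0 < tau ν q) ∨
      (pPlus ν χ < ⊤ ∧ 0 < tau ν (pPlus ν χ).toReal)) (hp : p < pPlus ν χ) :
    ∃ r, 1 < r ∧ p < r ∧ ∀ s, 1 < s → s ≤ r → 0 < tau ν s := by
  rcases h_tau with ⟨-, h⟩ | ⟨h, h2⟩
  · exact ⟨max p 1 + 1, by linarith [le_max_right p 1], by linarith [le_max_left p 1],
      fun s hs _ => h s hs⟩
  · obtain ⟨s, hs, hs1, -⟩ := hν.exists_pPlus h1 hχ h.ne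
    rw [hs] at h2 hp
    exact ⟨s, hs1, EReal.coe_lt_coe_iff.1 hp, fun u hu hus => hν.tau_pos_of_le h2 hu hus⟩

/-- The exponents needed for the lower bound on the partition functions. -/
lemma GeneratorLaw.exists_exponents (hν : GeneratorLaw ν) {χ p r : ℝ} (hχ : 0 < χ)
    (h : -χ < tangentDepth ν p) (hpr : p < r) :
    ∃ q δ : ℝ, 1 < q ∧ q ≤ 3 / 2 ∧ 0 < δ ∧ δ ≤ χ ∧ p * q ≤ r ∧
      q * tau ν p - tau ν (p * q) < (q - 1) * (χ - δ) := by
  obtain ⟨δ, hδ0, hδχ, hδ⟩ : ∃ δ, 0 < δ ∧ δ ≤ χ ∧ -tangentDepth ν p < χ - δ :=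
    ⟨min χ ((tangentDepth ν p + χ) / 2), lt_min hχ (by linarith), min_le_left _ _, by
      linarith [min_le_right χ ((tangentDepth ν p + χ) / 2)]⟩
  -- The function q τ(p) - τ(pq) vanishes at q = 1 with derivative τ(p) - pτ'(p) < χ - δ, so for q
  -- close enough to 1 on the right it lies below (q - 1)(χ - δ).
  have hd : HasDerivAt (fun q => q * tau ν p - tau ν (p * q)) (-tangentDepth ν p) 1 := by
    have h0 : HasDerivAt (tau ν) (deriv (tau ν) p) (p * 1) := by
      rw [mul_one]; exact (hν.differentiable_tau p).hasDerivAt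
    have h2 := h0.comp 1 ((hasDerivAt_id (1 : ℝ)).const_mul p)
    refine (((hasDerivAt_id (1 : ℝ)).mul_const (tau ν p)).sub h2).congr_deriv ?_
    simp only [tangentDepth]; ring
  have hs := (hasDerivAt_iff_tendsto_slope.1 hd).mono_left
    (nhdsWithin_mono 1 fun x (hx : x ∈ Set.Ioi (1 : ℝ)) => ne_of_gt hx)
  have hr : ∀ᶠ q in 𝓝[>] (1 : ℝ), p * q < r := by
    have : Tendsto (fun q : ℝ => p * q) (𝓝[>] 1) (𝓝 (p * 1)) :=
      ((continuous_const_mul p).tendsto 1).mono_left nhdsWithin_le_nhds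
    exact this.eventually_lt_const (by rwa [mul_one])
  obtain ⟨q, h3, h4, h5⟩ := ((hs.eventually_lt_const hδ).and (hr.and
    (Ioo_mem_nhdsGT (show (1 : ℝ) < 3 / 2 by norm_num)))).exists
  refine ⟨q, δ, h5.1, h5.2.le, hδ0, hδχ, h4.le, ?_⟩
  rw [slope_def_field, div_lt_iff₀ (by linarith [h5.1])] at h3
  simp only [mul_one, one_mul, sub_self, sub_zero] at h3
  linarith

end Exponents

/-! ### Power sums and linear extrapolation of growth exponents. -/

section PowerSums

variable {ι : Type*} {s : Finset ι} {a : ι → ℝ}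

lemma sum_rpow_pos (hs : s.Nonempty) (ha : ∀ k ∈ s, 0 < a k) (p : ℝ) : 0 < ∑ k ∈ s, a k ^ p :=
  Finset.sum_pos (fun k hk => Real.rpow_pos_of_pos (ha k hk) p) hs

/-- Power sums are log-convex functions of the exponent. -/
lemma convexOn_logb_sum_rpow (hs : s.Nonempty) (ha : ∀ k ∈ s, 0 < a k) :
    ConvexOn ℝ Set.univ fun p : ℝ => Real.logb 2 (∑ k ∈ s, a k ^ p) := by
  refine ⟨convex_univ, fun p _ q _ b c hb hc hbc => ?_⟩
  have hp := sum_rpow_pos hs ha p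
  have hq := sum_rpow_pos hs ha q
  set A := ∑ k ∈ s, a k ^ p
  set B := ∑ k ∈ s, a k ^ q
  have h1 : ∑ k ∈ s, a k ^ (b • p + c • q) ≤ A ^ b * B ^ c := by
    -- Hölder's inequality: after normalising both sums to one, it is the weighted
    -- arithmetic-geometric mean inequality term by term.
    have h2 : ∑ k ∈ s, (a k ^ p / A) ^ b * (a k ^ q / B) ^ c ≤ 1 := by
      calc _ ≤ ∑ k ∈ s, (b * (a k ^ p / A) + c * (a k ^ q / B)) :=
            Finset.sum_le_sum fun k hk => Real.geom_mean_le_arith_mean2_weighted hb hc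
              (div_nonneg (Real.rpow_nonneg (ha k hk).le _) hp.le)
              (div_nonneg (Real.rpow_nonneg (ha k hk).le _) hq.le) hbc
        _ = b * (A / A) + c * (B / B) := by
            rw [Finset.sum_add_distrib, ← Finset.mul_sum, ← Finset.mul_sum, ← Finset.sum_div,
              ← Finset.sum_div]
        _ = 1 := by rw [div_self hp.ne', div_self hq.ne']; linarith
    have h3 : ∑ k ∈ s, a k ^ (b • p + c • q) =
        A ^ b * B ^ c * ∑ k ∈ s, (a k ^ p / A) ^ b * (a k ^ q / B) ^ c := by
      rw [Finset.mul_sum]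
      refine Finset.sum_congr rfl fun k hk => ?_
      have hk := ha k hk
      rw [Real.div_rpow (Real.rpow_nonneg hk.le _) hp.le,
        Real.div_rpow (Real.rpow_nonneg hk.le _) hq.le, ← Real.rpow_mul hk.le,
        ← Real.rpow_mul hk.le, smul_eq_mul, smul_eq_mul, Real.rpow_add hk, mul_comm b, mul_comm c]
      have := (Real.rpow_pos_of_pos hp b).ne'
      have := (Real.rpow_pos_of_pos hq c).ne'
      field_simp
    rw [h3]
    exact mul_le_of_le_one_right (by positivity) h2
  calc Real.logb 2 (∑ k ∈ s, a k ^ (b • p + c • q)) ≤ Real.logb 2 (A ^ b * B ^ c) :=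
        Real.logb_le_logb_of_le (by norm_num) (sum_rpow_pos hs ha _) h1
    _ = b • Real.logb 2 A + c • Real.logb 2 B := by
        rw [Real.logb_mul (by positivity) (by positivity), Real.logb_rpow_eq_mul_logb_of_pos hp,
          Real.logb_rpow_eq_mul_logb_of_pos hq, smul_eq_mul, smul_eq_mul]

/-- This is the inequality between the ℓ^c and ℓ^1 norms of the numbers a_k^p: after division by
their sum, raising to a power c ≥ 1 only decreases each term. -/
lemma logb_sum_rpow_mul_le (hs : s.Nonempty) (ha : ∀ k ∈ s, 0 < a k) {c : ℝ} (hc : 1 ≤ c) (p : ℝ) :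
    Real.logb 2 (∑ k ∈ s, a k ^ (c * p)) ≤ c * Real.logb 2 (∑ k ∈ s, a k ^ p) := by
  have hp := sum_rpow_pos hs ha p
  set A := ∑ k ∈ s, a k ^ p
  have h1 : ∑ k ∈ s, a k ^ (c * p) ≤ A ^ c := by
    have h2 : ∑ k ∈ s, (a k ^ p / A) ^ c ≤ 1 := by
      calc _ ≤ ∑ k ∈ s, (a k ^ p / A) := Finset.sum_le_sum fun k hk => by
            have h0 : 0 ≤ a k ^ p / A := div_nonneg (Real.rpow_nonneg (ha k hk).le _) hp.le
            have h1 : a k ^ p / A ≤ 1 := (div_le_one hp).2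
              (Finset.single_le_sum (f := fun k => a k ^ p)
                (fun i hi => Real.rpow_nonneg (ha i hi).le _) hk)
            calc (a k ^ p / A) ^ c ≤ (a k ^ p / A) ^ (1 : ℝ) :=
                  Real.rpow_le_rpow_of_exponent_ge (div_pos (Real.rpow_pos_of_pos (ha k hk) _) hp)
                    h1 hc
              _ = _ := Real.rpow_one _
        _ = 1 := by rw [← Finset.sum_div, div_self hp.ne']
    have h3 : ∑ k ∈ s, a k ^ (c * p) = A ^ c * ∑ k ∈ s, (a k ^ p / A) ^ c := by
      rw [Finset.mul_sum]
      refine Finset.sum_congr rfl fun k hk => ?_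
      have hk := ha k hk
      rw [Real.div_rpow (Real.rpow_nonneg hk.le _) hp.le, ← Real.rpow_mul hk.le, mul_comm c]
      have := (Real.rpow_pos_of_pos hp c).ne'
      field_simp
    rw [h3]
    exact mul_le_of_le_one_right (by positivity) h2
  calc _ ≤ Real.logb 2 (A ^ c) :=
        Real.logb_le_logb_of_le (by norm_num) (sum_rpow_pos hs ha _) h1
    _ = _ := Real.logb_rpow_eq_mul_logb_of_pos hp

end PowerSums

lemma tendsto_affine_div (a y : ℝ) :
    Tendsto (fun j : ℕ => (a + j * y) / ((j + 1 : ℕ) : ℝ)) atTop (𝓝 y) := by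
  have h : Tendsto (fun j : ℕ => y + (a - y) * (1 / ((j : ℝ) + 1))) atTop (𝓝 (y + (a - y) * 0)) :=
    (tendsto_one_div_add_atTop_nhds_zero_nat.const_mul _).const_add _
  rw [mul_zero, add_zero] at h
  refine h.congr fun j => ?_
  have : (j : ℝ) + 1 ≠ 0 := by positivity
  push_cast
  field_simp
  ring

/-- The growth exponent of a sequence, from two-sided exponential bounds. -/
lemma tendsto_logb_div {S : ℕ → ℝ} {K c x : ℝ} (hK : 0 < K) (hc : 0 < c)
    (hS : ∀ j, 0 < S j) (hl : ∀ᶠ j : ℕ in atTop, K * (c * 2 ^ (j * x)) ≤ S (j + 1))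
    (hu : ∀ n : ℕ, ∀ᶠ j : ℕ in atTop, S (j + 1) ≤ K * 2 ^ (j * (x + 1 / ((n : ℝ) + 1)))) :
    Tendsto (fun j : ℕ => Real.logb 2 (S j) / j) atTop (𝓝 x) := by
  rw [← tendsto_add_atTop_iff_nat 1]
  have hpow : ∀ y : ℝ, Real.logb 2 (2 ^ y) = y := fun y => Real.logb_rpow (by norm_num) (by norm_num)
  refine tendsto_order.2 ⟨fun b hb => ?_, fun b hb => ?_⟩
  · filter_upwards [hl, (tendsto_affine_div (Real.logb 2 (K * c)) x).eventually_const_lt hb]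
      with j h1 h2
    refine h2.trans_le ?_
    gcongr
    rw [← hpow (j * x), ← Real.logb_mul (by positivity) (by positivity), mul_assoc]
    exact Real.logb_le_logb_of_le (by norm_num) (by positivity) h1
  · obtain ⟨n, hn⟩ := exists_nat_one_div_lt (sub_pos.2 hb)
    filter_upwards [hu n, (tendsto_affine_div (Real.logb 2 K) (x + 1 / ((n : ℝ) + 1))).eventually_lt_const
      (show _ < b by linarith)] with j h1 h2
    refine lt_of_le_of_lt ?_ h2
    gcongr
    rw [← hpow (j * (x + 1 / ((n : ℝ) + 1))), ← Real.logb_mul (by positivity) (by positivity)]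
    exact Real.logb_le_logb_of_le (by norm_num) (hS _) h1

/-- Extrapolation of growth exponents of log-convex functions beyond a point where the line joining
the origin to the graph of the exponent is tangent to it. -/
lemma tendsto_of_convexOn {L : ℕ → ℝ → ℝ} {φ : ℝ → ℝ} {c : ℝ} (hc : 1 ≤ c)
    (hconv : ∀ j, ConvexOn ℝ Set.univ (L j)) (hmul : ∀ j a u, 1 ≤ a → L j (a * u) ≤ a * L j u)
    (hφ : HasDerivAt φ (φ 1) 1)
    {t : ℕ → ℝ} (ht0 : ∀ n, 0 < t n) (ht1 : ∀ n, t n < 1) (htt : Tendsto t atTop (𝓝 0))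
    (hlim : ∀ n, Tendsto (fun j : ℕ => L j (1 - t n) / j) atTop (𝓝 (φ (1 - t n))))
    (hlim2 : ∀ n, Tendsto (fun j : ℕ => L j (1 - 2 * t n) / j) atTop (𝓝 (φ (1 - 2 * t n)))) :
    Tendsto (fun j : ℕ => L j c / j) atTop (𝓝 (c * φ 1)) := by
  have hmulv : ∀ k : ℝ, Tendsto (fun n => 1 - k * t n) atTop (𝓝 1) := fun k => by
    simpa using (htt.const_mul k).const_sub 1
  have hw : ∀ k : ℝ, 0 < k → Tendsto (fun n => 1 - k * t n) atTop (𝓝[≠] 1) := fun k hk =>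
    tendsto_nhdsWithin_iff.2 ⟨hmulv k, Eventually.of_forall fun n => by
      have := mul_pos hk (ht0 n)
      simp only [Set.mem_compl_iff, Set.mem_singleton_iff]
      intro h; linarith⟩
  have hsl : ∀ k : ℝ, 0 < k → Tendsto (fun n => slope φ 1 (1 - k * t n)) atTop (𝓝 (φ 1)) :=
    fun k hk => (hasDerivAt_iff_tendsto_slope.1 hφ).comp (hw k hk)
  have hφt : Tendsto (fun n => φ (1 - t n)) atTop (𝓝 (φ 1)) := by
    have := hφ.continuousAt.tendsto.comp (hmulv 1)
    simpa [Function.comp_def] using this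
  -- The secant of φ through 1 - 2t and 1 - t, evaluated at c. Its slope tends to φ'(1) = φ(1), so
  -- its value tends to φ(1) + (c - 1)φ(1).
  have hA : Tendsto (fun n => ((c - 1 + 2 * t n) * φ (1 - t n) - (c - 1 + t n) * φ (1 - 2 * t n)) / t n)
      atTop (𝓝 (c * φ 1)) := by
    have h1 : Tendsto (fun n => (c - 1 + t n) *
        (2 * slope φ 1 (1 - 2 * t n) - slope φ 1 (1 - 1 * t n)) + φ (1 - t n)) atTop
        (𝓝 ((c - 1 + 0) * (2 * φ 1 - φ 1) + φ 1)) :=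
      ((htt.const_add _).mul (((hsl 2 two_pos).const_mul 2).sub (hsl 1 one_pos))).add hφt
    rw [show (c - 1 + 0) * (2 * φ 1 - φ 1) + φ 1 = c * φ 1 by ring] at h1
    refine h1.congr fun n => ?_
    have := (ht0 n).ne'
    rw [slope_def_field, slope_def_field, one_mul]
    rw [show 1 - 2 * t n - 1 = -(2 * t n) by ring, show 1 - t n - 1 = -t n by ring]
    field_simp
    ring
  -- The upper bound: the ray from the origin through the point of the graph over 1 - t, evaluated
  -- at c.
  have hB : Tendsto (fun n => c / (1 - t n) * φ (1 - t n)) atTop (𝓝 (c * φ 1)) := by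
    have h1 : Tendsto (fun n => c / (1 - t n)) atTop (𝓝 (c / (1 - 0))) :=
      tendsto_const_nhds.div (htt.const_sub 1) (by norm_num)
    simpa using h1.mul hφt
  refine tendsto_order.2 ⟨fun b hb => ?_, fun b hb => ?_⟩
  · obtain ⟨n, hn⟩ := (hA.eventually_const_lt hb).exists
    have h1 : Tendsto (fun j : ℕ => ((c - 1 + 2 * t n) * (L j (1 - t n) / j) -
        (c - 1 + t n) * (L j (1 - 2 * t n) / j)) / t n) atTop
        (𝓝 (((c - 1 + 2 * t n) * φ (1 - t n) - (c - 1 + t n) * φ (1 - 2 * t n)) / t n)) :=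
      (((hlim n).const_mul _).sub ((hlim2 n).const_mul _)).div_const _
    filter_upwards [h1.eventually_const_lt hn] with j hj
    refine hj.trans_le ?_
    have ht := ht0 n
    have hd : 0 < c - 1 + 2 * t n := by linarith
    have hd' := hd.ne'
    -- The point 1 - t is a convex combination of 1 - 2t and c; solved for the value at c, convexity
    -- becomes a lower bound by the secant.
    have h2 := (hconv j).2 (Set.mem_univ (1 - 2 * t n)) (Set.mem_univ c)
      (show 0 ≤ (c - 1 + t n) / (c - 1 + 2 * t n) from div_nonneg (by linarith) hd.le)
      (show 0 ≤ t n / (c - 1 + 2 * t n) from div_nonneg ht.le hd.le) (by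
        rw [← add_div, div_eq_one_iff_eq hd']; ring)
    have h3 : (c - 1 + t n) / (c - 1 + 2 * t n) * (1 - 2 * t n) + t n / (c - 1 + 2 * t n) * c =
        1 - t n := by
      rw [div_mul_eq_mul_div, div_mul_eq_mul_div, ← add_div, div_eq_iff hd']; ring
    simp only [smul_eq_mul] at h2
    rw [h3, div_mul_eq_mul_div, div_mul_eq_mul_div, ← add_div, le_div_iff₀ hd] at h2
    rw [div_le_iff₀ ht, ← mul_div_assoc, ← mul_div_assoc, ← sub_div, div_mul_eq_mul_div]
    gcongr
    linarith
  · obtain ⟨n, hn⟩ := (hB.eventually_lt_const hb).exists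
    filter_upwards [((hlim n).const_mul (c / (1 - t n))).eventually_lt_const hn] with j hj
    refine lt_of_le_of_lt ?_ hj
    have h1 : 0 < 1 - t n := by linarith [ht1 n]
    have h2 := hmul j (c / (1 - t n)) (1 - t n) (by
      rw [le_div_iff₀ h1]; linarith [ht0 n])
    rw [div_mul_cancel₀ c h1.ne'] at h2
    rw [← mul_div_assoc]
    gcongr

/-! ### Growth of the partition function. -/

section Partition

variable {w : ℕ → Word → ℝ} {T χ : ℝ}

lemma convexOn_logb_partitionFn (h : ∀ m i, RegularTree (shift i (w m))) (hT : 0 < T) (hχ : 0 ≤ χ)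
    (j : ℕ) : ConvexOn ℝ Set.univ fun p => Real.logb 2 (partitionFn T χ w j p) :=
  convexOn_logb_sum_rpow
    (Finset.nonempty_range_iff.2 (mul_pos (numScales_pos hχ j) (by positivity)).ne')
    fun _ _ => concatMeasure_real_pos h hT

lemma logb_partitionFn_mul_le (h : ∀ m i, RegularTree (shift i (w m))) (hT : 0 < T) (hχ : 0 ≤ χ)
    (j : ℕ) {c : ℝ} (hc : 1 ≤ c) (p : ℝ) :
    Real.logb 2 (partitionFn T χ w j (c * p)) ≤ c * Real.logb 2 (partitionFn T χ w j p) :=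
  logb_sum_rpow_mul_le
    (Finset.nonempty_range_iff.2 (mul_pos (numScales_pos hχ j) (by positivity)).ne')
    (fun _ _ => concatMeasure_real_pos h hT) hc p

end Partition

section Forest

variable {Ω : Type*} [MeasurableSpace Ω] {P : Measure Ω} [IsProbabilityMeasure P]
  {ν : Measure ℝ} [IsProbabilityMeasure ν] {W : ℕ → Word → Ω → ℝ} {T χ : ℝ}

/-- Growth exponent of the partition function away from the linearization range. -/
lemma IsForest.ae_tendsto_logb_partitionFn
    (h : IsForest ν P fun k ω => shift k.2 fun r => W k.1 r ω) (hν : GeneratorLaw ν)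
    (hpos : ∀ᵐ w ∂(treeLaw ν), limitMass w ≠ 0) (hT : 0 < T) (hχ : 0 < χ) {p r : ℝ}
    (hp : -χ < tangentDepth ν p) (hpr : p < r) (hr : ∀ s, 1 < s → s ≤ r → 0 < tau ν s) :
    ∀ᵐ ω ∂P, Tendsto (fun j : ℕ => Real.logb 2 (partitionFn T χ (fun m r => W m r ω) j p) / j)
      atTop (𝓝 (χ - tau ν p)) := by
  obtain ⟨q, δ, hq, hq2, hδ, hδχ, hpq, hτ⟩ := hν.exists_exponents hχ hp hpr
  have hfin : ∀ s ≤ r, ∫⁻ w, limitMass w ^ s ∂(treeLaw ν) ≠ ⊤ := fun s hs =>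
    hν.limitMass_moment_ne_top hpos fun u hu hus => hr u hu (hus.trans hs)
  obtain ⟨c, hc, hlow⟩ := h.ae_le_forestSum hν hpos hχ.le hq hq2 hδ hδχ hτ (hfin p hpr.le)
    (hfin _ hpq)
  have hup := ae_all_iff.2 fun n : ℕ => h.ae_forestSum_le hν (χ := χ) (hfin p hpr.le)
    (ε := 1 / ((n : ℝ) + 1)) (by positivity)
  filter_upwards [hlow, hup, h.ae_regularTree hν hpos] with ω hl hu hreg
  have hreg' : ∀ m i, RegularTree (shift i fun r => W m r ω) := fun m i => hreg (m, i)
  have hS := fun j => partitionFn_pos hreg' hT hχ.le j p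
  have e := fun j => ofReal_partitionFn hreg' hT χ p j
  rw [ENNReal.ofReal_rpow_of_pos (by positivity)] at e
  refine tendsto_logb_div (K := (T / 2) ^ p) (by positivity) hc hS ?_ fun n => ?_
  · filter_upwards [hl] with j hj
    rw [← ENNReal.ofReal_le_ofReal_iff (hS _).le, e, ENNReal.ofReal_mul (by positivity)]
    gcongr
    exact hj
  · filter_upwards [hu n] with j hj
    rw [← ENNReal.ofReal_le_ofReal_iff (by positivity), e, ENNReal.ofReal_mul (by positivity)]
    gcongr
    exact hj

/-- Growth exponent of the partition function in the linearization range. -/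
lemma ae_tendsto_logb_partitionFn_of_tangent {P : Measure Ω} {ν : Measure ℝ}
    (hreg : ∀ᵐ ω ∂P, ∀ m i, RegularTree (shift i fun r => W m r ω)) (hν : GeneratorLaw ν)
    (hT : 0 < T) (hχ : 0 < χ) {s : ℝ} (hs : tangentDepth ν s = -χ)
    (h : ∀ u : ℝ, 0 < u → u < 1 → ∀ᵐ ω ∂P,
      Tendsto (fun j : ℕ => Real.logb 2 (partitionFn T χ (fun m r => W m r ω) j (u * s)) / j)
        atTop (𝓝 (χ - tau ν (u * s)))) {c : ℝ} (hc : 1 ≤ c) :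
    ∀ᵐ ω ∂P, Tendsto
      (fun j : ℕ => Real.logb 2 (partitionFn T χ (fun m r => W m r ω) j (c * s)) / j)
        atTop (𝓝 (-(deriv (tau ν) s * (c * s)))) := by
  -- The shift by 3 keeps 1 - 2t inside (0, 1). A sequence suffices, so only countably many null
  -- sets are discarded.
  have ht : ∀ n : ℕ, 0 < 1 / ((n : ℝ) + 3) ∧ 2 * (1 / ((n : ℝ) + 3)) < 1 := fun n => by
    refine ⟨by positivity, ?_⟩
    have : (0 : ℝ) ≤ n := Nat.cast_nonneg n
    rw [mul_one_div, div_lt_one (by positivity)]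
    linarith
  have h1 := ae_all_iff.2 fun n : ℕ => h (1 - 1 / ((n : ℝ) + 3)) (by linarith [ht n])
    (by linarith [ht n])
  have h2 := ae_all_iff.2 fun n : ℕ => h (1 - 2 * (1 / ((n : ℝ) + 3))) (by linarith [ht n])
    (by linarith [ht n])
  have hs' : χ - tau ν s = -(s * deriv (tau ν) s) := by
    simp only [tangentDepth] at hs; linarith
  -- On the ray u ↦ us, the critical equation says that the derivative at u = 1 equals the value
  -- there: the tangent passes through the origin. The parametrisation treats both signs of s at
  -- once.
  have hd : HasDerivAt (fun u => χ - tau ν (u * s)) (χ - tau ν (1 * s)) 1 := by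
    have h0 : HasDerivAt (tau ν) (deriv (tau ν) s) (1 * s) := by
      rw [one_mul]; exact (hν.differentiable_tau s).hasDerivAt
    refine ((h0.comp 1 ((hasDerivAt_id (1 : ℝ)).mul_const s)).const_sub χ).congr_deriv ?_
    rw [one_mul, hs']; ring
  filter_upwards [hreg, h1, h2] with ω hω hω1 hω2
  have := tendsto_of_convexOn (φ := fun u => χ - tau ν (u * s)) (c := c)
    (L := fun j u => Real.logb 2 (partitionFn T χ (fun m r => W m r ω) j (u * s))) hc
    (fun j => (convexOn_logb_partitionFn hω hT hχ.le j).comp_linearMap (LinearMap.mulRight ℝ s))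
    (fun j a u ha => by
      simp only [mul_assoc]
      exact logb_partitionFn_mul_le hω hT hχ.le j ha (u * s)) hd (t := fun n => 1 / ((n : ℝ) + 3)) (fun n => (ht n).1)
    (fun n => by linarith [ht n])
    (tendsto_const_nhds.div_atTop (tendsto_atTop_add_const_right _ _ tendsto_natCast_atTop_atTop))
    hω1 hω2
  convert this using 2
  rw [one_mul, hs']; ring

end Forest

end Cascade

theorem mainTheorem1 {Ω : Type*} [MeasurableSpace Ω] (P : Measure Ω) [IsProbabilityMeasure P]
    (T χ : ℝ) (hT : 0 < T) (hχ : 0 < χ)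
    -- the law `ν` of the cascade generator `W`
    (ν : Measure ℝ) [IsProbabilityMeasure ν]
    (h_pos : ∀ᵐ x ∂ν, 0 < x)
    (h_moments : ∀ q : ℝ, Integrable (fun x : ℝ => x ^ q) ν)
    (h_mean : ∫ x, x ∂ν = 1)
    (h_entropy : ∫ x, x * Real.logb 2 x ∂ν < 1)
    (h_nonconst : ν {1} < 1)
    -- either `p_χ^+ = ∞` and `τ > 0` on `(1,∞)`, or `p_χ^+ < ∞` and `τ(p_χ^+) > 0`
    (h_tau : (pPlus ν χ = ⊤ ∧ ∀ q : ℝ, 1 < q → 0 < tau ν q) ∨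
      (pPlus ν χ < ⊤ ∧ 0 < tau ν (pPlus ν χ).toReal))
    -- i.i.d. weights: `W m r` is the weight of the `m`-th cascade at the nonempty word `r`
    (W : ℕ → Word → Ω → ℝ)
    (h_law : ∀ (m : ℕ) (r : Word), r ≠ [] → HasLaw (W m r) ν P)
    (h_indep : iIndepFun (fun (i : ℕ × {r : Word // r ≠ []}) => W i.1 i.2.1) P)
    (p : ℝ) :
    ∀ᵐ ω ∂P,
      Tendsto
        (fun j : ℕ => Real.logb 2 (partitionFn T χ (fun m r => W m r ω) j p) / (-(j : ℝ)))
        atTop (𝓝 (tauMixed ν χ p)) := by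
  have hν : Cascade.GeneratorLaw ν := ⟨h_pos, h_moments, h_mean⟩
  -- The entropy condition is exactly the positivity of τ'(1) = 1 - E[W log₂ W].
  have hd1 : 0 < deriv (tau ν) 1 := by rw [hν.deriv_tau_one]; linarith
  have hforest : Cascade.IsForest ν P fun k ω => Cascade.shift k.2 fun r => W k.1 r ω :=
    Cascade.isForest_of_hasLaw (Cascade.hasLaw_subtrees h_law h_indep)
  have hplus : (1 : EReal) < pPlus ν χ := by
    by_cases h : pPlus ν χ = ⊤
    · rw [h]; exact EReal.coe_lt_top 1
    · obtain ⟨s, hs, hs1, -⟩ := hν.exists_pPlus hd1 hχ h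
      rw [hs]; exact EReal.coe_lt_coe_iff.2 hs1
  have hminus : pMinus ν χ < (0 : EReal) := by
    by_cases h : pMinus ν χ = ⊥
    · rw [h]; exact EReal.bot_lt_coe 0
    · obtain ⟨s, hs, hs1, -⟩ := hν.exists_pMinus hd1 hχ h
      rw [hs]; exact EReal.coe_lt_coe_iff.2 hs1
  have hpos : ∀ᵐ w ∂(Cascade.treeLaw ν), Cascade.limitMass w ≠ 0 := by
    obtain ⟨r, hr1, -, hr⟩ := hν.exists_tau_pos hd1 hχ h_tau (p := 1) hplus
    exact hν.ae_limitMass_pos hr1 hr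
  have hreg : ∀ᵐ ω ∂P, ∀ m i, Cascade.RegularTree (Cascade.shift i fun r => W m r ω) := by
    filter_upwards [hforest.ae_regularTree hν hpos] with ω hω m i using hω (m, i)
  have key : ∀ u : ℝ, u < pPlus ν χ → pMinus ν χ < u → ∀ᵐ ω ∂P,
      Tendsto (fun j : ℕ => Real.logb 2 (partitionFn T χ (fun m r => W m r ω) j u) / j)
        atTop (𝓝 (χ - tau ν u)) := fun u hu hu' => by
    obtain ⟨r, -, hur, hr⟩ := hν.exists_tau_pos hd1 hχ h_tau hu
    exact hforest.ae_tendsto_logb_partitionFn hν hpos hT hχ (hν.lt_tangentDepth hd1 hχ hu hu') hur hr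
  have main : ∀ᵐ ω ∂P,
      Tendsto (fun j : ℕ => Real.logb 2 (partitionFn T χ (fun m r => W m r ω) j p) / j)
        atTop (𝓝 (-tauMixed ν χ p)) := by
    unfold tauMixed
    split_ifs with h1 h2
    · obtain ⟨s, hs, hs1, hsd⟩ := hν.exists_pPlus hd1 hχ (h1.trans_lt (EReal.coe_lt_top p)).ne
      rw [hs, EReal.coe_le_coe_iff] at h1
      have hs0 : 0 < s := by linarith
      -- For 0 < u < 1 the point us lies in (0, s), hence strictly between the critical exponents; p
      -- is reached with c = p/s ≥ 1.
      have := Cascade.ae_tendsto_logb_partitionFn_of_tangent hreg hν hT hχ hsd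
        (fun u hu0 hu1 => key (u * s)
          (by rw [hs]; exact EReal.coe_lt_coe_iff.2 (by nlinarith))
          (hminus.trans (EReal.coe_lt_coe_iff.2 (mul_pos hu0 hs0))))
        (c := p / s) ((one_le_div hs0).2 h1)
      rw [div_mul_cancel₀ p hs0.ne'] at this
      rwa [hPlus, hs, EReal.toReal_coe]
    · obtain ⟨s, hs, hs0, hsd⟩ := hν.exists_pMinus hd1 hχ ((EReal.bot_lt_coe p).trans_le h2).ne'
      rw [hs, EReal.coe_le_coe_iff] at h2
      -- Now s < 0, so us lies in (s, 0), and p ≤ s again means p/s ≥ 1.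
      have := Cascade.ae_tendsto_logb_partitionFn_of_tangent hreg hν hT hχ hsd
        (fun u hu0 hu1 => key (u * s)
          ((EReal.coe_lt_coe_iff.2 (by nlinarith : u * s < 1)).trans hplus)
          (by rw [hs]; exact EReal.coe_lt_coe_iff.2 (by nlinarith)))
        (c := p / s) ((one_le_div_of_neg hs0).2 h2)
      rw [div_mul_cancel₀ p hs0.ne] at this
      rwa [hMinus, hs, EReal.toReal_coe]
    · rw [neg_sub]
      exact key p (not_le.1 h1) (not_le.1 h2)
  filter_upwards [main] with ω hω
  simpa [div_neg] using hω.neg
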